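/- **Setting.** Let $T$ be a set of first-order sentences (non-logical axioms) in a computably presented language $L$ containing the language of arithmetic $\{0,S,+,\cdot\}$. Let $\vdash$ denote provability in a fixed Hilbert calculus with equality. Assume that $T$ has a decidable set of axioms, that $T$ is consistent, that $T$ proves the axioms of Robinson arithmetic $\mathsf Q$, and that $T$ represents all computable functions: for every computable $f:\mathbb N\to\mathbb N$ there is an arithmetical formula $G_f(x,y)$ with $T\vdash\forall y\,(G_f(\overline n,y)\leftrightarrow y=\overline{f(n)})$ for all $n$. Here $\overline n$ is the numeral $S\cdots S0$, $\ulcorner\cdot\urcorner$ is a fixed effective Gödel numbering, $u\le w$ abbreviates $\exists z\,(z+u=w)$, $u\ge w$ means $w\le u$, $u<w$ abbreviates $\neg(u\ge w)$, and $y=\min z:\varphi(z)$ abbreviates $\varphi(y)\wedge\forall z\,(\varphi(z)\to y\le z)$. Call an arithmetical formula $P(x,y)$ a *proof formula* for $T$ if $T\vdash\forall y\,(P(\overline n,y)\leftrightarrow y=\overline m)$ whenever $n$ codes a $T$-proof of the sentence with code $m$, and $T\vdash\forall y\,\neg P(\overline n,y)$ whenever $n$ does not code a $T$-proof of a sentence.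 Let $f$ be the function with $f(\ulcorner A\urcorner)=\ulcorner A(\overline{\ulcorner A\urcorner})\urcorner$ for formulas $A$ of $L$ with at most the one free variable $v$, and $f(n)=0$ otherwise. Given a proof formula $P$ and a formula $G$ representing $f$, the diagonal sentence of a formula $E(v)$ is $$D(E)=\forall v\,\bigl(G(\overline{\ulcorner\forall v(G(k,v)\to E(v))\urcorner},v)\to E(v)\bigr).$$ For each $L$-sentence $s$ let $E_s(v)$ be one of $$\text{(a)}\ \ \forall x\forall y\,\bigl(P(x,v)\wedge y=\min z: P(z,\overline{\ulcorner s\urcorner})\to x\ge y\bigr),\qquad \text{(b)}\ \ \forall x\,\bigl(P(x,v)\to\exists y\,(P(y,\overline{\ulcorner s\urcorner})\wedge x\ge y)\bigr).$$ Let $h(\ulcorner s\urcorner)=\ulcorner D(E_s)\urcorner$ for sentences $s$ and $h(n)=0$ otherwise. Let $H$ represent $h$ and let $\mathrm{Dgn}(x,y)$ be $H(y,x)$. In case (a) put $$\mathrm{remote}(y):\ \exists x\exists k\exists z\,\bigl(\mathrm{Dgn}(x,y)\wedge k=\min n: P(n,y)\wedge z=\min m: P(m,x)\wedge z<k\bigr),$$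 write $t=\mathfrak K$ for $t=\min k:\exists y\,(\mathrm{remote}(y)\wedge P(k,y))$, and write $x\ge\mathfrak K$ for $\exists k\,(k=\mathfrak K\wedge x\ge k)$. In case (b) put $$\mathrm{remote}(y):\ \exists x\,\bigl(\mathrm{Dgn}(x,y)\wedge\exists z\,(P(z,x)\wedge\forall k\,(P(k,y)\to z<k))\bigr).$$ **Theorem.** $T$ is incomplete. Moreover, a proof formula $P$ and a formula $G$ representing $f$ exist, and for all such $P$ and $G$: 1. Suppose $T$ proves the axioms of $\mathsf{PA}$ (induction for arithmetical formulas). Then in case (a) a formula $H$ representing $h$ exists. For every such $H$ there is a sentence $\sigma$ of $L$ with $$T\vdash\sigma\leftrightarrow\forall x\,\bigl(P(x,\overline{\ulcorner\sigma\urcorner})\to x\ge\mathfrak K\bigr),$$ and every such $\sigma$ is neither provable nor refutable in $T$. 2. Without any induction assumption, in case (b) a formula $H$ representing $h$ exists. For every such $H$ there is a sentence $\sigma$ of $L$ with $$T\vdash\sigma\leftrightarrow\forall x\,\bigl(P(x,\overline{\ulcorner\sigma\urcorner})\to\exists y\,(\mathrm{remote}(y)\wedge P(x,y))\bigr),$$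 and every such $\sigma$ is neither provable nor refutable in $T$. -/

import Mathlib

open scoped FirstOrder

namespace Goedel

universe u v u' v'

/-! ### First-order formulas with de Bruijn indices

Terms are Mathlib's `L.Term ℕ`; the variable with index `i` below `d` quantifiers refers to the
`(i - d)`-th free variable, and index `0` directly below a quantifier is the quantified variable. -/

/-- First-order formulas with equality over the language `L`. -/
inductive Fm (L : FirstOrder.Language.{u, v}) : Type (max u v)
  | fal : Fm L
  | eq (t r : L.Term ℕ) : Fm L
  | rel {n : ℕ} (R : L.Relations n) (ts : Fin n → L.Term ℕ) : Fm L
  | imp (φ ψ : Fm L) : Fm L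
  | all (φ : Fm L) : Fm L

section FormulaOps

variable {L : FirstOrder.Language.{u, v}}

/-- Increase all variable indices of a term by one. -/
def shift (t : L.Term ℕ) : L.Term ℕ := t.relabel Nat.succ

/-- Transport of a substitution below a quantifier. -/
def up (s : ℕ → L.Term ℕ) : ℕ → L.Term ℕ
  | 0 => FirstOrder.Language.Term.var 0
  | n + 1 => shift (s n)

/-- All variables of the term have index less than `k`. -/
def TermBelow (k : ℕ) : L.Term ℕ → Prop
  | FirstOrder.Language.Term.var n => n < k
  | FirstOrder.Language.Term.func _ ts => ∀ i, TermBelow k (ts i)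

namespace Fm

/-- Simultaneous (capture avoiding) substitution of terms for the free variables. -/
def subst : Fm L → (ℕ → L.Term ℕ) → Fm L
  | fal, _ => fal
  | eq t r, s => eq (t.subst s) (r.subst s)
  | rel R ts, s => rel R (fun i => (ts i).subst s)
  | imp φ ψ, s => imp (φ.subst s) (ψ.subst s)
  | all φ, s => all (φ.subst (up s))

/-- `φ.inst t` is `φ(t)`: variable `0` is replaced by `t`, the other free variables move down. -/
def inst (φ : Fm L) (t : L.Term ℕ) : Fm L :=
  φ.subst (fun n => Nat.casesOn n t FirstOrder.Language.Term.var)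

/-- `φ.app t r` is `φ(t, r)` for a formula `φ` with the free variables `0` and `1`. -/
def app (φ : Fm L) (t r : L.Term ℕ) : Fm L :=
  φ.subst (fun n => Nat.casesOn n t (fun m => Nat.casesOn m r FirstOrder.Language.Term.var))

/-- All free variables of the formula have index less than `k`. -/
def Below : ℕ → Fm L → Prop
  | _, fal => True
  | k, eq t r => TermBelow k t ∧ TermBelow k r
  | k, rel _ ts => ∀ i, TermBelow k (ts i)
  | k, imp φ ψ => Below k φ ∧ Below k ψ
  | k, all φ => Below (k + 1) φ

/-- A sentence is a formula without free variables. -/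
def IsSentence (φ : Fm L) : Prop := Below 0 φ

def neg (φ : Fm L) : Fm L := imp φ fal

def and (φ ψ : Fm L) : Fm L := neg (imp φ (neg ψ))

def iff (φ ψ : Fm L) : Fm L := and (imp φ ψ) (imp ψ φ)

def ex (φ : Fm L) : Fm L := neg (all (neg φ))

/-- `χ₁ → (χ₂ → … → φ)`. -/
def impList (l : List (Fm L)) (φ : Fm L) : Fm L := l.foldr imp φ

/-- Translation of formulas along an inclusion (homomorphism) of languages. -/
def map {L' : FirstOrder.Language.{u', v'}} {L : FirstOrder.Language.{u, v}} (ι : L' →ᴸ L) : Fm L' → Fm L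
  | fal => fal
  | eq t r => eq (ι.onTerm t) (ι.onTerm r)
  | rel R ts => rel (ι.onRelation R) (fun i => ι.onTerm (ts i))
  | imp φ ψ => imp (map ι φ) (map ι ψ)
  | all φ => all (map ι φ)

end Fm

end FormulaOps

/-! ### A Hilbert calculus -/

section Calculus

variable {L : FirstOrder.Language.{u, v}}

/-- The logical axioms: propositional logic, quantifiers and equality. -/
inductive LogicalAx : Fm L → Prop
  | k (φ ψ : Fm L) : LogicalAx (.imp φ (.imp ψ φ))
  | s (φ ψ χ : Fm L) :
      LogicalAx (.imp (.imp φ (.imp ψ χ)) (.imp (.imp φ ψ) (.imp φ χ)))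
  | dne (φ : Fm L) : LogicalAx (.imp (.neg (.neg φ)) φ)
  | allInst (φ : Fm L) (t : L.Term ℕ) : LogicalAx (.imp (.all φ) (φ.inst t))
  | allDist (φ ψ : Fm L) :
      LogicalAx (.imp (.all (.imp φ ψ)) (.imp (.all φ) (.all ψ)))
  | allVac (φ : Fm L) :
      LogicalAx (.imp φ (.all (φ.subst (fun n => FirstOrder.Language.Term.var (n + 1)))))
  | eqRefl (t : L.Term ℕ) : LogicalAx (.eq t t)
  | eqEuclid (t r w : L.Term ℕ) : LogicalAx (.imp (.eq t r) (.imp (.eq t w) (.eq r w)))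
  | eqFunc {n : ℕ} (f : L.Functions n) (ts rs : Fin n → L.Term ℕ) :
      LogicalAx (.impList (List.ofFn fun i => .eq (ts i) (rs i))
        (.eq (FirstOrder.Language.Term.func f ts) (FirstOrder.Language.Term.func f rs)))
  | eqRel {n : ℕ} (R : L.Relations n) (ts rs : Fin n → L.Term ℕ) :
      LogicalAx (.impList (List.ofFn fun i => .eq (ts i) (rs i))
        (.imp (.rel R ts) (.rel R rs)))

/-- `φ` may follow the lines `l` in a derivation from `T`: it is a logical axiom, belongs to `T`,
or arises from lines in `l` by modus ponens or by generalization. -/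
def Step (T : Set (Fm L)) (l : List (Fm L)) (φ : Fm L) : Prop :=
  LogicalAx φ ∨ φ ∈ T ∨ (∃ ψ, ψ ∈ l ∧ Fm.imp ψ φ ∈ l) ∨ (∃ ψ, ψ ∈ l ∧ φ = Fm.all ψ)

/-- Derivations from `T`, as sequences of formulas. The list starts with the last line of the
derivation (its conclusion), and each line is justified by the lines that precede it in the
derivation, i.e. by those in the tail of the list. -/
def IsDerivation (T : Set (Fm L)) : List (Fm L) → Prop
  | [] => True
  | φ :: l => Step T l φ ∧ IsDerivation T l

/-- `T ⊢ φ`. -/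
def Provable (T : Set (Fm L)) (φ : Fm L) : Prop := ∃ l, IsDerivation T (φ :: l)

def Consistent (T : Set (Fm L)) : Prop := ¬ Provable T Fm.fal

/-- Every sentence of the language of `T` is provable or refutable in `T`. -/
def Complete (T : Set (Fm L)) : Prop :=
  ∀ s : Fm L, s.IsSentence → Provable T s ∨ Provable T s.neg

/-- `s` is neither provable nor refutable in `T`. -/
def Undecidable (T : Set (Fm L)) (s : Fm L) : Prop := ¬ Provable T s ∧ ¬ Provable T s.neg

end Calculus

/-! ### Gödel numbering -/

section Coding

variable {L : FirstOrder.Language.{u, v}} [Encodable (Σ n, L.Functions n)] [Encodable (Σ n, L.Relations n)]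

/-- Gödel numbers of terms. -/
def termCode : L.Term ℕ → ℕ
  | FirstOrder.Language.Term.var n => Nat.pair 0 n
  | FirstOrder.Language.Term.func (l := k) f ts =>
      Nat.pair 1 (Nat.pair (Encodable.encode (⟨k, f⟩ : Σ n, L.Functions n))
        (Encodable.encode (List.ofFn fun i => termCode (ts i))))

/-- Gödel numbers of formulas; the number `0` is not the code of a formula. -/
def code : Fm L → ℕ
  | .fal => Nat.pair 1 0
  | .eq t r => Nat.pair 2 (Nat.pair (termCode t) (termCode r))
  | .rel (n := k) R ts =>
      Nat.pair 3 (Nat.pair (Encodable.encode (⟨k, R⟩ : Σ n, L.Relations n))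
        (Encodable.encode (List.ofFn fun i => termCode (ts i))))
  | .imp φ ψ => Nat.pair 4 (Nat.pair (code φ) (code ψ))
  | .all φ => Nat.pair 5 (code φ)

/-- The relation `Proof_T(n, m)` on natural numbers: `n` is the code of a derivation from `T` whose
conclusion is the sentence with code `m`. -/
def ProofRel (T : Set (Fm L)) (n m : ℕ) : Prop :=
  ∃ (φ : Fm L) (l : List (Fm L)), IsDerivation T (φ :: l) ∧ φ.IsSentence ∧
    n = Encodable.encode ((φ :: l).map code) ∧ m = code φ

/-- The set of axioms `T` is decidable. -/
def RecursivelyAxiomatized (T : Set (Fm L)) : Prop :=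
  ComputablePred fun n : ℕ => ∃ φ ∈ T, code φ = n

end Coding

/-! ### Arithmetic -/

/-- The function symbols `0`, `S`, `+`, `·`. -/
inductive ArithFunc : ℕ → Type
  | zero : ArithFunc 0
  | succ : ArithFunc 1
  | add : ArithFunc 2
  | mul : ArithFunc 2

/-- The language of arithmetic. -/
def arith : FirstOrder.Language.{0, 0} := ⟨ArithFunc, fun _ => Empty⟩

abbrev ATerm : Type := arith.Term ℕ

abbrev AFm : Type := Fm arith

def var (n : ℕ) : ATerm := FirstOrder.Language.Term.var n

def zero : ATerm := FirstOrder.Language.Term.func (L := arith) ArithFunc.zero ![]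

def succ (t : ATerm) : ATerm := FirstOrder.Language.Term.func (L := arith) ArithFunc.succ ![t]

def add (t r : ATerm) : ATerm := FirstOrder.Language.Term.func (L := arith) ArithFunc.add ![t, r]

def mul (t r : ATerm) : ATerm := FirstOrder.Language.Term.func (L := arith) ArithFunc.mul ![t, r]

/-- The numeral of `n`: `n`-fold application of the successor symbol to zero. -/
def num : ℕ → ATerm
  | 0 => zero
  | n + 1 => succ (num n)

/-- `t ≤ r`, i.e. `∃ z, z + t = r`. -/
def le (t r : ATerm) : AFm := .ex (.eq (add (var 0) (shift t)) (shift r))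

/-- `t < r`, i.e. not `t ≥ r`. -/
def lt (t r : ATerm) : AFm := .neg (le r t)

/-- `t = min z : φ(z)`, where `z` is the variable `0` of `φ` (and the other variables of `φ` are
numbered as below one quantifier). -/
def isMin (φ : AFm) (t : ATerm) : AFm :=
  .and (φ.inst t) (.all (.imp φ (le (shift t) (var 0))))

/-- Robinson arithmetic. -/
inductive Q : AFm → Prop
  | succ_ne_zero : Q (.all (.neg (.eq (succ (var 0)) zero)))
  | succ_inj : Q (.all (.all (.imp (.eq (succ (var 1)) (succ (var 0))) (.eq (var 1) (var 0)))))
  | zero_or_succ :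
      Q (.all (.imp (.neg (.eq (var 0) zero)) (.ex (.eq (var 1) (succ (var 0))))))
  | add_zero : Q (.all (.eq (add (var 0) zero) (var 0)))
  | add_succ :
      Q (.all (.all (.eq (add (var 1) (succ (var 0))) (succ (add (var 1) (var 0))))))
  | mul_zero : Q (.all (.eq (mul (var 0) zero) zero))
  | mul_succ :
      Q (.all (.all (.eq (mul (var 1) (succ (var 0))) (add (mul (var 1) (var 0)) (var 1)))))

/-- Peano arithmetic: Robinson arithmetic and induction on the variable `0` for all formulas `φ` of
the language of arithmetic. The other free variables of `φ` are parameters; by the generalization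
rule such an open axiom amounts to its universal closure. -/
inductive PA : AFm → Prop
  | base (φ : AFm) : Q φ → PA φ
  | induction (φ : AFm) :
      PA (.imp (φ.inst zero)
        (.imp (.all (.imp φ
          (φ.subst (fun n => Nat.casesOn n (succ (var 0)) (fun m => var (m + 1))))))
        (.all φ)))

/-! ### Theories over arithmetic, representability, and the formulas of the proof -/

section Theory

variable {L : FirstOrder.Language.{u, v}} [Encodable (Σ n, L.Functions n)] [Encodable (Σ n, L.Relations n)]

/-- `T` proves all axioms in `A`, where `ι` includes the language of arithmetic in that of `T`. -/
def Extends (ι : arith →ᴸ L) (T : Set (Fm L)) (A : AFm → Prop) : Prop :=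
  ∀ φ, A φ → Provable T (φ.map ι)

/-- `G(x, y)` (`x`, `y` being the variables `0`, `1`) represents the function `f` in `T`:
`T ⊢ ∀ y (G(n, y) ↔ y = f(n))` for every `n`. -/
def Represents (ι : arith →ᴸ L) (T : Set (Fm L)) (G : AFm) (f : ℕ → ℕ) : Prop :=
  G.Below 2 ∧
    ∀ n, Provable T (Fm.map ι (.all (.iff (G.app (num n) (var 0)) (.eq (var 0) (num (f n))))))

/-- `T` represents every computable function. (One argument suffices, by coding of pairs.) -/
def RepresentsComputable (ι : arith →ᴸ L) (T : Set (Fm L)) : Prop :=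
  ∀ f : ℕ → ℕ, Computable f → ∃ G : AFm, Represents ι T G f

/-- `P(x, y)` represents in `T` the relation `Proof_T`, i.e. the partial function that takes the
code of a proof to the code of the sentence it proves: `T ⊢ ∀ y (P(n, y) ↔ y = m)` if `n` is the
code of a proof of `m`, and `T ⊢ ∀ y ¬ P(n, y)` if `n` is not the code of a proof. -/
def RepresentsProof (ι : arith →ᴸ L) (T : Set (Fm L)) (P : AFm) : Prop :=
  P.Below 2 ∧
    (∀ n m, ProofRel T n m →
      Provable T (Fm.map ι (.all (.iff (P.app (num n) (var 0)) (.eq (var 0) (num m)))))) ∧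
    ∀ n, (∀ m, ¬ ProofRel T n m) → Provable T (Fm.map ι (.all (.neg (P.app (num n) (var 0)))))

open Classical in
/-- The function taking the code of a formula `A(v)` in one free variable to the code of
`A(⌜A⌝)`, and all other numbers to `0`. -/
noncomputable def selfApp (ι : arith →ᴸ L) (n : ℕ) : ℕ :=
  if h : ∃ A : Fm L, A.Below 1 ∧ code A = n then code (h.choose.inst (ι.onTerm (num n))) else 0

/-- `B(k) = ∀ v (G(k, v) → E(v))`. -/
def preDiag (G E : AFm) : AFm := .all (.imp (G.app (var 1) (var 0)) E)

/-- The diagonal sentence `D(E) = B(⌜B⌝) = ∀ v (G(⌜B⌝, v) → E(v))` of the sentence form `E(v)`,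
where `B(k) = ∀ v (G(k, v) → E(v))`. -/
def diag (ι : arith →ᴸ L) (G E : AFm) : AFm :=
  (preDiag G E).inst (num (code ((preDiag G E).map ι)))

open Classical in
/-- The function `h` with `h(⌜s⌝) = ⌜D(E_s)⌝` for sentences `s` and `h(n) = 0` otherwise. The
sentence form `E_s` depends on `s` through its code only. -/
noncomputable def diagCode (ι : arith →ᴸ L) (G : AFm) (E : ℕ → AFm) (n : ℕ) : ℕ :=
  if ∃ s : Fm L, s.IsSentence ∧ code s = n then code ((diag ι G (E n)).map ι) else 0

/-- `σ` is, provably in `T`, a fixed point of the sentence form `F(v)`. -/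
def IsFixedPoint (ι : arith →ᴸ L) (T : Set (Fm L)) (F : ℕ → AFm) (σ : Fm L) : Prop :=
  σ.IsSentence ∧ Provable T (.iff σ ((F (code σ)).map ι))

end Theory

/-! #### The version with minimal proofs. -/

/-- `E_s(v)`: `∀ x ∀ y (Proof(x, v) ∧ y = min z : Proof(z, ⌜s⌝) → x ≥ y)`, with `c = ⌜s⌝`. -/
def extMin (P : AFm) (c : ℕ) : AFm :=
  .all (.all (.imp (.and (P.app (var 1) (var 2)) (isMin (P.app (var 0) (num c)) (var 0)))
    (le (var 0) (var 1))))

/-- `remote(y)`: `∃ x ∃ k ∃ z (Dgn(x, y) ∧ k = min n : Proof(n, y) ∧ z = min m : Proof(m, x) ∧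
z < k)`, where `Dgn(x, y)` is `H(y, x)`. -/
def remoteMin (P H : AFm) : AFm :=
  .ex (.ex (.ex (.and (H.app (var 3) (var 2)) (.and (isMin (P.app (var 0) (var 4)) (var 1))
    (.and (isMin (P.app (var 0) (var 3)) (var 0)) (lt (var 0) (var 1)))))))

/-- `t = 𝔎`: `t = min k : ∃ y (remote(y) ∧ Proof(k, y))`. -/
def isK (P H : AFm) (t : ATerm) : AFm :=
  isMin (.ex (.and (remoteMin P H) (P.app (var 1) (var 0)))) t

/-- `∀ x (Proof(x, c) → x ≥ 𝔎)`, where `x ≥ 𝔎` is `∃ k (k = 𝔎 ∧ k ≤ x)`. -/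
def formMin (P H : AFm) (c : ℕ) : AFm :=
  .all (.imp (P.app (var 0) (num c)) (.ex (.and (isK P H (var 0)) (le (var 0) (var 1)))))

/-! #### The version without minimality. -/

/-- `E_s(v)`: `∀ x (Proof(x, v) → ∃ y (Proof(y, ⌜s⌝) ∧ x ≥ y))`, with `c = ⌜s⌝`. -/
def ext (P : AFm) (c : ℕ) : AFm :=
  .all (.imp (P.app (var 0) (var 1)) (.ex (.and (P.app (var 0) (num c)) (le (var 0) (var 1)))))

/-- `remote(y)`: `∃ x (Dgn(x, y) ∧ ∃ z (Proof(z, x) ∧ ∀ k (Proof(k, y) → z < k)))`, where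
`Dgn(x, y)` is `H(y, x)`. -/
def remote (P H : AFm) : AFm :=
  .ex (.and (H.app (var 1) (var 0))
    (.ex (.and (P.app (var 0) (var 1)) (.all (.imp (P.app (var 0) (var 3)) (lt (var 1) (var 0)))))))

/-- `∀ x (Proof(x, c) → ∃ y (remote(y) ∧ Proof(x, y)))`. -/
def form (P H : AFm) (c : ℕ) : AFm :=
  .all (.imp (P.app (var 0) (num c)) (.ex (.and (remote P H) (P.app (var 1) (var 0)))))

end Goedel

/-!
The proof is semantic. By the completeness theorem for the given Hilbert calculus
(`provable_of_forall_model`), a sentence is provable in `T` if and only if it holds in all models of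
`T`, so every claim of provability becomes a claim about models of `T`. In a model of Robinson
arithmetic the numerals form an initial segment: whatever lies below a standard number is standard.
At standard arguments, a proof formula has exactly the values prescribed by the actual proofs
(`RepresentsProof.sat₂_iff`), so that in a model every proof below a standard one is an actual proof.

That the functions in question are computable, and so representable, rests on a single principle:
a function on codes defined by recursion on smaller codes is computable
(`exists_computable_rec`, a consequence of Kleene's recursion theorem). It yields the computability
of substitution, the decidability of the syntactic classes and of the logical axioms, hence of the
proof relation (`exists_computable_proofRel`), and so the computability of `selfApp` and `diagCode`.

Fixed points are obtained by the usual diagonalization (`exists_isFixedPoint`). For a sentence `s`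
let `D` be the diagonal sentence of `E_s`; it says that below each of its own proofs there is a proof
of `s`, while `remote(s)` says that some proof of `D` lies below all proofs of `s`.

In the version without minimality (`undecidable_of_isFixedPoint_form`), `σ` says that each proof of
`σ` proves a remote sentence. Suppose that a number `n` proves `σ`. In a model of `T` the sentence
proved by `n`, which is `σ` itself, is remote, so that some proof of the corresponding `D` lies below
all proofs of `σ`, in particular below `n`. That proof is standard, hence an actual one, so `D` is
true in the model and provides a proof of `σ` below it, a contradiction. Suppose that `σ` is
refutable. Then in every model of `T` some proof of `σ` proves no remote sentence, so `σ` is not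
remote, no proof of `D` lies below all proofs of `σ`, and `D` is true. Hence `D` has an actual proof;
the proof of `σ` below it that `D` provides is standard, so `σ` is provable as well, against
consistency. The version with least proofs (`undecidable_of_isFixedPoint_formMin`) follows the same
pattern. Induction enters through the least number principle (`PAModel.exists_min`).
-/

namespace Goedel

open FirstOrder.Language (Term)
open Encodable

universe u v w u' v'

/-! ### Substitution -/

section Substitution

variable {L : FirstOrder.Language.{u, v}}

theorem term_subst_var (t : L.Term ℕ) : t.subst Term.var = t := by
  induction t with
  | var n => rfl
  | func f ts ih => simp only [Term.subst, ih]

theorem term_subst_subst (t : L.Term ℕ) (s s' : ℕ → L.Term ℕ) :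
    (t.subst s).subst s' = t.subst fun n => (s n).subst s' := by
  induction t with
  | var n => rfl
  | func f ts ih => simp only [Term.subst, ih]

theorem shift_eq_subst (t : L.Term ℕ) : shift t = t.subst fun n => Term.var (n + 1) := by
  induction t with
  | var n => rfl
  | func f ts ih =>
    simp only [shift, Term.relabel, Term.subst, Term.func.injEq, heq_eq_eq, true_and] at ih ⊢
    exact funext ih

@[simp] theorem shift_var (n : ℕ) : shift (Term.var n : L.Term ℕ) = Term.var (n + 1) := rfl

@[simp] theorem up_var : up (Term.var : ℕ → L.Term ℕ) = Term.var := by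
  funext n; cases n <;> rfl

theorem shift_subst_up (t : L.Term ℕ) (s : ℕ → L.Term ℕ) :
    (shift t).subst (up s) = shift (t.subst s) := by
  simp only [shift_eq_subst, term_subst_subst]
  congr 1; funext n
  simp [Term.subst, up, shift_eq_subst]

theorem up_comp (s s' : ℕ → L.Term ℕ) :
    (fun n => (up s n).subst (up s')) = up fun n => (s n).subst s' := by
  funext n
  cases n with
  | zero => rfl
  | succ n => exact shift_subst_up _ _

theorem termBelow_mono {k m : ℕ} (h : k ≤ m) (t : L.Term ℕ) (ht : TermBelow k t) :
    TermBelow m t := by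
  induction t with
  | var n => exact lt_of_lt_of_le ht h
  | func f ts ih => exact fun i => ih i (ht i)

theorem exists_forall_fin_of_mono {n : ℕ} {p : Fin n → ℕ → Prop}
    (hp : ∀ i k m, k ≤ m → p i k → p i m) (h : ∀ i, ∃ k, p i k) : ∃ k, ∀ i, p i k := by
  choose f hf using h
  exact ⟨Finset.univ.sup f, fun i => hp i _ _ (Finset.le_sup (Finset.mem_univ i)) (hf i)⟩

theorem exists_termBelow (t : L.Term ℕ) : ∃ k, TermBelow k t := by
  induction t with
  | var n => exact ⟨n + 1, Nat.lt_succ_self n⟩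
  | func f ts ih =>
    exact exists_forall_fin_of_mono (fun i k m h => termBelow_mono h (ts i)) ih

theorem term_subst_congr {k : ℕ} (t : L.Term ℕ) (ht : TermBelow k t) {s s' : ℕ → L.Term ℕ}
    (h : ∀ i < k, s i = s' i) : t.subst s = t.subst s' := by
  induction t with
  | var n => exact h n ht
  | func f ts ih =>
    simp only [Term.subst, Term.func.injEq, heq_eq_eq, true_and]
    exact funext fun i => ih i (ht i)

theorem termBelow_subst {k m : ℕ} (t : L.Term ℕ) (ht : TermBelow k t) {s : ℕ → L.Term ℕ}
    (h : ∀ i < k, TermBelow m (s i)) : TermBelow m (t.subst s) := by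
  induction t with
  | var n => exact h n ht
  | func f ts ih => exact fun i => ih i (ht i)

theorem termBelow_shift {k : ℕ} (t : L.Term ℕ) (ht : TermBelow k t) :
    TermBelow (k + 1) (shift t) := by
  rw [shift_eq_subst]
  exact termBelow_subst t ht fun i hi => Nat.succ_lt_succ hi

theorem termBelow_up {k m : ℕ} {s : ℕ → L.Term ℕ} (h : ∀ i < k, TermBelow m (s i)) :
    ∀ i < k + 1, TermBelow (m + 1) (up s i)
  | 0, _ => Nat.succ_pos m
  | i + 1, hi => termBelow_shift _ (h i (Nat.lt_of_succ_lt_succ hi))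

theorem up_congr {k : ℕ} {s s' : ℕ → L.Term ℕ} (h : ∀ i < k, s i = s' i) :
    ∀ i < k + 1, up s i = up s' i
  | 0, _ => rfl
  | i + 1, hi => congrArg shift (h i (Nat.lt_of_succ_lt_succ hi))

namespace Fm

theorem subst_var (φ : Fm L) : φ.subst Term.var = φ := by
  induction φ with
  | fal => rfl
  | eq t r => simp only [subst, term_subst_var]
  | rel R ts => simp only [subst, term_subst_var]
  | imp φ ψ ihφ ihψ => simp only [subst, ihφ, ihψ]
  | all φ ih => simp only [subst, up_var, ih]

theorem subst_subst (φ : Fm L) (s s' : ℕ → L.Term ℕ) :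
    (φ.subst s).subst s' = φ.subst fun n => (s n).subst s' := by
  induction φ generalizing s s' with
  | fal => rfl
  | eq t r => simp only [subst, term_subst_subst]
  | rel R ts => simp only [subst, term_subst_subst]
  | imp φ ψ ihφ ihψ => simp only [subst, ihφ, ihψ]
  | all φ ih => simp only [subst, ih, up_comp]

theorem subst_congr (φ : Fm L) {k : ℕ} (hφ : φ.Below k) {s s' : ℕ → L.Term ℕ}
    (h : ∀ i < k, s i = s' i) : φ.subst s = φ.subst s' := by
  induction φ generalizing k s s' with
  | fal => rfl
  | eq t r => simp only [subst, term_subst_congr t hφ.1 h, term_subst_congr r hφ.2 h]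
  | rel R ts =>
    simp only [subst, rel.injEq, heq_eq_eq, true_and]
    exact funext fun i => term_subst_congr (ts i) (hφ i) h
  | imp φ ψ ihφ ihψ => simp only [subst, ihφ hφ.1 h, ihψ hφ.2 h]
  | all φ ih => simp only [subst, ih hφ (up_congr h)]

theorem IsSentence.subst_eq {φ : Fm L} (hφ : φ.IsSentence) (s : ℕ → L.Term ℕ) :
    φ.subst s = φ :=
  (subst_congr φ hφ fun _ hi => absurd hi (Nat.not_lt_zero _)).trans φ.subst_var

theorem Below.mono {φ : Fm L} {k m : ℕ} (hφ : φ.Below k) (h : k ≤ m) : φ.Below m := by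
  induction φ generalizing k m with
  | fal => trivial
  | eq t r => exact ⟨termBelow_mono h t hφ.1, termBelow_mono h r hφ.2⟩
  | rel R ts => exact fun i => termBelow_mono h (ts i) (hφ i)
  | imp φ ψ ihφ ihψ => exact ⟨ihφ hφ.1 h, ihψ hφ.2 h⟩
  | all φ ih => exact ih (k := k + 1) hφ (Nat.succ_le_succ h)

theorem exists_below (φ : Fm L) : ∃ k, φ.Below k := by
  induction φ with
  | fal => exact ⟨0, trivial⟩
  | eq t r =>
    obtain ⟨k, hk⟩ := exists_termBelow t
    obtain ⟨m, hm⟩ := exists_termBelow r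
    exact ⟨max k m, termBelow_mono (le_max_left _ _) t hk, termBelow_mono (le_max_right _ _) r hm⟩
  | rel R ts =>
    exact exists_forall_fin_of_mono (fun i k m h => termBelow_mono h (ts i))
      fun i => exists_termBelow (ts i)
  | imp φ ψ ihφ ihψ =>
    obtain ⟨k, hk⟩ := ihφ
    obtain ⟨m, hm⟩ := ihψ
    exact ⟨max k m, hk.mono (le_max_left _ _), hm.mono (le_max_right _ _)⟩
  | all φ ih =>
    obtain ⟨k, hk⟩ := ih
    exact ⟨k, hk.mono (Nat.le_succ k)⟩

theorem Below.subst {φ : Fm L} {k m : ℕ} (hφ : φ.Below k) {s : ℕ → L.Term ℕ}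
    (h : ∀ i < k, TermBelow m (s i)) : (φ.subst s).Below m := by
  induction φ generalizing k m s with
  | fal => trivial
  | eq t r => exact ⟨termBelow_subst t hφ.1 h, termBelow_subst r hφ.2 h⟩
  | rel R ts => exact fun i => termBelow_subst (ts i) (hφ i) h
  | imp φ ψ ihφ ihψ => exact ⟨ihφ hφ.1 h, ihψ hφ.2 h⟩
  | all φ ih => exact ih (k := k + 1) hφ (termBelow_up h)

theorem inst_subst (φ : Fm L) (t : L.Term ℕ) (s : ℕ → L.Term ℕ) :
    (φ.inst t).subst s = (φ.subst (up s)).inst (t.subst s) := by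
  simp only [inst, subst_subst]
  congr 1; funext n
  cases n with
  | zero => rfl
  | succ n => simp only [Term.subst, up, shift_eq_subst, term_subst_subst, term_subst_var]

theorem lift_subst_up (φ : Fm L) (s : ℕ → L.Term ℕ) :
    (φ.subst fun n => Term.var (n + 1)).subst (up s) =
      (φ.subst s).subst fun n => Term.var (n + 1) := by
  simp only [subst_subst]
  congr 1; funext n
  simp only [Term.subst, up, shift_eq_subst]

theorem impList_subst (l : List (Fm L)) (φ : Fm L) (s : ℕ → L.Term ℕ) :
    (impList l φ).subst s = impList (l.map fun ψ => ψ.subst s) (φ.subst s) := by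
  induction l with
  | nil => rfl
  | cons ψ l ih =>
    simp only [impList, List.foldr, subst, List.map] at ih ⊢
    rw [ih]

end Fm

/-- The substitution of `t` for the variable `k` below `k` quantifiers. -/
def instAt (k : ℕ) (t : L.Term ℕ) (i : ℕ) : L.Term ℕ :=
  if i < k then .var i else if i = k then t else .var (i - 1)

theorem up_instAt (k : ℕ) (t : L.Term ℕ) : up (instAt k t) = instAt (k + 1) (shift t) := by
  funext i
  cases i with
  | zero => simp [up, instAt]
  | succ i =>
    simp only [up, instAt, Nat.add_lt_add_iff_right, Nat.add_right_cancel_iff]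
    split_ifs with h1 h2
    · rfl
    · rfl
    · obtain ⟨j, rfl⟩ := Nat.exists_eq_succ_of_ne_zero (show i ≠ 0 by omega)
      rfl

theorem inst_eq_subst_instAt (φ : Fm L) (t : L.Term ℕ) : φ.inst t = φ.subst (instAt 0 t) := by
  rw [Fm.inst]
  congr 1; funext i
  cases i <;> simp [instAt]

end Substitution

/-! ### Derivability -/

section Derivability

variable {L : FirstOrder.Language.{u, v}} {T : Set (Fm L)} {φ ψ χ : Fm L}

theorem Step.mono {l l' : List (Fm L)} (h : ∀ χ ∈ l, χ ∈ l') : Step T l φ → Step T l' φ := by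
  rintro (h1 | h1 | ⟨ψ, h1, h2⟩ | ⟨ψ, h1, h2⟩)
  · exact .inl h1
  · exact .inr (.inl h1)
  · exact .inr (.inr (.inl ⟨ψ, h _ h1, h _ h2⟩))
  · exact .inr (.inr (.inr ⟨ψ, h _ h1, h2⟩))

theorem IsDerivation.append {l l' : List (Fm L)} (h : IsDerivation T l) (h' : IsDerivation T l') :
    IsDerivation T (l ++ l') := by
  induction l with
  | nil => exact h'
  | cons φ l ih => exact ⟨h.1.mono fun χ hχ => List.mem_append_left _ hχ, ih h.2⟩

theorem Provable.of_logicalAx (h : LogicalAx φ) : Provable T φ := ⟨[], .inl h, trivial⟩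

theorem Provable.of_mem (h : φ ∈ T) : Provable T φ := ⟨[], .inr (.inl h), trivial⟩

theorem Provable.mp (h : Provable T (.imp φ ψ)) (h' : Provable T φ) : Provable T ψ := by
  obtain ⟨l, hl⟩ := h
  obtain ⟨l', hl'⟩ := h'
  exact ⟨_, .inr (.inr (.inl ⟨φ, by simp, by simp⟩)), hl.append hl'⟩

theorem Provable.false_of_neg (hcons : Consistent T) (h : Provable T φ)
    (h' : Provable T φ.neg) : False := hcons (h'.mp h)

theorem Provable.gen (h : Provable T φ) : Provable T (.all φ) := by
  obtain ⟨l, hl⟩ := h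
  exact ⟨_, .inr (.inr (.inr ⟨φ, by simp, rfl⟩)), hl⟩

/-- Induction over derivations. -/
theorem Provable.induction {p : Fm L → Prop} (hax : ∀ φ, LogicalAx φ → p φ) (hT : ∀ φ ∈ T, p φ)
    (hmp : ∀ φ ψ, p (.imp φ ψ) → p φ → p ψ) (hgen : ∀ φ, p φ → p (.all φ))
    (h : Provable T φ) : p φ := by
  have key : ∀ l : List (Fm L), IsDerivation T l → ∀ χ ∈ l, p χ := by
    intro l
    induction l with
    | nil => simp
    | cons χ l ih =>
      intro hl
      have ih' := ih hl.2
      refine List.forall_mem_cons.2 ⟨?_, ih'⟩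
      rcases hl.1 with h1 | h1 | ⟨ψ, h1, h2⟩ | ⟨ψ, h1, h2⟩
      · exact hax _ h1
      · exact hT _ h1
      · exact hmp _ _ (ih' _ h2) (ih' _ h1)
      · exact h2 ▸ hgen _ (ih' _ h1)
  obtain ⟨l, hl⟩ := h
  exact key _ hl φ (by simp)

theorem LogicalAx.subst (h : LogicalAx φ) (s : ℕ → L.Term ℕ) : LogicalAx (φ.subst s) := by
  induction h with
  | k φ ψ => exact .k _ _
  | s φ ψ χ => exact .s _ _ _
  | dne φ => exact .dne _
  | allInst φ t =>
    rw [Fm.subst, Fm.inst_subst]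
    exact .allInst _ _
  | allDist φ ψ => exact .allDist _ _
  | allVac φ =>
    rw [Fm.subst, Fm.subst, Fm.lift_subst_up]
    exact .allVac _
  | eqRefl t => exact .eqRefl _
  | eqEuclid t r w => exact .eqEuclid _ _ _
  | eqFunc f ts rs =>
    rw [Fm.impList_subst, List.map_ofFn]
    exact .eqFunc f _ _
  | eqRel R ts rs =>
    rw [Fm.impList_subst, List.map_ofFn]
    exact .eqRel R _ _

/-- The theorems of a set of sentences are closed under substitution. -/
theorem Provable.subst (hT : ∀ φ ∈ T, φ.IsSentence) (h : Provable T φ) (s : ℕ → L.Term ℕ) :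
    Provable T (φ.subst s) := by
  refine Provable.induction (p := fun φ => ∀ s, Provable T (φ.subst s)) ?_ ?_ ?_ ?_ h s
  · exact fun φ h s => .of_logicalAx (h.subst s)
  · intro φ h s
    rw [(hT φ h).subst_eq]
    exact .of_mem h
  · exact fun φ ψ h h' s => (h s).mp (h' s)
  · exact fun φ h s => (h (up s)).gen

/-- `Der T Γ φ`: `φ` follows by modus ponens from theorems of `T` and the assumptions `Γ`. The
generalization rule is not applied to assumptions, so that their free variables act as
constants. -/
inductive Der (T Γ : Set (Fm L)) : Fm L → Prop
  | thm {φ : Fm L} : Provable T φ → Der T Γ φ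
  | hyp {φ : Fm L} : φ ∈ Γ → Der T Γ φ
  | mp {φ ψ : Fm L} : Der T Γ (.imp φ ψ) → Der T Γ φ → Der T Γ ψ

namespace Der

variable {Γ Δ : Set (Fm L)}

theorem ax (h : LogicalAx φ) : Der T Γ φ := .thm (.of_logicalAx h)

theorem mono (h : Γ ⊆ Δ) (hφ : Der T Γ φ) : Der T Δ φ := by
  induction hφ with
  | thm h1 => exact .thm h1
  | hyp h1 => exact .hyp (h h1)
  | mp _ _ ih ih' => exact .mp ih ih'

theorem imp_self : Der T Γ (.imp φ φ) :=
  .mp (.mp (.ax (.s φ (.imp φ φ) φ)) (.ax (.k _ _))) (.ax (.k _ _))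

/-- The deduction theorem. -/
theorem intro (h : Der T (insert φ Γ) ψ) : Der T Γ (.imp φ ψ) := by
  induction h with
  | thm h1 => exact .mp (.ax (.k _ _)) (.thm h1)
  | hyp h1 =>
    rcases h1 with rfl | h1
    · exact imp_self
    · exact .mp (.ax (.k _ _)) (.hyp h1)
  | mp _ _ ih ih' => exact .mp (.mp (.ax (.s _ _ _)) ih) ih'

theorem head : Der T (insert φ Γ) φ := .hyp (Set.mem_insert _ _)

theorem weaken (h : Der T Γ φ) : Der T (insert ψ Γ) φ := h.mono (Set.subset_insert _ _)

theorem by_contra (h : Der T (insert (.neg φ) Γ) .fal) : Der T Γ φ :=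
  .mp (.ax (.dne φ)) h.intro

theorem exfalso (h : Der T Γ .fal) : Der T Γ φ := by_contra h.weaken

theorem of_empty (h : Der T ∅ φ) : Provable T φ := by
  induction h with
  | thm h1 => exact h1
  | hyp h1 => exact absurd h1 (Set.notMem_empty _)
  | mp _ _ ih ih' => exact ih.mp ih'

/-- Derivations use finitely many assumptions. -/
theorem exists_of_iUnion {Γ : ℕ → Set (Fm L)} (hΓ : Monotone Γ) (h : Der T (⋃ n, Γ n) φ) :
    ∃ n, Der T (Γ n) φ := by
  induction h with
  | thm h1 => exact ⟨0, .thm h1⟩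
  | hyp h1 =>
    obtain ⟨n, hn⟩ := Set.mem_iUnion.1 h1
    exact ⟨n, .hyp hn⟩
  | mp _ _ ih ih' =>
    obtain ⟨n, hn⟩ := ih
    obtain ⟨m, hm⟩ := ih'
    exact ⟨max n m, .mp (hn.mono (hΓ (le_max_left _ _))) (hm.mono (hΓ (le_max_right _ _)))⟩

theorem of_gen
    (h : Der T ((fun χ : Fm L => χ.subst fun n => Term.var (n + 1)) '' Γ) φ) :
    Der T Γ (.all φ) := by
  induction h with
  | thm h1 => exact .thm h1.gen
  | hyp h1 =>
    obtain ⟨χ, hχ, rfl⟩ := h1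
    exact .mp (.ax (.allVac χ)) (.hyp hχ)
  | mp _ _ ih ih' => exact .mp (.mp (.ax (.allDist _ _)) ih) ih'

theorem subst (hT : ∀ φ ∈ T, φ.IsSentence) (h : Der T Γ φ) (s : ℕ → L.Term ℕ) :
    Der T ((fun χ : Fm L => χ.subst s) '' Γ) (φ.subst s) := by
  induction h with
  | thm h1 => exact .thm (h1.subst hT s)
  | hyp h1 => exact .hyp ⟨_, h1, rfl⟩
  | mp _ _ ih ih' => exact .mp ih ih'

/-- Generalization over a variable that is fresh for the assumptions. -/
theorem all_of_fresh (hT : ∀ φ ∈ T, φ.IsSentence) {m : ℕ} (hΓ : ∀ χ ∈ Γ, χ.Below m)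
    (hφ : φ.Below (m + 1)) (h : Der T Γ (φ.inst (.var m))) : Der T Γ (.all φ) := by
  -- rename the fresh variable `m` to `0` and shift the variables below `m` up by one
  have h1 := h.subst hT fun n => if n = m then .var 0 else .var (n + 1)
  have h2 : (fun χ : Fm L => χ.subst fun n => if n = m then .var 0 else .var (n + 1)) '' Γ =
      (fun χ : Fm L => χ.subst fun n => Term.var (n + 1)) '' Γ :=
    Set.image_congr fun χ hχ => Fm.subst_congr χ (hΓ χ hχ) fun i hi => if_neg hi.ne
  have h3 : (φ.inst (.var m)).subst (fun n => if n = m then .var 0 else .var (n + 1)) = φ := by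
    rw [Fm.inst, Fm.subst_subst]
    refine (Fm.subst_congr φ hφ fun i hi => ?_).trans φ.subst_var
    cases i with
    | zero => simp [Term.subst]
    | succ i => simp [Term.subst, (Nat.lt_of_succ_lt_succ hi).ne]
  rw [h2, h3] at h1
  exact of_gen h1

end Der

end Derivability

/-! ### Tarski semantics and soundness -/

section Semantics

variable {L : FirstOrder.Language.{u, v}} {M : Type w}

/-- The assignment `a, v 0, v 1, …`. -/
def scons {α : Type w} (a : α) (v : ℕ → α) : ℕ → α := fun n => Nat.casesOn n a v

@[simp] theorem scons_zero {α : Type w} (a : α) (v : ℕ → α) : scons a v 0 = a := rfl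

@[simp] theorem scons_succ {α : Type w} (a : α) (v : ℕ → α) (n : ℕ) : scons a v (n + 1) = v n := rfl

@[simp] theorem realize_shift [L.Structure M] (t : L.Term ℕ) (a : M) (v : ℕ → M) :
    (shift t).realize (scons a v) = t.realize v := by
  rw [shift, Term.realize_relabel]; rfl

theorem realize_up [L.Structure M] (s : ℕ → L.Term ℕ) (a : M) (v : ℕ → M) :
    (fun n => (up s n).realize (scons a v)) = scons a fun n => (s n).realize v := by
  funext n
  cases n with
  | zero => rfl
  | succ n => exact realize_shift _ _ _

theorem realize_congr [L.Structure M] {k : ℕ} {t : L.Term ℕ} (ht : TermBelow k t) {v v' : ℕ → M}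
    (h : ∀ i < k, v i = v' i) : t.realize v = t.realize v' := by
  induction t with
  | var n => exact h n ht
  | func f ts ih =>
    simp only [Term.realize_func]
    congr 1
    exact funext fun i => ih i (ht i)

namespace Fm

/-- Truth of a formula in a structure under an assignment to its free variables. -/
def Sat [L.Structure M] : Fm L → (ℕ → M) → Prop
  | fal, _ => False
  | eq t r, v => t.realize v = r.realize v
  | rel R ts, v => FirstOrder.Language.Structure.RelMap R fun i => (ts i).realize v
  | imp φ ψ, v => φ.Sat v → ψ.Sat v
  | all φ, v => ∀ a, φ.Sat (scons a v)

variable [L.Structure M] {φ ψ : Fm L} {v : ℕ → M}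

@[simp] theorem sat_fal : (fal : Fm L).Sat v ↔ False := Iff.rfl

@[simp] theorem sat_eq {t r : L.Term ℕ} : (eq t r).Sat v ↔ t.realize v = r.realize v := Iff.rfl

@[simp] theorem sat_imp : (imp φ ψ).Sat v ↔ (φ.Sat v → ψ.Sat v) := Iff.rfl

@[simp] theorem sat_all : (all φ).Sat v ↔ ∀ a, φ.Sat (scons a v) := Iff.rfl

@[simp] theorem sat_neg : φ.neg.Sat v ↔ ¬ φ.Sat v := Iff.rfl

@[simp] theorem sat_and : (φ.and ψ).Sat v ↔ φ.Sat v ∧ ψ.Sat v := by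
  simp [Fm.and]

@[simp] theorem sat_iff : (φ.iff ψ).Sat v ↔ (φ.Sat v ↔ ψ.Sat v) := by
  simp [Fm.iff, iff_def]

@[simp] theorem sat_ex : φ.ex.Sat v ↔ ∃ a, φ.Sat (scons a v) := by
  simp [ex]

theorem sat_impList {l : List (Fm L)} :
    (impList l φ).Sat v ↔ ((∀ χ ∈ l, χ.Sat v) → φ.Sat v) := by
  induction l with
  | nil => simp [impList]
  | cons χ l ih =>
    simp only [impList, List.foldr, sat_imp, List.forall_mem_cons, and_imp] at ih ⊢
    exact imp_congr_right fun _ => ih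

theorem sat_subst {s : ℕ → L.Term ℕ} :
    (φ.subst s).Sat v ↔ φ.Sat fun n => (s n).realize v := by
  induction φ generalizing s v with
  | fal => rfl
  | eq t r => simp only [subst, sat_eq, Term.realize_subst]
  | rel R ts => simp only [subst, Sat, Term.realize_subst]
  | imp φ ψ ihφ ihψ => simp only [subst, sat_imp, ihφ, ihψ]
  | all φ ih => simp only [subst, sat_all, ih, realize_up]

@[simp] theorem sat_inst {t : L.Term ℕ} : (φ.inst t).Sat v ↔ φ.Sat (scons (t.realize v) v) := by
  rw [inst, sat_subst]
  refine iff_of_eq (congrArg _ (funext fun n => ?_))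
  cases n <;> rfl

theorem sat_congr {k : ℕ} (hφ : φ.Below k) {v v' : ℕ → M} (h : ∀ i < k, v i = v' i) :
    φ.Sat v ↔ φ.Sat v' := by
  induction φ generalizing k v v' with
  | fal => rfl
  | eq t r => rw [sat_eq, sat_eq, realize_congr hφ.1 h, realize_congr hφ.2 h]
  | rel R ts =>
    simp only [Sat]
    rw [funext fun i => realize_congr (hφ i) h]
  | imp φ ψ ihφ ihψ => rw [sat_imp, sat_imp, ihφ hφ.1 h, ihψ hφ.2 h]
  | all φ ih =>
    refine forall_congr' fun a => ih (k := k + 1) hφ fun i hi => ?_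
    cases i with
    | zero => rfl
    | succ i => exact h i (Nat.lt_of_succ_lt_succ hi)

theorem IsSentence.sat_iff (hφ : φ.IsSentence) (v v' : ℕ → M) : φ.Sat v ↔ φ.Sat v' :=
  sat_congr hφ fun _ hi => absurd hi (Nat.not_lt_zero _)

end Fm

theorem LogicalAx.sat [L.Structure M] {φ : Fm L} (h : LogicalAx φ) (v : ℕ → M) : φ.Sat v := by
  cases h with
  | k φ ψ => exact fun h _ => h
  | s φ ψ χ => exact fun h h' h'' => h h'' (h' h'')
  | dne φ => exact fun h => not_not.1 h
  | allInst φ t => exact fun h => Fm.sat_inst.2 (h _)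
  | allDist φ ψ => exact fun h h' a => h a (h' a)
  | allVac φ => exact fun h a => Fm.sat_subst.2 h
  | eqRefl t => exact rfl
  | eqEuclid t r w => exact fun h h' => h.symm.trans h'
  | eqFunc f ts rs =>
    refine Fm.sat_impList.2 fun h => ?_
    simp only [List.forall_mem_ofFn_iff, Fm.sat_eq] at h
    simp only [Fm.sat_eq, Term.realize_func, h]
  | eqRel R ts rs =>
    refine Fm.sat_impList.2 fun h => ?_
    simp only [List.forall_mem_ofFn_iff, Fm.sat_eq] at h
    simp only [Fm.Sat, h, imp_self]

/-- The structure `M` is a model of `T`. -/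
def Models (M : Type w) [L.Structure M] (T : Set (Fm L)) : Prop :=
  ∀ φ ∈ T, ∀ v : ℕ → M, φ.Sat v

theorem Provable.sat [L.Structure M] {T : Set (Fm L)} (hM : Models M T) {φ : Fm L}
    (h : Provable T φ) (v : ℕ → M) : φ.Sat v :=
  Provable.induction (p := fun φ => ∀ v : ℕ → M, φ.Sat v) (fun _ h => h.sat) hM
    (fun _ _ h h' v => h v (h' v)) (fun _ h v a => h (scons a v)) h v

end Semantics

/-! ### The completeness theorem -/

section Completeness

variable {L : FirstOrder.Language.{u, v}} {T : Set (Fm L)}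

/-- Consistent and complete sets of formulas that contain a counterexample to every universal
formula they refute. The counterexamples are free variables, so that no new constants are
needed. -/
structure IsHenkin (T Δ : Set (Fm L)) : Prop where
  consistent : ¬ Der T Δ .fal
  complete : ∀ φ, φ ∈ Δ ∨ φ.neg ∈ Δ
  witness : ∀ φ, (Fm.all φ).neg ∈ Δ → ∃ t, (φ.inst t).neg ∈ Δ

theorem exists_below_of_finite {Γ : Set (Fm L)} (h : Γ.Finite) : ∃ m, ∀ χ ∈ Γ, χ.Below m := by
  induction Γ, h using Set.Finite.induction_on with
  | empty => exact ⟨0, fun _ h => absurd h (Set.notMem_empty _)⟩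
  | @insert φ Γ _ _ ih =>
    obtain ⟨m, hm⟩ := ih
    obtain ⟨k, hk⟩ := φ.exists_below
    refine ⟨max k m, ?_⟩
    rintro χ (rfl | hχ)
    · exact hk.mono (le_max_left _ _)
    · exact (hm χ hχ).mono (le_max_right _ _)

/-- One step of the Henkin construction. -/
theorem exists_henkin_step (hT : ∀ φ ∈ T, φ.IsSentence) {Γ : Set (Fm L)} (hfin : Γ.Finite)
    (hcon : ¬ Der T Γ .fal) (φ : Fm L) :
    ∃ Δ : Set (Fm L), (Δ.Finite ∧ ¬ Der T Δ .fal) ∧ Γ ⊆ Δ ∧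
      (φ ∈ Δ ∨ φ.neg ∈ Δ ∧ ∀ ψ, φ = .all ψ → ∃ t, (ψ.inst t).neg ∈ Δ) := by
  by_cases h : Der T (insert φ Γ) .fal
  · have hneg : ¬ Der T (insert φ.neg Γ) .fal := fun h' => hcon (.mp h'.intro h.intro)
    by_cases hall : ∃ ψ, φ = .all ψ
    · obtain ⟨ψ, rfl⟩ := hall
      obtain ⟨m, hm⟩ := exists_below_of_finite (hfin.insert (Fm.all ψ).neg)
      refine ⟨insert (ψ.inst (.var m)).neg (insert (Fm.all ψ).neg Γ),
        ⟨(hfin.insert _).insert _, fun h' => ?_⟩,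
        (Set.subset_insert _ _).trans (Set.subset_insert _ _), .inr ⟨.inr (.inl rfl), ?_⟩⟩
      · have hψ : ψ.Below (m + 1) := (hm _ (Set.mem_insert _ _)).1
        exact hneg (.mp .head (Der.all_of_fresh hT hm hψ h'.by_contra))
      · rintro ψ' h'
        cases h'
        exact ⟨_, .inl rfl⟩
    · exact ⟨_, ⟨hfin.insert _, hneg⟩, Set.subset_insert _ _,
        .inr ⟨.inl rfl, fun ψ hψ => absurd ⟨ψ, hψ⟩ hall⟩⟩
  · exact ⟨_, ⟨hfin.insert φ, h⟩, Set.subset_insert _ _, .inl (.inl rfl)⟩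

theorem exists_isHenkin [Countable (Fm L)] (hT : ∀ φ ∈ T, φ.IsSentence) {Γ : Set (Fm L)}
    (hfin : Γ.Finite) (hcon : ¬ Der T Γ .fal) : ∃ Δ, Γ ⊆ Δ ∧ IsHenkin T Δ := by
  have : Nonempty (Fm L) := ⟨.fal⟩
  obtain ⟨e, he⟩ := exists_surjective_nat (Fm L)
  choose! next h1 h2 h3 using fun (Γ : Set (Fm L)) (h : Γ.Finite ∧ ¬ Der T Γ .fal) (φ : Fm L) =>
    exists_henkin_step hT h.1 h.2 φ
  let G : ℕ → Set (Fm L) := fun n => Nat.rec Γ (fun n Δ => next Δ (e n)) n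
  have hG : ∀ n, (G n).Finite ∧ ¬ Der T (G n) .fal := by
    intro n
    induction n with
    | zero => exact ⟨hfin, hcon⟩
    | succ n ih => exact h1 _ ih _
  have hmono : Monotone G := monotone_nat_of_le_succ fun n => h2 _ (hG n) _
  have hcons : ¬ Der T (⋃ n, G n) .fal := fun h =>
    let ⟨n, hn⟩ := Der.exists_of_iUnion hmono h
    (hG n).2 hn
  have hsub : ∀ n, G n ⊆ ⋃ n, G n := Set.subset_iUnion G
  refine ⟨⋃ n, G n, hsub 0, hcons, fun φ => ?_, fun φ hφ => ?_⟩
  · obtain ⟨n, rfl⟩ := he φ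
    exact (h3 _ (hG n) (e n)).imp (fun h => hsub (n + 1) h) fun h => hsub (n + 1) h.1
  · obtain ⟨n, hn⟩ := he (.all φ)
    rcases h3 _ (hG n) (e n) with h | h
    · exact absurd (Der.mp (.hyp hφ) (.hyp (hsub (n + 1) (hn ▸ h)))) hcons
    · obtain ⟨t, ht⟩ := h.2 φ hn
      exact ⟨t, hsub (n + 1) ht⟩

namespace IsHenkin

variable {Δ : Set (Fm L)} (hΔ : IsHenkin T Δ) {φ ψ : Fm L}
include hΔ

theorem mem_of_der (h : Der T Δ φ) : φ ∈ Δ :=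
  (hΔ.complete φ).resolve_right fun h' => hΔ.consistent (.mp (.hyp h') h)

theorem neg_mem_iff : φ.neg ∈ Δ ↔ φ ∉ Δ :=
  ⟨fun h h' => hΔ.consistent (.mp (.hyp h) (.hyp h')), (hΔ.complete φ).resolve_left⟩

theorem imp_mem_iff : Fm.imp φ ψ ∈ Δ ↔ (φ ∈ Δ → ψ ∈ Δ) := by
  refine ⟨fun h h' => hΔ.mem_of_der (.mp (.hyp h) (.hyp h')), fun h => ?_⟩
  by_cases h' : φ ∈ Δ
  · exact hΔ.mem_of_der (.mp (.ax (.k _ _)) (.hyp (h h')))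
  · have h'' := hΔ.neg_mem_iff.2 h'
    exact hΔ.mem_of_der (Der.intro (.exfalso (.mp (.weaken (.hyp h'')) .head)))

theorem all_mem_iff : Fm.all φ ∈ Δ ↔ ∀ t, φ.inst t ∈ Δ := by
  refine ⟨fun h t => hΔ.mem_of_der (.mp (.ax (.allInst _ _)) (.hyp h)), fun h => ?_⟩
  by_contra h'
  obtain ⟨t, ht⟩ := hΔ.witness φ (hΔ.neg_mem_iff.2 h')
  exact hΔ.neg_mem_iff.1 ht (h t)

theorem mem_of_impList {l : List (Fm L)} (h : Fm.impList l φ ∈ Δ) (hl : ∀ χ ∈ l, χ ∈ Δ) :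
    φ ∈ Δ := by
  induction l with
  | nil => exact h
  | cons χ l ih =>
    rw [List.forall_mem_cons] at hl
    exact ih (hΔ.imp_mem_iff.1 h hl.1) hl.2

theorem eq_refl (t : L.Term ℕ) : Fm.eq t t ∈ Δ := hΔ.mem_of_der (.ax (.eqRefl t))

theorem eq_euclid {t r w : L.Term ℕ} (h : Fm.eq t r ∈ Δ) (h' : Fm.eq t w ∈ Δ) :
    Fm.eq r w ∈ Δ :=
  hΔ.imp_mem_iff.1 (hΔ.imp_mem_iff.1 (hΔ.mem_of_der (.ax (.eqEuclid t r w))) h) h'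

/-- Terms are identified if they are provably equal. -/
def setoid : Setoid (L.Term ℕ) where
  r t r := Fm.eq t r ∈ Δ
  iseqv := ⟨hΔ.eq_refl, fun h => hΔ.eq_euclid h (hΔ.eq_refl _),
    fun h h' => hΔ.eq_euclid (hΔ.eq_euclid h (hΔ.eq_refl _)) h'⟩

/-- The domain of the term model. -/
abbrev TermModel : Type u := Quotient hΔ.setoid

/-- The structure on the term model. Since the interpretations are computed on representatives
chosen by `Quotient.out`, no compatibility proof is needed here. -/
noncomputable instance termStructure : L.Structure hΔ.TermModel where
  funMap f xs := Quotient.mk _ (.func f fun i => (xs i).out)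
  RelMap R xs := Fm.rel R (fun i => (xs i).out) ∈ Δ

theorem out_mk (t : L.Term ℕ) : Fm.eq (Quotient.mk hΔ.setoid t).out t ∈ Δ :=
  @Quotient.mk_out _ hΔ.setoid t

theorem realize_eq (t : L.Term ℕ) (s : ℕ → L.Term ℕ) :
    t.realize (fun n => (Quotient.mk _ (s n) : hΔ.TermModel)) = Quotient.mk _ (t.subst s) := by
  induction t with
  | var n => rfl
  | func f ts ih =>
    simp only [Term.realize_func, ih]
    refine Quotient.sound (hΔ.mem_of_impList (hΔ.mem_of_der (.ax (.eqFunc f _ _))) ?_)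
    rw [List.forall_mem_ofFn_iff]
    exact fun i => hΔ.out_mk _

/-- Truth in the term model is membership in the Henkin set. -/
theorem sat_iff_mem (φ : Fm L) (s : ℕ → L.Term ℕ) :
    φ.Sat (fun n => (Quotient.mk _ (s n) : hΔ.TermModel)) ↔ φ.subst s ∈ Δ := by
  induction φ generalizing s with
  | fal => exact iff_of_false id fun h => hΔ.consistent (.hyp h)
  | eq t r =>
    rw [Fm.sat_eq, hΔ.realize_eq, hΔ.realize_eq]
    exact Quotient.eq
  | rel R ts =>
    simp only [Fm.Sat, hΔ.realize_eq, Fm.subst]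
    constructor
    all_goals
      refine hΔ.imp_mem_iff.1 (hΔ.mem_of_impList (hΔ.mem_of_der (.ax (.eqRel R _ _))) ?_)
      rw [List.forall_mem_ofFn_iff]
    · exact fun i => hΔ.out_mk _
    · exact fun i => hΔ.eq_euclid (hΔ.out_mk _) (hΔ.eq_refl _)
  | imp φ ψ ihφ ihψ => rw [Fm.sat_imp, ihφ, ihψ, Fm.subst, hΔ.imp_mem_iff]
  | all φ ih =>
    have h1 : ∀ t, φ.Sat (scons (Quotient.mk _ t : hΔ.TermModel) fun n => Quotient.mk _ (s n)) ↔
        (φ.subst (up s)).inst t ∈ Δ := by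
      intro t
      have h2 : (scons (Quotient.mk _ t : hΔ.TermModel) fun n => Quotient.mk _ (s n)) =
          fun n => Quotient.mk _ (scons t s n) := by
        funext n; cases n <;> rfl
      have h3 : (φ.subst (up s)).inst t = φ.subst (scons t s) := by
        rw [Fm.inst, Fm.subst_subst]
        congr 1; funext n
        cases n with
        | zero => rfl
        | succ n =>
          simp only [up, shift_eq_subst, term_subst_subst, Term.subst, term_subst_var, scons_succ]
      rw [h2, ih, h3]
    rw [Fm.sat_all, Fm.subst, hΔ.all_mem_iff]
    refine ⟨fun h t => (h1 t).1 (h _), fun h a => ?_⟩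
    obtain ⟨t, rfl⟩ := Quotient.exists_rep a
    exact (h1 t).2 (h t)

end IsHenkin

/-- Gödel's completeness theorem for countable languages: what holds in all models of a set `T` of
sentences is provable in `T`. -/
theorem provable_of_forall_model [Countable (Fm L)] (hT : ∀ φ ∈ T, φ.IsSentence) {φ : Fm L}
    (h : ∀ (M : Type u) [L.Structure M], Models M T → ∀ v : ℕ → M, φ.Sat v) : Provable T φ := by
  by_contra hφ
  have hcon : ¬ Der T {φ.neg} .fal := fun h' =>
    hφ (Der.of_empty (Der.by_contra (by simpa using h')))
  obtain ⟨Δ, hsub, hΔ⟩ := exists_isHenkin hT (Set.finite_singleton _) hcon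
  have key : ∀ ψ : Fm L, ψ ∈ Δ → ψ.Sat fun n => (Quotient.mk _ (.var n) : hΔ.TermModel) :=
    fun ψ hψ => (hΔ.sat_iff_mem ψ Term.var).2 (by rwa [Fm.subst_var])
  refine key _ (hsub rfl) (h hΔ.TermModel (fun ψ hψ v => ?_) _)
  exact ((hT ψ hψ).sat_iff _ _).1 (key ψ (hΔ.mem_of_der (.thm (.of_mem hψ))))

theorem exists_model [Countable (Fm L)] (hT : ∀ φ ∈ T, φ.IsSentence) (hcons : Consistent T) :
    ∃ (M : Type u) (_ : L.Structure M), Nonempty M ∧ Models M T := by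
  by_contra h
  push Not at h
  refine hcons (provable_of_forall_model hT fun M _ hM v => ?_)
  exact (h M _ ⟨v 0⟩ hM).elim

end Completeness

/-! ### Computable functions and predicates -/

section Computability

attribute [fun_prop] Computable ComputablePred
attribute [fun_prop] Computable.id Computable.const Computable.comp Computable.pair

variable {α : Type u} {β : Type v} {γ : Type w} [Primcodable α] [Primcodable β] [Primcodable γ]

@[fun_prop] theorem computable_fst {f : α → β × γ} (h : Computable f) :
    Computable fun x => (f x).1 := Computable.fst.comp h

@[fun_prop] theorem computable_snd {f : α → β × γ} (h : Computable f) :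
    Computable fun x => (f x).2 := Computable.snd.comp h

@[fun_prop] theorem computable_natPair {f g : α → ℕ} (hf : Computable f) (hg : Computable g) :
    Computable fun x => Nat.pair (f x) (g x) := Primrec₂.natPair.to_comp.comp hf hg

@[fun_prop] theorem computable_unpair {f : α → ℕ} (h : Computable f) :
    Computable fun x => Nat.unpair (f x) := Computable.unpair.comp h

@[fun_prop] theorem computable_add {f g : α → ℕ} (hf : Computable f) (hg : Computable g) :
    Computable fun x => f x + g x := Primrec.nat_add.to_comp.comp hf hg

@[fun_prop] theorem computable_sub {f g : α → ℕ} (hf : Computable f) (hg : Computable g) :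
    Computable fun x => f x - g x := Primrec.nat_sub.to_comp.comp hf hg

@[fun_prop] theorem computable_ite {c : α → Prop} [DecidablePred c] {f g : α → β}
    (hc : ComputablePred c) (hf : Computable f) (hg : Computable g) :
    Computable fun x => if c x then f x else g x := by
  refine (Computable.cond hc.decide hf hg).of_eq fun a => ?_
  by_cases h : c a <;> simp [h]

@[fun_prop] theorem computablePred_eq {f g : α → ℕ} (hf : Computable f) (hg : Computable g) :
    ComputablePred fun x => f x = g x :=
  Computable.computablePred (Primrec.eq.decide.to_comp.comp hf hg)

@[fun_prop] theorem computablePred_lt {f g : α → ℕ} (hf : Computable f) (hg : Computable g) :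
    ComputablePred fun x => f x < g x :=
  Computable.computablePred (Primrec.nat_lt.decide.to_comp.comp hf hg)

@[fun_prop] theorem computablePred_not {p : α → Prop} (h : ComputablePred p) :
    ComputablePred fun x => ¬ p x := h.not

@[fun_prop] theorem computablePred_comp {p : β → Prop} {f : α → β} (h : ComputablePred p)
    (hf : Computable f) : ComputablePred fun x => p (f x) := by
  classical exact Computable.computablePred (h.decide.comp hf)

@[fun_prop] theorem computablePred_and {p q : α → Prop} (hp : ComputablePred p)
    (hq : ComputablePred q) : ComputablePred fun x => p x ∧ q x := by
  classical
  exact Computable.computablePred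
    ((Primrec.and.to_comp.comp hp.decide hq.decide).of_eq fun a => by simp)

@[fun_prop] theorem computablePred_or {p q : α → Prop} (hp : ComputablePred p)
    (hq : ComputablePred q) : ComputablePred fun x => p x ∨ q x := by
  classical
  exact Computable.computablePred
    ((Primrec.or.to_comp.comp hp.decide hq.decide).of_eq fun a => by simp)

theorem computablePred_exists_lt {p : α → ℕ → Prop} {f : α → ℕ}
    (hp : ComputablePred fun x : α × ℕ => p x.1 x.2) (hf : Computable f) :
    ComputablePred fun x => ∃ i < f x, p x i := by
  classical
  have h1 : Computable fun x : α => Nat.rec (motive := fun _ => Bool) false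
      (fun i r => r || decide (p x i)) (f x) := by
    refine Computable.nat_rec hf (.const false) (h := fun x ir => ir.2 || decide (p x ir.1)) ?_
    have h2 : Computable fun y : α × ℕ × Bool => decide (p y.1 y.2.1) :=
      hp.decide.comp (f := fun x : α × ℕ => decide (p x.1 x.2))
        (g := fun y : α × ℕ × Bool => (y.1, y.2.1)) (by fun_prop)
    exact Primrec.or.to_comp.comp (by fun_prop) h2
  refine Computable.computablePred (h1.of_eq fun x => ?_)
  induction f x with
  | zero => simp
  | succ n ih => simp only [ih, Nat.exists_lt_succ_right, Bool.decide_or]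

open Nat.Partrec (Code) in
/-- Recursion on a measure with at most two recursive calls yields a computable function. The
function is obtained as a fixed point from Kleene's second recursion theorem, and is total because
the measure decreases. -/
theorem exists_computable_rec (μ : α → ℕ) {base : α → Prop} {g₀ : α → ℕ} {c₁ c₂ : α → α}
    {g : α × ℕ × ℕ → ℕ} (hbase : ComputablePred base) (hg₀ : Computable g₀)
    (hc₁ : Computable c₁) (hc₂ : Computable c₂) (hg : Computable g)
    (h₁ : ∀ a, ¬ base a → μ (c₁ a) < μ a) (h₂ : ∀ a, ¬ base a → μ (c₂ a) < μ a) :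
    ∃ f : α → ℕ, Computable f ∧ (∀ a, base a → f a = g₀ a) ∧
      ∀ a, ¬ base a → f a = g (a, f (c₁ a), f (c₂ a)) := by
  classical
  let Φ : Code → ℕ →. ℕ := fun c n =>
    (Part.ofOption (Encodable.decode (α := α) n)).bind fun a =>
      cond (decide (base a)) (Part.some (g₀ a))
        ((Code.eval c (Encodable.encode (c₁ a))).bind fun r₁ =>
          (Code.eval c (Encodable.encode (c₂ a))).bind fun r₂ => Part.some (g (a, r₁, r₂)))
  have hΦ : Partrec₂ Φ := by
    refine Partrec.bind (Computable.ofOption (Computable.decode.comp Computable.snd)) ?_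
    refine Partrec.cond (hbase.decide.comp .snd) (hg₀.comp .snd).partrec ?_
    refine Partrec.bind (Code.eval_part.comp (by fun_prop)
      (Computable.encode.comp (by fun_prop))) ?_
    refine Partrec.bind (Code.eval_part.comp (by fun_prop)
      (Computable.encode.comp (by fun_prop))) ?_
    exact Computable.partrec (by fun_prop)
  obtain ⟨c, hc⟩ := Code.fixed_point₂ hΦ
  have hc' : ∀ a, Code.eval c (Encodable.encode a) = cond (decide (base a)) (Part.some (g₀ a))
        ((Code.eval c (Encodable.encode (c₁ a))).bind fun r₁ =>
          (Code.eval c (Encodable.encode (c₂ a))).bind fun r₂ => Part.some (g (a, r₁, r₂))) := by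
    intro a
    conv_lhs => rw [hc]
    simp [Φ]
  have hdef : ∀ n a, μ a = n → ∃ r, Code.eval c (Encodable.encode a) = Part.some r := by
    intro n
    induction n using Nat.strong_induction_on with
    | _ n ih =>
      rintro a rfl
      rw [hc']
      by_cases ha : base a
      · exact ⟨g₀ a, by simp [ha]⟩
      · obtain ⟨r₁, hr₁⟩ := ih _ (h₁ a ha) _ rfl
        obtain ⟨r₂, hr₂⟩ := ih _ (h₂ a ha) _ rfl
        exact ⟨g (a, r₁, r₂), by simp [ha, hr₁, hr₂]⟩
  choose f hf using fun a => hdef _ a rfl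
  refine ⟨f, ?_, fun a ha => ?_, fun a ha => ?_⟩
  · refine Partrec.of_eq_tot (f := fun a => Code.eval c (Encodable.encode a))
      (Code.eval_part.comp (by fun_prop) Computable.encode) fun a => ?_
    rw [hf]
    exact Part.mem_some _
  · have h := hc' a
    rw [hf] at h
    simpa [ha] using h
  · have h := hc' a
    rw [hf, hf, hf] at h
    simpa [ha] using h

end Computability

/-! ### Recursion on codes of terms and formulas -/

section SyntaxFold

/-- The data of a recursive definition on codes of terms, lists of terms, and formulas, with a
context of type `κ` that changes by `up` below a quantifier. The argument `p` of `bot` is the payload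
of the tag of `⊥`, which a correct code has equal to `0`; `fn` and `rel` receive the code of the
symbol and the value of the list of its arguments. -/
structure FoldData (κ : Type) where
  up : κ → κ
  leaf : κ × ℕ → ℕ
  fn : ℕ × ℕ → ℕ
  nil : ℕ
  cons : ℕ × ℕ → ℕ
  bot : ℕ → ℕ
  eq : ℕ × ℕ → ℕ
  rel : ℕ × ℕ → ℕ
  imp : ℕ × ℕ → ℕ
  all : ℕ → ℕ

namespace FoldData

variable {κ : Type} [Primcodable κ] (d : FoldData κ)

/-- All functions that enter the recursion are computable; the constant `nil` needs no condition. -/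
structure IsComputable : Prop where
  up : Computable d.up
  leaf : Computable d.leaf
  fn : Computable d.fn
  cons : Computable d.cons
  bot : Computable d.bot
  eq : Computable d.eq
  rel : Computable d.rel
  imp : Computable d.imp
  all : Computable d.all

/-- The functions `t`, `l`, `f` on codes of terms, of lists of terms, and of formulas satisfy the
recursion given by `d`; on numbers with an invalid tag the value is `0`. -/
structure IsFold (t l f : κ × ℕ → ℕ) : Prop where
  computable_t : Computable t
  computable_f : Computable f
  t_var : ∀ k i, t (k, Nat.pair 0 i) = d.leaf (k, i)
  t_func : ∀ k e p, t (k, Nat.pair 1 (Nat.pair e p)) = d.fn (e, l (k, p))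
  t_junk : ∀ k m p, t (k, Nat.pair (m + 2) p) = 0
  l_nil : ∀ k, l (k, 0) = d.nil
  l_cons : ∀ k a p, l (k, Nat.succ (Nat.pair a p)) = d.cons (t (k, a), l (k, p))
  f_zero : ∀ k p, f (k, Nat.pair 0 p) = 0
  f_fal : ∀ k p, f (k, Nat.pair 1 p) = d.bot p
  f_eq : ∀ k a b, f (k, Nat.pair 2 (Nat.pair a b)) = d.eq (t (k, a), t (k, b))
  f_rel : ∀ k e p, f (k, Nat.pair 3 (Nat.pair e p)) = d.rel (e, l (k, p))
  f_imp : ∀ k a b, f (k, Nat.pair 4 (Nat.pair a b)) = d.imp (f (k, a), f (k, b))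
  f_all : ∀ k a, f (k, Nat.pair 5 a) = d.all (f (d.up k, a))
  f_junk : ∀ k m p, f (k, Nat.pair (m + 6) p) = 0

theorem lt_pair_of_ne_zero {t p : ℕ} (ht : t ≠ 0) : p < Nat.pair t p :=
  lt_of_lt_of_le (by omega) (Nat.add_le_pair t p)

theorem exists_isFold (hd : d.IsComputable) : ∃ t l f, d.IsFold t l f := by
  obtain ⟨hup, hleaf, hfn, hcons, hbot, heq, hrel, himp, hall⟩ := hd
  -- the state `(s, k, n)` asks for the value at `n` as a formula (`s = 0`), as a term (`s = 1`),
  -- or as a list of terms (`s = 2`)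
  let base : ℕ × κ × ℕ → Prop := fun a =>
    (a.1 = 0 ∧ ¬ (1 < a.2.2.unpair.1 ∧ a.2.2.unpair.1 < 6)) ∨
      (a.1 = 1 ∧ ¬ a.2.2.unpair.1 = 1) ∨ (1 < a.1 ∧ a.2.2 = 0)
  let g₀ : ℕ × κ × ℕ → ℕ := fun a =>
    if a.1 = 0 then if a.2.2.unpair.1 = 1 then d.bot a.2.2.unpair.2 else 0
    else if a.1 = 1 then if a.2.2.unpair.1 = 0 then d.leaf (a.2.1, a.2.2.unpair.2) else 0
    else d.nil
  let c₁ : ℕ × κ × ℕ → ℕ × κ × ℕ := fun a =>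
    if a.1 = 0 then
      if a.2.2.unpair.1 = 5 then (0, d.up a.2.1, a.2.2.unpair.2)
      else if a.2.2.unpair.1 = 4 then (0, a.2.1, a.2.2.unpair.2.unpair.1)
      else if a.2.2.unpair.1 = 3 then (2, a.2.1, a.2.2.unpair.2.unpair.2)
      else (1, a.2.1, a.2.2.unpair.2.unpair.1)
    else if a.1 = 1 then (2, a.2.1, a.2.2.unpair.2.unpair.2)
    else (1, a.2.1, (a.2.2 - 1).unpair.1)
  let c₂ : ℕ × κ × ℕ → ℕ × κ × ℕ := fun a =>
    if a.1 = 0 then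
      if a.2.2.unpair.1 = 5 then (0, d.up a.2.1, a.2.2.unpair.2)
      else if a.2.2.unpair.1 = 4 then (0, a.2.1, a.2.2.unpair.2.unpair.2)
      else if a.2.2.unpair.1 = 3 then (2, a.2.1, a.2.2.unpair.2.unpair.2)
      else (1, a.2.1, a.2.2.unpair.2.unpair.2)
    else if a.1 = 1 then (2, a.2.1, a.2.2.unpair.2.unpair.2)
    else (2, a.2.1, (a.2.2 - 1).unpair.2)
  let g : (ℕ × κ × ℕ) × ℕ × ℕ → ℕ := fun x =>
    if x.1.1 = 0 then
      if x.1.2.2.unpair.1 = 5 then d.all x.2.1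
      else if x.1.2.2.unpair.1 = 4 then d.imp (x.2.1, x.2.2)
      else if x.1.2.2.unpair.1 = 3 then d.rel (x.1.2.2.unpair.2.unpair.1, x.2.1)
      else d.eq (x.2.1, x.2.2)
    else if x.1.1 = 1 then d.fn (x.1.2.2.unpair.2.unpair.1, x.2.1)
    else d.cons (x.2.1, x.2.2)
  have hlt : ∀ a : ℕ × κ × ℕ, ¬ base a → (c₁ a).2.2 < a.2.2 ∧ (c₂ a).2.2 < a.2.2 := by
    rintro ⟨s, k, n⟩ h
    have h1 : n.unpair.2.unpair.1 ≤ n.unpair.2 := Nat.unpair_left_le _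
    have h2 : n.unpair.2.unpair.2 ≤ n.unpair.2 := Nat.unpair_right_le _
    have h3 : (n - 1).unpair.1 ≤ n - 1 := Nat.unpair_left_le _
    have h4 : (n - 1).unpair.2 ≤ n - 1 := Nat.unpair_right_le _
    have h5 : n.unpair.1 + n.unpair.2 ≤ n := Nat.unpair_add_le n
    simp only [base, not_or, not_and_or, not_not] at h
    rcases s with _ | _ | s
    · obtain ⟨h6, h7⟩ := h.1.resolve_left fun h => h rfl
      simp only [c₁, c₂, if_true]
      split_ifs <;> constructor <;> dsimp only <;> omega
    · have h6 := h.2.1.resolve_left fun h => h rfl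
      simp only [c₁, c₂]
      norm_num
      omega
    · have h6 := h.2.2.resolve_left fun h => h (by simp)
      simp only [c₁, c₂]
      norm_num
      omega
  obtain ⟨f, hf, hf₀, hf₁⟩ := exists_computable_rec (fun a : ℕ × κ × ℕ => a.2.2)
    (base := base) (g₀ := g₀) (c₁ := c₁) (c₂ := c₂) (g := g)
    (by fun_prop) (by fun_prop) (by fun_prop) (by fun_prop) (by fun_prop)
    (fun a h => (hlt a h).1) (fun a h => (hlt a h).2)
  refine ⟨fun x => f (1, x), fun x => f (2, x), fun x => f (0, x), by fun_prop, by fun_prop,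
    ?_, ?_, ?_, ?_, ?_, ?_, ?_, ?_, ?_, ?_, ?_, ?_⟩
  · intro k i
    rw [hf₀ _ (by simp [base])]; simp [g₀]
  · intro k e p
    rw [hf₁ _ (by simp [base])]; simp [g, c₁]
  · intro k m p
    rw [hf₀ _ (by simp [base])]; simp [g₀]
  · intro k
    rw [hf₀ _ (by simp [base])]; simp [g₀]
  · intro k a p
    rw [hf₁ _ (by simp [base])]; simp [g, c₁, c₂]
  · intro k p
    rw [hf₀ _ (by simp [base])]; simp [g₀]
  · intro k p
    rw [hf₀ _ (by simp [base])]; simp [g₀]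
  · intro k a b
    rw [hf₁ _ (by simp [base])]; simp [g, c₁, c₂]
  · intro k e p
    rw [hf₁ _ (by simp [base])]; simp [g, c₁]
  · intro k a b
    rw [hf₁ _ (by simp [base])]; simp [g, c₁, c₂]
  · intro k a
    rw [hf₁ _ (by simp [base])]; simp [g, c₁]
  · intro k m p
    rw [hf₀ _ (by simp [base])]; simp [g₀]

end FoldData

end SyntaxFold

/-! ### Injectivity and monotonicity of the Gödel numbering -/

section Codes

variable {L : FirstOrder.Language.{u, v}} [Encodable (Σ n, L.Functions n)]

theorem termCode_var (i : ℕ) : termCode (.var i : L.Term ℕ) = Nat.pair 0 i := by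
  rw [termCode]

theorem termCode_func {k : ℕ} (f : L.Functions k) (ts : Fin k → L.Term ℕ) :
    termCode (.func f ts) = Nat.pair 1 (Nat.pair (encode (⟨k, f⟩ : Σ n, L.Functions n))
      (encode (List.ofFn fun i => termCode (ts i)))) := by
  rw [termCode]

theorem encode_ofFn_succ {k : ℕ} (f : Fin (k + 1) → ℕ) :
    encode (List.ofFn f) = Nat.succ (Nat.pair (f 0) (encode (List.ofFn fun i => f i.succ))) := by
  rw [List.ofFn_succ, encode_list_cons]
  rfl

theorem encode_ofFn_zero (f : Fin 0 → ℕ) : encode (List.ofFn f) = 0 := by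
  rw [List.ofFn_zero, encode_list_nil]

theorem le_encode_ofFn {k : ℕ} (f : Fin k → ℕ) (i : Fin k) : f i ≤ encode (List.ofFn f) := by
  induction k with
  | zero => exact i.elim0
  | succ k ih =>
    rw [encode_ofFn_succ]
    refine Fin.cases ?_ (fun j => ?_) i
    · exact (Nat.left_le_pair _ _).trans (Nat.le_succ _)
    · exact (ih (fun i => f i.succ) j).trans ((Nat.right_le_pair _ _).trans (Nat.le_succ _))

theorem pair_le_pair {a b c d : ℕ} (h : a ≤ c) (h' : b ≤ d) : Nat.pair a b ≤ Nat.pair c d := by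
  refine le_trans (b := Nat.pair c b) ?_ ?_
  · rcases h.eq_or_lt with rfl | h
    · exact le_rfl
    · exact (Nat.pair_lt_pair_left _ h).le
  · rcases h'.eq_or_lt with rfl | h'
    · exact le_rfl
    · exact (Nat.pair_lt_pair_right _ h').le

theorem encode_ofFn_mono {k : ℕ} {f g : Fin k → ℕ} (h : ∀ i, f i ≤ g i) :
    encode (List.ofFn f) ≤ encode (List.ofFn g) := by
  induction k with
  | zero => rw [encode_ofFn_zero, encode_ofFn_zero]
  | succ k ih =>
    rw [encode_ofFn_succ, encode_ofFn_succ]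
    exact Nat.succ_le_succ (pair_le_pair (h 0) (ih fun i => h i.succ))

theorem termCode_injective : Function.Injective (termCode : L.Term ℕ → ℕ) := by
  intro t
  induction t with
  | var i =>
    rintro (j | ⟨g, rs⟩) h
    · simp only [termCode_var, Nat.pair_eq_pair, true_and] at h
      rw [h]
    · simp [termCode_var, termCode_func] at h
  | func f ts ih =>
    rintro (j | ⟨g, rs⟩) h
    · simp [termCode_var, termCode_func] at h
    · simp only [termCode_func, Nat.pair_eq_pair, true_and, encode_inj] at h
      obtain ⟨h1, h2⟩ := h
      cases h1
      rw [List.ofFn_inj] at h2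
      rw [funext fun i => ih i (congrFun h2 i)]

theorem termCode_eq_func {r : L.Term ℕ} {e c : ℕ}
    (h : termCode r = Nat.pair 1 (Nat.pair e c)) :
    ∃ (k : ℕ) (f : L.Functions k) (ts : Fin k → L.Term ℕ), r = .func f ts ∧
      encode (⟨k, f⟩ : Σ n, L.Functions n) = e ∧
      encode (List.ofFn fun i => termCode (ts i)) = c := by
  cases r with
  | var i => simp [termCode_var] at h
  | func f ts =>
    simp only [termCode_func, Nat.pair_eq_pair, true_and] at h
    exact ⟨_, f, ts, rfl, h⟩

theorem termBelow_termCode (t : L.Term ℕ) : TermBelow (termCode t + 1) t := by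
  induction t with
  | var i =>
    rw [termCode_var]
    exact Nat.lt_succ_of_le (Nat.right_le_pair _ _)
  | func f ts ih =>
    intro i
    refine termBelow_mono (Nat.succ_le_succ ?_) _ (ih i)
    rw [termCode_func]
    exact (le_encode_ofFn (fun i => termCode (ts i)) i).trans
      ((Nat.right_le_pair _ _).trans (Nat.right_le_pair _ _))

theorem termCode_le_termCode_shift (t : L.Term ℕ) : termCode t ≤ termCode (shift t) := by
  induction t with
  | var i =>
    rw [shift_var, termCode_var, termCode_var]
    exact pair_le_pair le_rfl (Nat.le_succ i)
  | func f ts ih =>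
    have h : shift (.func f ts) = .func f fun i => shift (ts i) := rfl
    rw [h, termCode_func, termCode_func]
    exact pair_le_pair le_rfl (pair_le_pair le_rfl (encode_ofFn_mono ih))

theorem term_instAt_eq_or_le (r : L.Term ℕ) (k : ℕ) :
    (∀ t t', r.subst (instAt k t) = r.subst (instAt k t')) ∨
      ∀ t, termCode t ≤ termCode (r.subst (instAt k t)) := by
  induction r with
  | var i =>
    by_cases h : i = k
    · exact .inr fun t => by simp [Term.subst, instAt, h]
    · exact .inl fun t t' => by simp [Term.subst, instAt, h]
  | func f ts ih =>
    by_cases h : ∀ i, ∀ t t', (ts i).subst (instAt k t) = (ts i).subst (instAt k t')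
    · exact .inl fun t t' => by simp only [Term.subst, funext fun i => h i t t']
    · obtain ⟨i, hi⟩ := not_forall.1 h
      refine .inr fun t => ?_
      rw [Term.subst, termCode_func]
      exact ((ih i).resolve_left hi t).trans
        ((le_encode_ofFn (fun i => termCode ((ts i).subst (instAt k t))) i).trans
          ((Nat.right_le_pair _ _).trans (Nat.right_le_pair _ _)))

variable [Encodable (Σ n, L.Relations n)]

theorem code_eq_eq {Φ : Fm L} {a b : ℕ} (h : code Φ = Nat.pair 2 (Nat.pair a b)) :
    ∃ t r, Φ = .eq t r ∧ termCode t = a ∧ termCode r = b := by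
  cases Φ <;> simp only [code, Nat.pair_eq_pair] at h <;> simp at h
  exact ⟨_, _, rfl, h⟩

theorem code_eq_rel {Φ : Fm L} {e c : ℕ} (h : code Φ = Nat.pair 3 (Nat.pair e c)) :
    ∃ (k : ℕ) (R : L.Relations k) (ts : Fin k → L.Term ℕ), Φ = .rel R ts ∧
      encode (⟨k, R⟩ : Σ n, L.Relations n) = e ∧
      encode (List.ofFn fun i => termCode (ts i)) = c := by
  cases Φ <;> simp only [code, Nat.pair_eq_pair] at h <;> simp at h
  exact ⟨_, _, _, rfl, h⟩

theorem code_eq_imp {Φ : Fm L} {a b : ℕ} (h : code Φ = Nat.pair 4 (Nat.pair a b)) :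
    ∃ φ ψ, Φ = .imp φ ψ ∧ code φ = a ∧ code ψ = b := by
  cases Φ <;> simp only [code, Nat.pair_eq_pair] at h <;> simp at h
  exact ⟨_, _, rfl, h⟩

theorem code_eq_all {Φ : Fm L} {a : ℕ} (h : code Φ = Nat.pair 5 a) :
    ∃ φ, Φ = .all φ ∧ code φ = a := by
  cases Φ <;> simp only [code, Nat.pair_eq_pair] at h <;> simp at h
  exact ⟨_, rfl, h⟩

theorem code_eq_fal {Φ : Fm L} {a : ℕ} (h : code Φ = Nat.pair 1 a) : Φ = .fal := by
  cases Φ <;> simp only [code, Nat.pair_eq_pair] at h <;> simp at h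
  rfl

theorem code_injective : Function.Injective (code : Fm L → ℕ) := by
  intro φ
  induction φ with
  | fal => intro χ h; exact (code_eq_fal h.symm).symm
  | eq t r =>
    intro χ h
    obtain ⟨t', r', rfl, h1, h2⟩ := code_eq_eq h.symm
    rw [termCode_injective h1, termCode_injective h2]
  | rel R ts =>
    intro χ h
    obtain ⟨k, R', ts', rfl, h1, h2⟩ := code_eq_rel h.symm
    rw [encode_inj] at h1 h2
    cases h1
    rw [List.ofFn_inj] at h2
    rw [funext fun i => termCode_injective (congrFun h2 i)]
  | imp φ ψ ihφ ihψ =>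
    intro χ h
    obtain ⟨φ', ψ', rfl, h1, h2⟩ := code_eq_imp h.symm
    rw [ihφ h1.symm, ihψ h2.symm]
  | all φ ih =>
    intro χ h
    obtain ⟨φ', rfl, h1⟩ := code_eq_all h.symm
    rw [ih h1.symm]

theorem countable_fm : Countable (Fm L) := code_injective.countable

theorem below_code (φ : Fm L) : φ.Below (code φ + 1) := by
  induction φ with
  | fal => trivial
  | eq t r =>
    refine ⟨termBelow_mono (Nat.succ_le_succ ?_) _ (termBelow_termCode t),
      termBelow_mono (Nat.succ_le_succ ?_) _ (termBelow_termCode r)⟩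
    · exact (Nat.left_le_pair _ _).trans (Nat.right_le_pair _ _)
    · exact (Nat.right_le_pair _ _).trans (Nat.right_le_pair _ _)
  | rel R ts =>
    refine fun i => termBelow_mono (Nat.succ_le_succ ?_) _ (termBelow_termCode (ts i))
    exact (le_encode_ofFn (fun i => termCode (ts i)) i).trans
      ((Nat.right_le_pair _ _).trans (Nat.right_le_pair _ _))
  | imp φ ψ ihφ ihψ =>
    refine ⟨ihφ.mono (Nat.succ_le_succ ?_), ihψ.mono (Nat.succ_le_succ ?_)⟩
    · exact (Nat.left_le_pair _ _).trans (Nat.right_le_pair _ _)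
    · exact (Nat.right_le_pair _ _).trans (Nat.right_le_pair _ _)
  | all φ ih =>
    exact Fm.Below.mono (m := code (Fm.all φ) + 1 + 1) ih
      (Nat.succ_le_succ ((Nat.right_le_pair 5 (code φ)).trans (Nat.le_succ _)))

theorem subst_instAt_eq_or_le (φ : Fm L) (k : ℕ) :
    (∀ t t', φ.subst (instAt k t) = φ.subst (instAt k t')) ∨
      ∀ t, termCode t ≤ code (φ.subst (instAt k t)) := by
  induction φ generalizing k with
  | fal => exact .inl fun _ _ => rfl
  | eq a b =>
    rcases term_instAt_eq_or_le a k with ha | ha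
    · rcases term_instAt_eq_or_le b k with hb | hb
      · exact .inl fun t t' => by rw [Fm.subst, ha t t', hb t t', Fm.subst]
      · exact .inr fun t => (hb t).trans ((Nat.right_le_pair _ _).trans (Nat.right_le_pair _ _))
    · exact .inr fun t => (ha t).trans ((Nat.left_le_pair _ _).trans (Nat.right_le_pair _ _))
  | rel R ts =>
    by_cases h : ∀ i, ∀ t t', (ts i).subst (instAt k t) = (ts i).subst (instAt k t')
    · exact .inl fun t t' => by simp only [Fm.subst, funext fun i => h i t t']
    · obtain ⟨i, hi⟩ := not_forall.1 h
      refine .inr fun t => ?_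
      exact ((term_instAt_eq_or_le (ts i) k).resolve_left hi t).trans
        ((le_encode_ofFn (fun i => termCode ((ts i).subst (instAt k t))) i).trans
          ((Nat.right_le_pair _ _).trans (Nat.right_le_pair _ _)))
  | imp φ ψ ihφ ihψ =>
    rcases ihφ k with ha | ha
    · rcases ihψ k with hb | hb
      · exact .inl fun t t' => by rw [Fm.subst, ha t t', hb t t', Fm.subst]
      · exact .inr fun t => (hb t).trans ((Nat.right_le_pair _ _).trans (Nat.right_le_pair _ _))
    · exact .inr fun t => (ha t).trans ((Nat.left_le_pair _ _).trans (Nat.right_le_pair _ _))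
  | all φ ih =>
    rcases ih (k + 1) with h | h
    · exact .inl fun t t' => by simp only [Fm.subst, up_instAt, h (shift t) (shift t')]
    · refine .inr fun t => ?_
      rw [Fm.subst, up_instAt]
      exact (termCode_le_termCode_shift t).trans ((h _).trans (Nat.right_le_pair _ _))

/-- Either `φ(t)` does not depend on `t`, or `t` occurs in `φ(t)`, up to shifts of its variables, and
so has a code that is bounded by that of `φ(t)`. -/
theorem inst_eq_or_le (φ : Fm L) :
    (∀ t t', φ.inst t = φ.inst t') ∨ ∀ t, termCode t ≤ code (φ.inst t) := by
  simp only [inst_eq_subst_instAt]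
  exact subst_instAt_eq_or_le φ 0

end Codes

/-! ### Decidability of the syntax and computability of substitution -/

section SyntaxComputable

/-- The function `s` sends the code of a symbol to its arity plus one, and all other numbers to
`0`. -/
theorem exists_computable_arity {α : Type w} [Primcodable α] {ar : α → ℕ} (h : Computable ar) :
    ∃ s : ℕ → ℕ, Computable s ∧ ∀ e m, s e = m + 1 ↔ ∃ a : α, encode a = e ∧ ar a = m := by
  refine ⟨fun e => Option.casesOn (motive := fun _ => ℕ) (decode (α := α) e) 0
    (fun a => if encode a = e then ar a + 1 else 0), ?_, fun e m => ?_⟩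
  · refine Computable.option_casesOn Computable.decode (.const 0) ?_
    have h1 : Computable fun x : ℕ × α => encode x.2 := Computable.encode.comp .snd
    exact Computable.to₂ (f := fun x : ℕ × α => if encode x.2 = x.1 then ar x.2 + 1 else 0)
      (by fun_prop)
  · constructor
    · intro he
      cases ha : decode (α := α) e with
      | none => simp [ha] at he
      | some a =>
        simp only [ha] at he
        split_ifs at he with h1
        exact ⟨a, h1, by simpa using he⟩
    · rintro ⟨a, rfl, rfl⟩
      simp

variable {L : FirstOrder.Language.{u, v}} [Primcodable (Σ n, L.Functions n)]

/-- The recursion that checks well-formedness; the context is a bound for the free variables. The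
value is `1` for correct terms and formulas, and the length plus one for correct lists. -/
def checkData (s r : ℕ → ℕ) : FoldData ℕ where
  up k := k + 1
  leaf x := if x.2 < x.1 then 1 else 0
  fn x := if 0 < x.2 ∧ x.2 = s x.1 then 1 else 0
  nil := 1
  cons x := if x.1 = 1 ∧ 0 < x.2 then x.2 + 1 else 0
  bot p := if p = 0 then 1 else 0
  eq x := if x.1 = 1 ∧ x.2 = 1 then 1 else 0
  rel x := if 0 < x.2 ∧ x.2 = r x.1 then 1 else 0
  imp x := if x.1 = 1 ∧ x.2 = 1 then 1 else 0
  all p := p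

theorem exists_eq_pair (n : ℕ) : ∃ a b, n = Nat.pair a b := ⟨_, _, (Nat.pair_unpair n).symm⟩

theorem isFold_check_term {s r : ℕ → ℕ} {t l f : ℕ × ℕ → ℕ} (h : (checkData s r).IsFold t l f)
    (hs : ∀ e m, s e = m + 1 ↔ ∃ g : Σ n, L.Functions n, encode g = e ∧ g.1 = m) (n : ℕ) :
    (∀ k, t (k, n) = 1 ↔ ∃ a : L.Term ℕ, TermBelow k a ∧ termCode a = n) ∧
    ∀ k m, l (k, n) = m + 1 ↔ ∃ ts : Fin m → L.Term ℕ, (∀ i, TermBelow k (ts i)) ∧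
      encode (List.ofFn fun i => termCode (ts i)) = n := by
  induction n using Nat.strong_induction_on with
  | _ n ih =>
    constructor
    · intro k
      obtain ⟨m, p, rfl⟩ := exists_eq_pair n
      match m with
      | 0 =>
        rw [h.t_var]
        simp only [checkData]
        constructor
        · intro h1
          split_ifs at h1 with h2
          exact ⟨.var p, h2, termCode_var p⟩
        · rintro ⟨a, h1, h2⟩
          rw [← termCode_var (L := L)] at h2
          rw [termCode_injective h2] at h1
          exact if_pos h1
      | 1 =>
        obtain ⟨e, p, rfl⟩ := exists_eq_pair p
        rw [h.t_func]
        have ihp := (ih p (lt_of_le_of_lt (Nat.right_le_pair e p)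
          (FoldData.lt_pair_of_ne_zero one_ne_zero))).2 k
        simp only [checkData]
        constructor
        · intro h1
          split_ifs at h1 with h2
          obtain ⟨m, hm⟩ := Nat.exists_eq_succ_of_ne_zero h2.1.ne'
          obtain ⟨ts, h3, h4⟩ := (ihp m).1 hm
          obtain ⟨⟨m', g⟩, h5, h6⟩ := (hs e m).1 (h2.2.symm.trans hm)
          subst h6
          exact ⟨.func g ts, h3, by rw [termCode_func, h5, h4]⟩
        · rintro ⟨a, h1, h2⟩
          obtain ⟨m, g, ts, rfl, h3, h4⟩ := termCode_eq_func h2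
          have h5 := (ihp m).2 ⟨ts, h1, h4⟩
          have h6 := (hs e m).2 ⟨⟨m, g⟩, h3, rfl⟩
          exact if_pos ⟨by omega, by omega⟩
      | m + 2 =>
        rw [h.t_junk]
        refine iff_of_false zero_ne_one ?_
        rintro ⟨a, h1, h2⟩
        cases a <;> simp [termCode_var, termCode_func] at h2
    · intro k m
      cases n with
      | zero =>
        rw [h.l_nil]
        simp only [checkData]
        constructor
        · intro h1
          obtain rfl : m = 0 := by omega
          exact ⟨Fin.elim0, fun i => i.elim0, encode_ofFn_zero _⟩
        · rintro ⟨ts, h1, h2⟩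
          cases m with
          | zero => rfl
          | succ m => rw [encode_ofFn_succ] at h2; cases h2
      | succ n =>
        obtain ⟨a, p, rfl⟩ := exists_eq_pair n
        have iha := (ih a (Nat.lt_succ_of_le (Nat.left_le_pair a p))).1 k
        have ihp := (ih p (Nat.lt_succ_of_le (Nat.right_le_pair a p))).2 k
        rw [h.l_cons]
        simp only [checkData]
        constructor
        · intro h1
          split_ifs at h1 with h2
          obtain ⟨t₀, h3, h4⟩ := iha.1 h2.1
          obtain ⟨m, rfl⟩ := Nat.exists_eq_succ_of_ne_zero (show m ≠ 0 by omega)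
          obtain ⟨ts, h5, h6⟩ := (ihp m).1 (by omega)
          refine ⟨Fin.cons t₀ ts, Fin.cases h3 h5, ?_⟩
          rw [encode_ofFn_succ]
          simp only [Fin.cons_zero, Fin.cons_succ, h4, h6]
        · rintro ⟨ts, h1, h2⟩
          cases m with
          | zero => rw [encode_ofFn_zero] at h2; cases h2
          | succ m =>
            rw [encode_ofFn_succ, Nat.succ_inj, Nat.pair_eq_pair] at h2
            have h3 := iha.2 ⟨ts 0, h1 0, h2.1⟩
            have h4 := (ihp m).2 ⟨_, fun i => h1 i.succ, h2.2⟩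
            rw [if_pos ⟨h3, by omega⟩, h4]

variable [Primcodable (Σ n, L.Relations n)]

theorem isFold_check_fm {s r : ℕ → ℕ} {t l f : ℕ × ℕ → ℕ} (h : (checkData s r).IsFold t l f)
    (hs : ∀ e m, s e = m + 1 ↔ ∃ g : Σ n, L.Functions n, encode g = e ∧ g.1 = m)
    (hr : ∀ e m, r e = m + 1 ↔ ∃ g : Σ n, L.Relations n, encode g = e ∧ g.1 = m) (n k : ℕ) :
    f (k, n) = 1 ↔ ∃ φ : Fm L, φ.Below k ∧ code φ = n := by
  induction n using Nat.strong_induction_on generalizing k with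
  | _ n ih =>
    obtain ⟨m, p, rfl⟩ := exists_eq_pair n
    match m with
    | 0 =>
      rw [h.f_zero]
      refine iff_of_false zero_ne_one ?_
      rintro ⟨φ, h1, h2⟩
      cases φ <;> simp [code] at h2
    | 1 =>
      rw [h.f_fal]
      simp only [checkData]
      constructor
      · intro h1
        split_ifs at h1 with h2
        exact ⟨.fal, trivial, by rw [h2, code]⟩
      · rintro ⟨φ, h1, h2⟩
        cases code_eq_fal h2
        rw [code, Nat.pair_eq_pair] at h2
        exact if_pos h2.2.symm
    | 2 =>
      obtain ⟨a, b, rfl⟩ := exists_eq_pair p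
      rw [h.f_eq]
      have iha := (isFold_check_term h hs a).1 k
      have ihb := (isFold_check_term h hs b).1 k
      simp only [checkData]
      constructor
      · intro h1
        split_ifs at h1 with h2
        obtain ⟨t, h3, h4⟩ := iha.1 h2.1
        obtain ⟨r, h5, h6⟩ := ihb.1 h2.2
        exact ⟨.eq t r, ⟨h3, h5⟩, by rw [code, h4, h6]⟩
      · rintro ⟨φ, h1, h2⟩
        obtain ⟨t, r, rfl, h3, h4⟩ := code_eq_eq h2
        exact if_pos ⟨iha.2 ⟨t, h1.1, h3⟩, ihb.2 ⟨r, h1.2, h4⟩⟩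
    | 3 =>
      obtain ⟨e, p, rfl⟩ := exists_eq_pair p
      rw [h.f_rel]
      have ihp := (isFold_check_term h hs p).2 k
      simp only [checkData]
      constructor
      · intro h1
        split_ifs at h1 with h2
        obtain ⟨m, hm⟩ := Nat.exists_eq_succ_of_ne_zero h2.1.ne'
        obtain ⟨ts, h3, h4⟩ := (ihp m).1 hm
        obtain ⟨⟨m', g⟩, h5, h6⟩ := (hr e m).1 (h2.2.symm.trans hm)
        subst h6
        exact ⟨.rel g ts, h3, by rw [code, h5, h4]⟩
      · rintro ⟨φ, h1, h2⟩
        obtain ⟨m, g, ts, rfl, h3, h4⟩ := code_eq_rel h2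
        have h5 := (ihp m).2 ⟨ts, h1, h4⟩
        have h6 := (hr e m).2 ⟨⟨m, g⟩, h3, rfl⟩
        exact if_pos ⟨by omega, by omega⟩
    | 4 =>
      obtain ⟨a, b, rfl⟩ := exists_eq_pair p
      rw [h.f_imp]
      have hlt : Nat.pair a b < Nat.pair 4 (Nat.pair a b) :=
        FoldData.lt_pair_of_ne_zero (by norm_num)
      have iha := ih a (lt_of_le_of_lt (Nat.left_le_pair a b) hlt) k
      have ihb := ih b (lt_of_le_of_lt (Nat.right_le_pair a b) hlt) k
      simp only [checkData]
      constructor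
      · intro h1
        split_ifs at h1 with h2
        obtain ⟨φ, h3, h4⟩ := iha.1 h2.1
        obtain ⟨ψ, h5, h6⟩ := ihb.1 h2.2
        exact ⟨.imp φ ψ, ⟨h3, h5⟩, by rw [code, h4, h6]⟩
      · rintro ⟨φ, h1, h2⟩
        obtain ⟨φ, ψ, rfl, h3, h4⟩ := code_eq_imp h2
        exact if_pos ⟨iha.2 ⟨φ, h1.1, h3⟩, ihb.2 ⟨ψ, h1.2, h4⟩⟩
    | 5 =>
      rw [h.f_all]
      refine (ih p (FoldData.lt_pair_of_ne_zero (by norm_num)) (k + 1)).trans ?_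
      constructor
      · rintro ⟨φ, h1, h2⟩
        exact ⟨.all φ, h1, by rw [code, h2]⟩
      · rintro ⟨φ, h1, h2⟩
        obtain ⟨φ, rfl, h3⟩ := code_eq_all h2
        exact ⟨φ, h1, h3⟩
    | m + 6 =>
      rw [h.f_junk]
      refine iff_of_false zero_ne_one ?_
      rintro ⟨φ, h1, h2⟩
      cases φ <;> simp only [code, Nat.pair_eq_pair] at h2 <;> omega

theorem computablePred_below
    (hF : Computable (fun f : Σ n, L.Functions n => f.1))
    (hR : Computable (fun R : Σ n, L.Relations n => R.1)) :
    (ComputablePred fun x : ℕ × ℕ => ∃ t : L.Term ℕ, TermBelow x.1 t ∧ termCode t = x.2) ∧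
    ComputablePred fun x : ℕ × ℕ => ∃ φ : Fm L, φ.Below x.1 ∧ code φ = x.2 := by
  obtain ⟨s, hs, hs'⟩ := exists_computable_arity hF
  obtain ⟨r, hr, hr'⟩ := exists_computable_arity hR
  have hd : (checkData s r).IsComputable := by
    constructor <;> simp only [checkData] <;> fun_prop
  obtain ⟨t, l, f, h⟩ := (checkData s r).exists_isFold hd
  have ht := h.computable_t
  have hf := h.computable_f
  refine ⟨ComputablePred.of_eq (p := fun x : ℕ × ℕ => t x = 1) (by fun_prop) fun x =>
    (isFold_check_term h hs' x.2).1 x.1, ComputablePred.of_eq (p := fun x : ℕ × ℕ => f x = 1)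
    (by fun_prop) fun x => isFold_check_fm h hs' hr' x.2 x.1⟩

/-- All variables of a term are bounded by its code, so that the bound in `computablePred_below`
can be dropped. -/
theorem computablePred_isTerm (hF : Computable (fun f : Σ n, L.Functions n => f.1))
    (hR : Computable (fun R : Σ n, L.Relations n => R.1)) :
    ComputablePred fun n : ℕ => ∃ t : L.Term ℕ, termCode t = n := by
  have h := (computablePred_below hF hR).1
  refine ComputablePred.of_eq (computablePred_comp (f := fun n : ℕ => (n + 1, n)) h (by fun_prop))
    fun n => ⟨?_, ?_⟩
  · rintro ⟨t, -, ht⟩; exact ⟨t, ht⟩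
  · rintro ⟨t, rfl⟩; exact ⟨t, termBelow_termCode t, rfl⟩

theorem computablePred_isFm (hF : Computable (fun f : Σ n, L.Functions n => f.1))
    (hR : Computable (fun R : Σ n, L.Relations n => R.1)) :
    ComputablePred fun n : ℕ => ∃ φ : Fm L, code φ = n := by
  have h := (computablePred_below hF hR).2
  refine ComputablePred.of_eq (computablePred_comp (f := fun n : ℕ => (n + 1, n)) h (by fun_prop))
    fun n => ⟨?_, ?_⟩
  · rintro ⟨t, -, ht⟩; exact ⟨t, ht⟩
  · rintro ⟨t, rfl⟩; exact ⟨t, below_code t, rfl⟩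

/-- The recursion that substitutes on codes; `leaf (k, i)` is the code of the term substituted for
the variable `i` in the context `k`. -/
def substData {κ : Type} (up : κ → κ) (leaf : κ × ℕ → ℕ) : FoldData κ where
  up := up
  leaf := leaf
  fn x := Nat.pair 1 (Nat.pair x.1 x.2)
  nil := 0
  cons x := Nat.pair x.1 x.2 + 1
  bot p := Nat.pair 1 p
  eq x := Nat.pair 2 (Nat.pair x.1 x.2)
  rel x := Nat.pair 3 (Nat.pair x.1 x.2)
  imp x := Nat.pair 4 (Nat.pair x.1 x.2)
  all p := Nat.pair 5 p

/-- Substitution is computable on codes, if contexts describe substitutions via a relation `R`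
that is preserved below quantifiers. -/
theorem exists_computable_subst {κ : Type} [Primcodable κ] {upc : κ → κ} {leaf : κ × ℕ → ℕ}
    (hup : Computable upc) (hleaf : Computable leaf) (R : κ → (ℕ → L.Term ℕ) → Prop)
    (hR : ∀ k s, R k s → (∀ i, leaf (k, i) = termCode (s i)) ∧ R (upc k) (up s)) :
    ∃ t f : κ × ℕ → ℕ, Computable t ∧ Computable f ∧ ∀ k s, R k s →
      (∀ a : L.Term ℕ, t (k, termCode a) = termCode (a.subst s)) ∧
      ∀ φ : Fm L, f (k, code φ) = code (φ.subst s) := by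
  have hd : (substData upc leaf).IsComputable := by
    constructor <;> simp only [substData] <;> fun_prop
  obtain ⟨t, l, f, h⟩ := (substData upc leaf).exists_isFold hd
  have hl : ∀ k s (m : ℕ) (ts : Fin m → L.Term ℕ),
      (∀ i, t (k, termCode (ts i)) = termCode ((ts i).subst s)) →
      l (k, encode (List.ofFn fun i => termCode (ts i))) =
        encode (List.ofFn fun i => termCode ((ts i).subst s)) := by
    intro k s m ts
    induction m with
    | zero => intro _; rw [encode_ofFn_zero, encode_ofFn_zero, h.l_nil]; rfl
    | succ m ih =>
      intro hts
      rw [encode_ofFn_succ, encode_ofFn_succ, h.l_cons, hts 0, ih _ fun i => hts i.succ]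
      rfl
  have ht : ∀ k s, R k s → ∀ a : L.Term ℕ, t (k, termCode a) = termCode (a.subst s) := by
    intro k s hs a
    induction a with
    | var i => rw [termCode_var, h.t_var]; exact (hR k s hs).1 i
    | func g ts ih =>
      rw [termCode_func, h.t_func, hl k s _ ts ih, Term.subst, termCode_func]
      rfl
  refine ⟨t, f, h.computable_t, h.computable_f, fun k s hs => ⟨ht k s hs, fun φ => ?_⟩⟩
  induction φ generalizing k s with
  | fal => rw [code, h.f_fal]; rfl
  | eq a b => rw [code, h.f_eq, ht k s hs, ht k s hs]; rfl
  | rel r ts => rw [code, h.f_rel, hl k s _ ts fun i => ht k s hs _]; rfl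
  | imp φ ψ ihφ ihψ => rw [code, h.f_imp, ihφ k s hs, ihψ k s hs]; rfl
  | all φ ih => rw [code, h.f_all]; exact congrArg _ (ih _ _ (hR k s hs).2)

/-- The context `k` stands for the shift of the variables with index at least `k`. -/
theorem exists_computable_lift :
    ∃ t f : ℕ → ℕ, Computable t ∧ Computable f ∧
      (∀ a : L.Term ℕ, t (termCode a) = termCode (shift a)) ∧
      ∀ φ : Fm L, f (code φ) = code (φ.subst fun n => .var (n + 1)) := by
  obtain ⟨t, f, ht, hf, h⟩ := exists_computable_subst (L := L) (upc := fun k : ℕ => k + 1)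
    (leaf := fun x => if x.2 < x.1 then Nat.pair 0 x.2 else Nat.pair 0 (x.2 + 1))
    (by fun_prop) (by fun_prop)
    (fun k s => s = fun i => if i < k then .var i else .var (i + 1)) (by
      rintro k _ rfl
      refine ⟨fun i => ?_, funext fun i => ?_⟩
      · dsimp only
        split_ifs <;> rw [termCode_var]
      · cases i with
        | zero => simp [up]
        | succ i =>
          simp only [up, Nat.add_lt_add_iff_right]
          split_ifs <;> rfl)
  have h0 := h 0 (fun n => .var (n + 1)) (by simp)
  refine ⟨fun n => t (0, n), fun n => f (0, n), by fun_prop, by fun_prop, fun a => ?_, h0.2⟩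
  rw [shift_eq_subst]
  exact h0.1 a

/-- The context `(k, c)` stands for the substitution of the term with code `c` for the variable `k`,
which below a quantifier becomes `k + 1`, while the term is shifted. -/
theorem exists_computable_inst :
    ∃ f : ℕ × ℕ → ℕ, Computable f ∧
      ∀ (t : L.Term ℕ) (φ : Fm L), f (termCode t, code φ) = code (φ.inst t) := by
  obtain ⟨l, -, hl, -, hl', -⟩ := exists_computable_lift (L := L)
  obtain ⟨t, f, ht, hf, h⟩ := exists_computable_subst (L := L)
    (upc := fun k : ℕ × ℕ => (k.1 + 1, l k.2))
    (leaf := fun x => if x.2 < x.1.1 then Nat.pair 0 x.2 else if x.2 = x.1.1 then x.1.2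
      else Nat.pair 0 (x.2 - 1))
    (by fun_prop) (by fun_prop) (fun k s => ∃ t, k.2 = termCode t ∧ s = instAt k.1 t) (by
      rintro ⟨k, _⟩ _ ⟨t, rfl, rfl⟩
      refine ⟨fun i => ?_, shift t, hl' t, up_instAt k t⟩
      simp only [instAt]
      split_ifs <;> simp only [termCode_var])
  refine ⟨fun x => f ((0, x.1), x.2), by fun_prop, fun t φ => ?_⟩
  rw [inst_eq_subst_instAt]
  exact (h (0, termCode t) _ ⟨t, rfl, rfl⟩).2 φ

end SyntaxComputable

/-! ### Decidability of the logical axioms -/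

section Axioms

variable {L : FirstOrder.Language.{u, v}} [Primcodable (Σ n, L.Functions n)]
  [Primcodable (Σ n, L.Relations n)]

theorem le_code_impList (l : List (Fm L)) (φ : Fm L) : code φ ≤ code (Fm.impList l φ) := by
  induction l with
  | nil => exact le_rfl
  | cons χ l ih =>
    exact ih.trans ((Nat.right_le_pair (code χ) _).trans (Nat.right_le_pair 4 _))

/-- The code of `t₁ = r₁ → … → tₘ = rₘ → φ` is computable from the codes of `φ` and of the lists
of the `tᵢ` and of the `rᵢ`. -/
theorem exists_computable_impList_eq :
    ∃ f : ℕ × ℕ × ℕ → ℕ, Computable f ∧ ∀ (φ : Fm L) (m : ℕ) (ts rs : Fin m → L.Term ℕ),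
      f (code φ, encode (List.ofFn fun i => termCode (ts i)),
        encode (List.ofFn fun i => termCode (rs i))) =
      code (Fm.impList (List.ofFn fun i => .eq (ts i) (rs i)) φ) := by
  have hlt : ∀ a : ℕ × ℕ × ℕ, ¬ a.2.1 = 0 → (a.2.1 - 1).unpair.2 < a.2.1 := fun a ha =>
    lt_of_le_of_lt (Nat.unpair_right_le _) (by omega)
  obtain ⟨f, hf, h₀, h₁⟩ := exists_computable_rec (fun a : ℕ × ℕ × ℕ => a.2.1)
    (base := fun a => a.2.1 = 0) (g₀ := fun a => a.1)
    (c₁ := fun a => (a.1, (a.2.1 - 1).unpair.2, (a.2.2 - 1).unpair.2))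
    (c₂ := fun a => (a.1, (a.2.1 - 1).unpair.2, (a.2.2 - 1).unpair.2))
    (g := fun x => Nat.pair 4 (Nat.pair
      (Nat.pair 2 (Nat.pair (x.1.2.1 - 1).unpair.1 (x.1.2.2 - 1).unpair.1)) x.2.1))
    (by fun_prop) (by fun_prop) (by fun_prop) (by fun_prop) (by fun_prop) hlt hlt
  refine ⟨f, hf, fun φ m ts rs => ?_⟩
  induction m with
  | zero => rw [encode_ofFn_zero, encode_ofFn_zero, h₀ _ rfl]; rfl
  | succ m ih =>
    rw [encode_ofFn_succ, encode_ofFn_succ, h₁ _ (Nat.succ_ne_zero _), List.ofFn_succ]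
    simp only [Nat.succ_eq_add_one, Nat.add_sub_cancel, Nat.unpair_pair, ih]
    rfl

/-- The code of the left-hand side of the implication with code `n`. -/
def lhs (n : ℕ) : ℕ := n.unpair.2.unpair.1

/-- The code of the right-hand side of the implication with code `n`. -/
def rhs (n : ℕ) : ℕ := n.unpair.2.unpair.2

@[simp] theorem lhs_pair (a b c : ℕ) : lhs (Nat.pair a (Nat.pair b c)) = b := by simp [lhs]

@[simp] theorem rhs_pair (a b c : ℕ) : rhs (Nat.pair a (Nat.pair b c)) = c := by simp [rhs]

@[fun_prop] theorem computable_lhs {α : Type w} [Primcodable α] {f : α → ℕ} (h : Computable f) :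
    Computable fun x => lhs (f x) := by unfold lhs; fun_prop

@[fun_prop] theorem computable_rhs {α : Type w} [Primcodable α] {f : α → ℕ} (h : Computable f) :
    Computable fun x => rhs (f x) := by unfold rhs; fun_prop

variable (hF : Computable (fun f : Σ n, L.Functions n => f.1))
  (hR : Computable (fun R : Σ n, L.Relations n => R.1))
include hF hR

theorem computablePred_axK :
    ComputablePred fun n : ℕ => ∃ φ ψ : Fm L, code (.imp φ (.imp ψ φ)) = n := by
  have hfm := computablePred_isFm hF hR
  refine ComputablePred.of_eq (p := fun n => (∃ Φ : Fm L, code Φ = n) ∧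
    n = Nat.pair 4 (Nat.pair (lhs n) (Nat.pair 4 (Nat.pair (lhs (rhs n)) (lhs n)))))
    (by fun_prop) fun n => ⟨?_, ?_⟩
  · rintro ⟨⟨Φ, rfl⟩, h⟩
    obtain ⟨φ, Φ, rfl, h1, h2⟩ := code_eq_imp h
    obtain ⟨ψ, χ, rfl, h3, h4⟩ := code_eq_imp h2
    rw [← h1] at h4
    cases code_injective h4
    exact ⟨_, _, rfl⟩
  · rintro ⟨φ, ψ, rfl⟩
    exact ⟨⟨_, rfl⟩, by simp [code]⟩

theorem computablePred_axS :
    ComputablePred fun n : ℕ => ∃ φ ψ χ : Fm L,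
      code (.imp (.imp φ (.imp ψ χ)) (.imp (.imp φ ψ) (.imp φ χ))) = n := by
  have hfm := computablePred_isFm hF hR
  refine ComputablePred.of_eq (p := fun n => (∃ Φ : Fm L, code Φ = n) ∧
    n = Nat.pair 4 (Nat.pair (Nat.pair 4 (Nat.pair (lhs (lhs n))
        (Nat.pair 4 (Nat.pair (lhs (rhs (lhs n))) (rhs (rhs (lhs n)))))))
      (Nat.pair 4 (Nat.pair (Nat.pair 4 (Nat.pair (lhs (lhs n)) (lhs (rhs (lhs n)))))
        (Nat.pair 4 (Nat.pair (lhs (lhs n)) (rhs (rhs (lhs n)))))))))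
    (by fun_prop) fun n => ⟨?_, ?_⟩
  · rintro ⟨⟨Φ, rfl⟩, h⟩
    generalize lhs (lhs (code Φ)) = a, lhs (rhs (lhs (code Φ))) = b,
      rhs (rhs (lhs (code Φ))) = c at h
    obtain ⟨Φ, Ψ, rfl, h1, h2⟩ := code_eq_imp h
    obtain ⟨φ, Φ, rfl, rfl, h4⟩ := code_eq_imp h1
    obtain ⟨ψ, χ, rfl, rfl, rfl⟩ := code_eq_imp h4
    obtain ⟨Φ, Ψ, rfl, h5, h6⟩ := code_eq_imp h2
    obtain ⟨φ', ψ', rfl, h7, h8⟩ := code_eq_imp h5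
    obtain ⟨φ'', χ', rfl, h9, h10⟩ := code_eq_imp h6
    cases code_injective h7
    cases code_injective h8
    cases code_injective h9
    cases code_injective h10
    exact ⟨_, _, _, rfl⟩
  · rintro ⟨φ, ψ, χ, rfl⟩
    exact ⟨⟨_, rfl⟩, by simp [code]⟩

theorem computablePred_axDne :
    ComputablePred fun n : ℕ => ∃ φ : Fm L, code (.imp (.neg (.neg φ)) φ) = n := by
  have hfm := computablePred_isFm hF hR
  refine ComputablePred.of_eq (p := fun n => (∃ Φ : Fm L, code Φ = n) ∧
    n = Nat.pair 4 (Nat.pair (Nat.pair 4 (Nat.pair (Nat.pair 4 (Nat.pair (rhs n) (Nat.pair 1 0)))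
      (Nat.pair 1 0))) (rhs n)))
    (by fun_prop) fun n => ⟨?_, ?_⟩
  · rintro ⟨⟨Φ, rfl⟩, h⟩
    obtain ⟨Φ, φ, rfl, h1, h2⟩ := code_eq_imp h
    obtain ⟨Φ, Ψ, rfl, h3, h4⟩ := code_eq_imp h1
    obtain ⟨φ', Ψ', rfl, h5, h6⟩ := code_eq_imp h3
    cases code_eq_fal h4
    cases code_eq_fal h6
    rw [← h2] at h5
    cases code_injective h5
    exact ⟨_, rfl⟩
  · rintro ⟨φ, rfl⟩
    exact ⟨⟨_, rfl⟩, by simp [code, Fm.neg]⟩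

/-- The instantiating term is found by a search below the code of the axiom. -/
theorem computablePred_axAllInst :
    ComputablePred fun n : ℕ => ∃ (φ : Fm L) (t : L.Term ℕ),
      code (.imp (.all φ) (φ.inst t)) = n := by
  have hfm := computablePred_isFm hF hR
  have htm := computablePred_isTerm hF hR
  obtain ⟨f, hf, hf'⟩ := exists_computable_inst (L := L)
  refine ComputablePred.of_eq (p := fun n => (∃ Φ : Fm L, code Φ = n) ∧
    ∃ c < n + 1, (∃ t : L.Term ℕ, termCode t = c) ∧
      n = Nat.pair 4 (Nat.pair (Nat.pair 5 (lhs n).unpair.2) (f (c, (lhs n).unpair.2))))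
    (computablePred_and hfm (computablePred_exists_lt (computablePred_and
      (computablePred_comp (f := fun x : ℕ × ℕ => x.2) htm (by fun_prop)) (by fun_prop))
      (by fun_prop)))
    fun n => ⟨?_, ?_⟩
  · rintro ⟨⟨Φ, rfl⟩, c, -, ⟨t, rfl⟩, h⟩
    generalize (lhs (code Φ)).unpair.2 = a at h
    obtain ⟨Φ, Ψ, rfl, h1, h2⟩ := code_eq_imp h
    obtain ⟨φ, rfl, rfl⟩ := code_eq_all h1
    rw [hf'] at h2
    cases code_injective h2
    exact ⟨_, _, rfl⟩
  · rintro ⟨φ, t, rfl⟩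
    refine ⟨⟨_, rfl⟩, ?_⟩
    have key : ∃ t' : L.Term ℕ, termCode t' ≤ code (φ.inst t) ∧ φ.inst t' = φ.inst t := by
      rcases inst_eq_or_le φ with h | h
      · exact ⟨.var 0, by rw [termCode_var]; exact Nat.zero_le _, h _ _⟩
      · exact ⟨t, h t, rfl⟩
    obtain ⟨t', h1, h2⟩ := key
    refine ⟨termCode t', Nat.lt_succ_of_le (h1.trans ?_), ⟨t', rfl⟩, ?_⟩
    · exact (Nat.right_le_pair (code (.all φ)) _).trans (Nat.right_le_pair 4 _)
    · simp [code, hf', h2]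

theorem computablePred_axAllDist :
    ComputablePred fun n : ℕ => ∃ φ ψ : Fm L,
      code (.imp (.all (.imp φ ψ)) (.imp (.all φ) (.all ψ))) = n := by
  have hfm := computablePred_isFm hF hR
  refine ComputablePred.of_eq (p := fun n => (∃ Φ : Fm L, code Φ = n) ∧
    n = Nat.pair 4 (Nat.pair (Nat.pair 5 (Nat.pair 4 (Nat.pair (lhs (lhs n).unpair.2)
      (rhs (lhs n).unpair.2)))) (Nat.pair 4 (Nat.pair (Nat.pair 5 (lhs (lhs n).unpair.2))
        (Nat.pair 5 (rhs (lhs n).unpair.2))))))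
    (by fun_prop) fun n => ⟨?_, ?_⟩
  · rintro ⟨⟨Φ, rfl⟩, h⟩
    generalize lhs (lhs (code Φ)).unpair.2 = a, rhs (lhs (code Φ)).unpair.2 = b at h
    obtain ⟨Φ, Ψ, rfl, h1, h2⟩ := code_eq_imp h
    obtain ⟨Φ, rfl, h3⟩ := code_eq_all h1
    obtain ⟨φ, ψ, rfl, rfl, rfl⟩ := code_eq_imp h3
    obtain ⟨Φ, Ψ, rfl, h4, h5⟩ := code_eq_imp h2
    obtain ⟨φ', rfl, h6⟩ := code_eq_all h4
    obtain ⟨ψ', rfl, h7⟩ := code_eq_all h5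
    cases code_injective h6
    cases code_injective h7
    exact ⟨_, _, rfl⟩
  · rintro ⟨φ, ψ, rfl⟩
    exact ⟨⟨_, rfl⟩, by simp [code]⟩

theorem computablePred_axAllVac :
    ComputablePred fun n : ℕ => ∃ φ : Fm L,
      code (.imp φ (.all (φ.subst fun n => .var (n + 1)))) = n := by
  have hfm := computablePred_isFm hF hR
  obtain ⟨-, f, -, hf, -, hf'⟩ := exists_computable_lift (L := L)
  refine ComputablePred.of_eq (p := fun n => (∃ Φ : Fm L, code Φ = n) ∧
    n = Nat.pair 4 (Nat.pair (lhs n) (Nat.pair 5 (f (lhs n)))))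
    (by fun_prop) fun n => ⟨?_, ?_⟩
  · rintro ⟨⟨Φ, rfl⟩, h⟩
    generalize lhs (code Φ) = a at h
    obtain ⟨φ, Ψ, rfl, rfl, h2⟩ := code_eq_imp h
    obtain ⟨ψ, rfl, h3⟩ := code_eq_all h2
    rw [hf'] at h3
    cases code_injective h3
    exact ⟨_, rfl⟩
  · rintro ⟨φ, rfl⟩
    exact ⟨⟨_, rfl⟩, by simp [code, hf']⟩

theorem computablePred_axEqRefl :
    ComputablePred fun n : ℕ => ∃ t : L.Term ℕ, code (.eq t t) = n := by
  have hfm := computablePred_isFm hF hR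
  refine ComputablePred.of_eq (p := fun n => (∃ Φ : Fm L, code Φ = n) ∧
    n = Nat.pair 2 (Nat.pair (lhs n) (lhs n))) (by fun_prop) fun n => ⟨?_, ?_⟩
  · rintro ⟨⟨Φ, rfl⟩, h⟩
    obtain ⟨t, r, rfl, h1, h2⟩ := code_eq_eq h
    rw [← h1] at h2
    cases termCode_injective h2
    exact ⟨_, rfl⟩
  · rintro ⟨φ, rfl⟩
    exact ⟨⟨_, rfl⟩, by simp [code]⟩

theorem computablePred_axEqEuclid :
    ComputablePred fun n : ℕ => ∃ t r w : L.Term ℕ,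
      code (.imp (.eq t r) (.imp (.eq t w) (.eq r w))) = n := by
  have hfm := computablePred_isFm hF hR
  refine ComputablePred.of_eq (p := fun n => (∃ Φ : Fm L, code Φ = n) ∧
    n = Nat.pair 4 (Nat.pair (Nat.pair 2 (Nat.pair (lhs (lhs n)) (rhs (lhs n))))
      (Nat.pair 4 (Nat.pair (Nat.pair 2 (Nat.pair (lhs (lhs n)) (rhs (rhs (rhs n)))))
        (Nat.pair 2 (Nat.pair (rhs (lhs n)) (rhs (rhs (rhs n)))))))))
    (by fun_prop) fun n => ⟨?_, ?_⟩
  · rintro ⟨⟨Φ, rfl⟩, h⟩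
    generalize lhs (lhs (code Φ)) = a, rhs (lhs (code Φ)) = b,
      rhs (rhs (rhs (code Φ))) = c at h
    obtain ⟨Φ, Ψ, rfl, h1, h2⟩ := code_eq_imp h
    obtain ⟨t, r, rfl, rfl, rfl⟩ := code_eq_eq h1
    obtain ⟨Φ, Ψ, rfl, h3, h4⟩ := code_eq_imp h2
    obtain ⟨t', w, rfl, h5, rfl⟩ := code_eq_eq h3
    obtain ⟨r', w', rfl, h6, h7⟩ := code_eq_eq h4
    cases termCode_injective h5
    cases termCode_injective h6
    cases termCode_injective h7
    exact ⟨_, _, _, rfl⟩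
  · rintro ⟨t, r, w, rfl⟩
    exact ⟨⟨_, rfl⟩, by simp [code]⟩

theorem computablePred_axEqFunc :
    ComputablePred fun n : ℕ => ∃ (k : ℕ) (f : L.Functions k) (ts rs : Fin k → L.Term ℕ),
      code (.impList (List.ofFn fun i => .eq (ts i) (rs i)) (.eq (.func f ts) (.func f rs))) =
        n := by
  have hfm := computablePred_isFm hF hR
  obtain ⟨g, hg, hg'⟩ := exists_computable_impList_eq (L := L)
  refine ComputablePred.of_eq (p := fun n => ∃ p < n + 1, (∃ Φ : Fm L, code Φ = p) ∧
    p = Nat.pair 2 (Nat.pair (Nat.pair 1 (Nat.pair (lhs (lhs p)) (rhs (lhs p))))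
      (Nat.pair 1 (Nat.pair (lhs (lhs p)) (rhs (rhs p))))) ∧
    n = g (p, rhs (lhs p), rhs (rhs p)))
    (computablePred_exists_lt (computablePred_and
      (computablePred_comp (f := fun x : ℕ × ℕ => x.2) hfm (by fun_prop)) (by fun_prop))
      (by fun_prop)) fun n => ⟨?_, ?_⟩
  · rintro ⟨p, -, ⟨Φ, rfl⟩, h, rfl⟩
    generalize lhs (lhs (code Φ)) = e, rhs (lhs (code Φ)) = c, rhs (rhs (code Φ)) = d at h
    obtain ⟨t, r, rfl, h1, h2⟩ := code_eq_eq h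
    obtain ⟨k, f, ts, rfl, rfl, rfl⟩ := termCode_eq_func h1
    obtain ⟨k', f', rs, rfl, h3, rfl⟩ := termCode_eq_func h2
    cases encode_injective h3
    exact ⟨k, f, ts, rs, (hg' _ _ _ _).symm⟩
  · rintro ⟨k, f, ts, rs, rfl⟩
    refine ⟨_, Nat.lt_succ_of_le (le_code_impList _ _), ⟨_, rfl⟩, ?_, ?_⟩
    · simp [code, termCode_func]
    · rw [← hg' (.eq (.func f ts) (.func f rs)) k ts rs]
      simp [code, termCode_func]

theorem computablePred_axEqRel :
    ComputablePred fun n : ℕ => ∃ (k : ℕ) (R : L.Relations k) (ts rs : Fin k → L.Term ℕ),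
      code (.impList (List.ofFn fun i => .eq (ts i) (rs i)) (.imp (.rel R ts) (.rel R rs))) =
        n := by
  have hfm := computablePred_isFm hF hR
  obtain ⟨g, hg, hg'⟩ := exists_computable_impList_eq (L := L)
  refine ComputablePred.of_eq (p := fun n => ∃ p < n + 1, (∃ Φ : Fm L, code Φ = p) ∧
    p = Nat.pair 4 (Nat.pair (Nat.pair 3 (Nat.pair (lhs (lhs p)) (rhs (lhs p))))
      (Nat.pair 3 (Nat.pair (lhs (lhs p)) (rhs (rhs p))))) ∧
    n = g (p, rhs (lhs p), rhs (rhs p)))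
    (computablePred_exists_lt (computablePred_and
      (computablePred_comp (f := fun x : ℕ × ℕ => x.2) hfm (by fun_prop)) (by fun_prop))
      (by fun_prop)) fun n => ⟨?_, ?_⟩
  · rintro ⟨p, -, ⟨Φ, rfl⟩, h, rfl⟩
    generalize lhs (lhs (code Φ)) = e, rhs (lhs (code Φ)) = c, rhs (rhs (code Φ)) = d at h
    obtain ⟨φ, ψ, rfl, h1, h2⟩ := code_eq_imp h
    obtain ⟨k, R, ts, rfl, rfl, rfl⟩ := code_eq_rel h1
    obtain ⟨k', R', rs, rfl, h3, rfl⟩ := code_eq_rel h2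
    cases encode_injective h3
    exact ⟨k, R, ts, rs, (hg' _ _ _ _).symm⟩
  · rintro ⟨k, R, ts, rs, rfl⟩
    refine ⟨_, Nat.lt_succ_of_le (le_code_impList _ _), ⟨_, rfl⟩, ?_, ?_⟩
    · simp [code]
    · rw [← hg' (.imp (.rel R ts) (.rel R rs)) k ts rs]
      simp [code]

theorem computablePred_logicalAx :
    ComputablePred fun n : ℕ => ∃ φ : Fm L, LogicalAx φ ∧ code φ = n := by
  have h := computablePred_or (computablePred_axK hF hR) <|
    computablePred_or (computablePred_axS hF hR) <|
    computablePred_or (computablePred_axDne hF hR) <|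
    computablePred_or (computablePred_axAllInst hF hR) <|
    computablePred_or (computablePred_axAllDist hF hR) <|
    computablePred_or (computablePred_axAllVac hF hR) <|
    computablePred_or (computablePred_axEqRefl hF hR) <|
    computablePred_or (computablePred_axEqEuclid hF hR) <|
    computablePred_or (computablePred_axEqFunc hF hR) (computablePred_axEqRel hF hR)
  refine h.of_eq fun n => ⟨?_, ?_⟩
  · rintro (⟨φ, ψ, rfl⟩ | ⟨φ, ψ, χ, rfl⟩ | ⟨φ, rfl⟩ | ⟨φ, t, rfl⟩ | ⟨φ, ψ, rfl⟩ | ⟨φ, rfl⟩ |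
      ⟨t, rfl⟩ | ⟨t, r, w, rfl⟩ | ⟨k, f, ts, rs, rfl⟩ | ⟨k, R, ts, rs, rfl⟩)
    · exact ⟨_, .k _ _, rfl⟩
    · exact ⟨_, .s _ _ _, rfl⟩
    · exact ⟨_, .dne _, rfl⟩
    · exact ⟨_, .allInst _ _, rfl⟩
    · exact ⟨_, .allDist _ _, rfl⟩
    · exact ⟨_, .allVac _, rfl⟩
    · exact ⟨_, .eqRefl _, rfl⟩
    · exact ⟨_, .eqEuclid _ _ _, rfl⟩
    · exact ⟨_, .eqFunc _ _ _, rfl⟩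
    · exact ⟨_, .eqRel _ _ _, rfl⟩
  · rintro ⟨φ, hφ, rfl⟩
    cases hφ with
    | k φ ψ => exact .inl ⟨_, _, rfl⟩
    | s φ ψ χ => exact .inr (.inl ⟨_, _, _, rfl⟩)
    | dne φ => exact .inr (.inr (.inl ⟨_, rfl⟩))
    | allInst φ t => exact .inr (.inr (.inr (.inl ⟨_, _, rfl⟩)))
    | allDist φ ψ => exact .inr (.inr (.inr (.inr (.inl ⟨_, _, rfl⟩))))
    | allVac φ => exact .inr (.inr (.inr (.inr (.inr (.inl ⟨_, rfl⟩)))))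
    | eqRefl t => exact .inr (.inr (.inr (.inr (.inr (.inr (.inl ⟨_, rfl⟩))))))
    | eqEuclid t r w =>
      exact .inr (.inr (.inr (.inr (.inr (.inr (.inr (.inl ⟨_, _, _, rfl⟩)))))))
    | eqFunc f ts rs =>
      exact .inr (.inr (.inr (.inr (.inr (.inr (.inr (.inr (.inl ⟨_, f, ts, rs, rfl⟩))))))))
    | eqRel R ts rs =>
      exact .inr (.inr (.inr (.inr (.inr (.inr (.inr (.inr (.inr ⟨_, R, ts, rs, rfl⟩))))))))

end Axioms

/-! ### Decidability of proofs -/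

section Proofs

variable {L : FirstOrder.Language.{u, v}} [Primcodable (Σ n, L.Functions n)]
  [Primcodable (Σ n, L.Relations n)]

theorem primrecRel_mp :
    PrimrecRel fun (l : List ℕ) (a : ℕ) => ∃ b ∈ l, Nat.pair 4 (Nat.pair b a) ∈ l := by
  have h1 : PrimrecRel fun (c : ℕ) (x : ℕ × ℕ) => c = Nat.pair 4 (Nat.pair x.1 x.2) :=
    Primrec.eq.comp Primrec.fst (Primrec₂.natPair.comp (.const 4)
      (Primrec₂.natPair.comp (Primrec.fst.comp .snd) (Primrec.snd.comp .snd)))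
  have h2 : PrimrecRel fun (b : ℕ) (x : List ℕ × ℕ) =>
      ∃ c ∈ x.1, c = Nat.pair 4 (Nat.pair b x.2) :=
    h1.exists_mem_list.comp (f := fun y : ℕ × List ℕ × ℕ => y.2.1)
      (g := fun y => (y.1, y.2.2)) (Primrec.fst.comp .snd)
      (Primrec.fst.pair (Primrec.snd.comp .snd))
  have h3 : PrimrecRel fun (l : List ℕ) (a : ℕ) => ∃ b ∈ l, ∃ c ∈ l,
      c = Nat.pair 4 (Nat.pair b a) :=
    h2.exists_mem_list.comp (f := fun y : List ℕ × ℕ => y.1) (g := fun y => y)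
      Primrec.fst Primrec.id
  exact h3.of_eq fun l a => by simp

theorem primrecRel_gen :
    PrimrecRel fun (l : List ℕ) (a : ℕ) => ∃ b ∈ l, a = Nat.pair 5 b := by
  have h1 : PrimrecRel fun (b : ℕ) (a : ℕ) => a = Nat.pair 5 b :=
    Primrec.eq.comp Primrec.snd (Primrec₂.natPair.comp (.const 5) .fst)
  exact h1.exists_mem_list

/-- `Step` in terms of codes. -/
theorem step_iff_code {T : Set (Fm L)} {l : List (Fm L)} {a : ℕ} :
    (∃ φ, Step T l φ ∧ code φ = a) ↔
      ((∃ φ : Fm L, LogicalAx φ ∧ code φ = a) ∨ (∃ φ ∈ T, code φ = a)) ∨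
        (∃ b ∈ l.map code, Nat.pair 4 (Nat.pair b a) ∈ l.map code) ∨
          ∃ b ∈ l.map code, a = Nat.pair 5 b := by
  constructor
  · rintro ⟨φ, h1 | h1 | ⟨ψ, h1, h2⟩ | ⟨ψ, h1, rfl⟩, rfl⟩
    · exact .inl (.inl ⟨φ, h1, rfl⟩)
    · exact .inl (.inr ⟨φ, h1, rfl⟩)
    · exact .inr (.inl ⟨_, List.mem_map_of_mem h1, List.mem_map_of_mem (f := code) h2⟩)
    · exact .inr (.inr ⟨_, List.mem_map_of_mem h1, rfl⟩)
  · rintro ((⟨φ, h1, rfl⟩ | ⟨φ, h1, rfl⟩) | ⟨b, h1, h2⟩ | ⟨b, h1, rfl⟩)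
    · exact ⟨φ, .inl h1, rfl⟩
    · exact ⟨φ, .inr (.inl h1), rfl⟩
    · obtain ⟨ψ, h3, rfl⟩ := List.mem_map.1 h1
      obtain ⟨Φ, h4, h5⟩ := List.mem_map.1 h2
      obtain ⟨ψ', φ, rfl, h6, h7⟩ := code_eq_imp h5
      cases code_injective h6
      exact ⟨φ, .inr (.inr (.inl ⟨_, h3, h4⟩)), h7⟩
    · obtain ⟨ψ, h3, rfl⟩ := List.mem_map.1 h1
      exact ⟨.all ψ, .inr (.inr (.inr ⟨ψ, h3, rfl⟩)), rfl⟩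

theorem computablePred_isDerivation
    (hF : Computable (fun f : Σ n, L.Functions n => f.1))
    (hR : Computable (fun R : Σ n, L.Relations n => R.1))
    {T : Set (Fm L)} (hrec : RecursivelyAxiomatized T) :
    ComputablePred fun l : List ℕ => ∃ Γ : List (Fm L), IsDerivation T Γ ∧ Γ.map code = l := by
  have hax := computablePred_logicalAx hF hR
  have hT : ComputablePred fun n : ℕ => ∃ φ ∈ T, code φ = n := hrec
  have hmp : ComputablePred fun x : List ℕ × ℕ => ∃ b ∈ x.1, Nat.pair 4 (Nat.pair b x.2) ∈ x.1 :=
    PrimrecPred.computablePred primrecRel_mp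
  have hgen : ComputablePred fun x : List ℕ × ℕ => ∃ b ∈ x.1, x.2 = Nat.pair 5 b :=
    PrimrecPred.computablePred primrecRel_gen
  let step : List ℕ × ℕ → Prop := fun x =>
    ((∃ φ : Fm L, LogicalAx φ ∧ code φ = x.2) ∨ (∃ φ ∈ T, code φ = x.2)) ∨
      (∃ b ∈ x.1, Nat.pair 4 (Nat.pair b x.2) ∈ x.1) ∨ ∃ b ∈ x.1, x.2 = Nat.pair 5 b
  have hstep : ComputablePred step :=
    computablePred_or (computablePred_or
      (computablePred_comp (f := fun x : List ℕ × ℕ => x.2) hax (by fun_prop))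
      (computablePred_comp (f := fun x : List ℕ × ℕ => x.2) hT (by fun_prop)))
      (computablePred_or hmp hgen)
  have hhead : Computable (List.headI : List ℕ → ℕ) := Primrec.list_headI.to_comp
  have htail : Computable (List.tail : List ℕ → List ℕ) := Primrec.list_tail.to_comp
  have hnil : ComputablePred fun l : List ℕ => l = [] :=
    PrimrecPred.computablePred (Primrec.eq.comp Primrec.id (.const []))
  have hlt : ∀ l : List ℕ, ¬ l = [] → l.tail.length < l.length := by
    rintro (_ | ⟨a, l⟩) h
    · exact absurd rfl h
    · exact Nat.lt_succ_self _
  classical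
  obtain ⟨f, hf, h₀, h₁⟩ := exists_computable_rec (α := List ℕ) List.length
    (base := fun l => l = []) (g₀ := fun _ => 1) (c₁ := List.tail) (c₂ := List.tail)
    (g := fun x => if step (x.1.tail, x.1.headI) ∧ x.2.1 = 1 then 1 else 0)
    hnil (.const 1) htail htail (by fun_prop) hlt hlt
  refine ComputablePred.of_eq (p := fun l => f l = 1) (by fun_prop) fun l => ?_
  induction l with
  | nil =>
    rw [h₀ _ rfl]
    exact iff_of_true rfl ⟨[], trivial, rfl⟩
  | cons a l ih =>
    rw [h₁ _ (List.cons_ne_nil _ _)]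
    simp only [List.tail_cons, List.headI_cons, ih, ite_eq_left_iff, zero_ne_one, imp_false,
      not_not]
    constructor
    · rintro ⟨h1, Γ, h2, rfl⟩
      obtain ⟨φ, h3, rfl⟩ := step_iff_code.2 h1
      exact ⟨φ :: Γ, ⟨h3, h2⟩, rfl⟩
    · rintro ⟨_ | ⟨φ, Γ⟩, h1, h2⟩
      · cases h2
      · simp only [List.map_cons, List.cons.injEq] at h2
        obtain ⟨rfl, rfl⟩ := h2
        exact ⟨step_iff_code.1 ⟨φ, h1.1, rfl⟩, Γ, h1.2, rfl⟩

/-- Proofs are decidable: a total computable function sends codes of proofs to the code of their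
conclusion plus one, and all other numbers to `0`. -/
theorem exists_computable_proofRel
    (hF : Computable (fun f : Σ n, L.Functions n => f.1))
    (hR : Computable (fun R : Σ n, L.Relations n => R.1))
    {T : Set (Fm L)} (hrec : RecursivelyAxiomatized T) :
    ∃ f : ℕ → ℕ, Computable f ∧ ∀ n m, f n = m + 1 ↔ ProofRel T n m := by
  have hder := computablePred_isDerivation hF hR hrec
  have hsent := (computablePred_below hF hR).2
  have hhead : Computable (List.headI : List ℕ → ℕ) := Primrec.list_headI.to_comp
  have hdec : Computable (Denumerable.ofNat (List ℕ)) := Computable.ofNat _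
  have hnil : ComputablePred fun l : List ℕ => l = [] :=
    PrimrecPred.computablePred (Primrec.eq.comp Primrec.id (.const []))
  classical
  refine ⟨fun n => if (¬ Denumerable.ofNat (List ℕ) n = [] ∧
      ∃ Γ : List (Fm L), IsDerivation T Γ ∧ Γ.map code = Denumerable.ofNat (List ℕ) n) ∧
      ∃ φ : Fm L, φ.Below 0 ∧ code φ = (Denumerable.ofNat (List ℕ) n).headI
    then (Denumerable.ofNat (List ℕ) n).headI + 1 else 0, ?_, fun n m => ?_⟩
  · refine computable_ite (computablePred_and (computablePred_and (by fun_prop)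
      (computablePred_comp (f := fun n => Denumerable.ofNat (List ℕ) n) hder hdec)) ?_)
      (by fun_prop) (by fun_prop)
    exact computablePred_comp (f := fun n => (0, (Denumerable.ofNat (List ℕ) n).headI)) hsent
      (by fun_prop)
  · constructor
    · intro h
      dsimp only at h
      split_ifs at h with h1
      obtain ⟨⟨h2, Γ, h3, h4⟩, φ, h5, h6⟩ := h1
      rw [← h4] at h h2 h6
      cases Γ with
      | nil => exact absurd rfl h2
      | cons ψ l =>
        cases code_injective h6
        refine ⟨_, l, h3, h5, ?_, by simpa using h.symm⟩
        rw [h4]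
        exact (Denumerable.encode_ofNat n).symm
    · rintro ⟨φ, l, h1, h2, rfl, rfl⟩
      have h3 : Denumerable.ofNat (List ℕ) (encode ((φ :: l).map code)) = (φ :: l).map code :=
        Denumerable.ofNat_encode _
      dsimp only
      rw [h3, if_pos ⟨⟨by simp, φ :: l, h1, rfl⟩, φ, h2, rfl⟩]
      rfl

theorem exists_proofRel_iff {T : Set (Fm L)} {φ : Fm L} (hφ : φ.IsSentence) :
    (∃ n, ProofRel T n (code φ)) ↔ Provable T φ := by
  constructor
  · rintro ⟨n, ψ, l, h1, h2, -, h3⟩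
    cases code_injective h3
    exact ⟨l, h1⟩
  · rintro ⟨l, hl⟩
    exact ⟨_, φ, l, hl, hφ, rfl, rfl⟩

theorem ProofRel.exists_provable {T : Set (Fm L)} {n m : ℕ} (h : ProofRel T n m) :
    ∃ φ : Fm L, φ.IsSentence ∧ Provable T φ ∧ code φ = m := by
  obtain ⟨φ, l, h1, h2, -, rfl⟩ := h
  exact ⟨φ, h2, ⟨l, h1⟩, rfl⟩

end Proofs

/-! ### Computability of the diagonal functions -/

section Diagonal

variable {L : FirstOrder.Language.{u, v}} [Primcodable (Σ n, L.Functions n)]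

theorem exists_computable_num (ι : arith →ᴸ L) :
    ∃ f : ℕ → ℕ, Computable f ∧ ∀ n, f n = termCode (ι.onTerm (num n)) := by
  let e := encode (⟨1, ι.onFunction ArithFunc.succ⟩ : Σ n, L.Functions n)
  refine ⟨fun n => Nat.rec (motive := fun _ => ℕ) (termCode (ι.onTerm zero))
    (fun _ r => Nat.pair 1 (Nat.pair e (Nat.pair r 0 + 1))) n, ?_, fun n => ?_⟩
  · exact Computable.nat_rec Computable.id (.const _)
      (h := fun _ x => Nat.pair 1 (Nat.pair e (Nat.pair x.2 0 + 1)))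
      (Computable.to₂ (f := fun y : ℕ × ℕ × ℕ => Nat.pair 1 (Nat.pair e (Nat.pair y.2.2 0 + 1)))
        (by fun_prop))
  · induction n with
    | zero => rfl
    | succ n ih =>
      have h : ι.onTerm (num (n + 1)) =
          .func (ι.onFunction ArithFunc.succ) fun i => ι.onTerm (![num n] i) := rfl
      rw [h, termCode_func, encode_ofFn_succ, encode_ofFn_zero]
      simp only [ih]
      rfl

variable [Primcodable (Σ n, L.Relations n)]

theorem selfApp_code (ι : arith →ᴸ L) {A : Fm L} (hA : A.Below 1) :
    selfApp ι (code A) = code (A.inst (ι.onTerm (num (code A)))) := by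
  have h : ∃ B : Fm L, B.Below 1 ∧ code B = code A := ⟨A, hA, rfl⟩
  rw [selfApp, dif_pos h, code_injective h.choose_spec.2]

theorem computable_selfApp (hF : Computable (fun f : Σ n, L.Functions n => f.1))
    (hR : Computable (fun R : Σ n, L.Relations n => R.1)) (ι : arith →ᴸ L) :
    Computable (selfApp ι) := by
  obtain ⟨f, hf, hf'⟩ := exists_computable_inst (L := L)
  obtain ⟨g, hg, hg'⟩ := exists_computable_num ι
  have h1 : ComputablePred fun n : ℕ => ∃ A : Fm L, A.Below 1 ∧ code A = n :=
    computablePred_comp (f := fun n : ℕ => (1, n)) (computablePred_below hF hR).2 (by fun_prop)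
  classical
  refine (computable_ite h1 (show Computable fun n => f (g n, n) by fun_prop) (.const 0)).of_eq
    fun n => ?_
  by_cases h : ∃ A : Fm L, A.Below 1 ∧ code A = n
  · rw [if_pos h]
    obtain ⟨A, hA, rfl⟩ := h
    rw [selfApp_code ι hA, hg', hf']
  · rw [if_neg h, selfApp, dif_neg h]

end Diagonal

/-! ### Translation along a language inclusion -/

section Map

variable {L : FirstOrder.Language.{u, v}} {L' : FirstOrder.Language.{u', v'}} (ι : L' →ᴸ L)

theorem onTerm_subst (t : L'.Term ℕ) (s : ℕ → L'.Term ℕ) :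
    ι.onTerm (t.subst s) = (ι.onTerm t).subst fun n => ι.onTerm (s n) := by
  induction t with
  | var n => rfl
  | func f ts ih => simp only [Term.subst, FirstOrder.Language.LHom.onTerm, ih]

theorem onTerm_shift (t : L'.Term ℕ) : ι.onTerm (shift t) = shift (ι.onTerm t) := by
  rw [shift_eq_subst, onTerm_subst, shift_eq_subst]
  rfl

theorem onTerm_up (s : ℕ → L'.Term ℕ) :
    (fun n => ι.onTerm (up s n)) = up fun n => ι.onTerm (s n) := by
  funext n
  cases n with
  | zero => rfl
  | succ n => exact onTerm_shift ι _

theorem termBelow_onTerm {k : ℕ} {t : L'.Term ℕ} (h : TermBelow k t) :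
    TermBelow k (ι.onTerm t) := by
  induction t with
  | var n => exact h
  | func f ts ih => exact fun i => ih i (h i)

namespace Fm

theorem map_subst (φ : Fm L') (s : ℕ → L'.Term ℕ) :
    (φ.subst s).map ι = (φ.map ι).subst fun n => ι.onTerm (s n) := by
  induction φ generalizing s with
  | fal => rfl
  | eq t r => simp only [subst, map, onTerm_subst]
  | rel R ts => simp only [subst, map, onTerm_subst]
  | imp φ ψ ihφ ihψ => simp only [subst, map, ihφ, ihψ]
  | all φ ih => simp only [subst, map, ih, onTerm_up]

theorem map_inst (φ : Fm L') (t : L'.Term ℕ) : (φ.inst t).map ι = (φ.map ι).inst (ι.onTerm t) := by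
  rw [inst, inst, map_subst]
  congr 1; funext n
  cases n <;> rfl

theorem Below.map {φ : Fm L'} {k : ℕ} (h : φ.Below k) : (φ.map ι).Below k := by
  induction φ generalizing k with
  | fal => trivial
  | eq t r => exact ⟨termBelow_onTerm ι h.1, termBelow_onTerm ι h.2⟩
  | rel R ts => exact fun i => termBelow_onTerm ι (h i)
  | imp φ ψ ihφ ihψ => exact ⟨ihφ h.1, ihψ h.2⟩
  | all φ ih => exact ih (k := k + 1) h

theorem sat_map {M : Type w} [L.Structure M] [L'.Structure M] [ι.IsExpansionOn M] {φ : Fm L'}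
    {v : ℕ → M} : (φ.map ι).Sat v ↔ φ.Sat v := by
  induction φ generalizing v with
  | fal => rfl
  | eq t r => simp only [map, sat_eq, FirstOrder.Language.LHom.realize_onTerm]
  | rel R ts =>
    simp only [map, Sat, FirstOrder.Language.LHom.realize_onTerm]
    exact iff_of_eq (FirstOrder.Language.LHom.IsExpansionOn.map_onRelation R _)
  | imp φ ψ ihφ ihψ => simp only [map, sat_imp, ihφ, ihψ]
  | all φ ih => simp only [map, sat_all, ih]

end Fm

end Map

/-! ### Substitution in arithmetical formulas -/

section ArithSyntax

variable {s : ℕ → ATerm} {k : ℕ}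

theorem var_subst (n : ℕ) : (var n).subst s = s n := rfl

theorem succ_subst (t : ATerm) : (succ t).subst s = succ (t.subst s) :=
  congrArg (Term.func (L := arith) ArithFunc.succ) (funext fun i => by fin_cases i; rfl)

theorem add_subst (t r : ATerm) : (add t r).subst s = add (t.subst s) (r.subst s) :=
  congrArg (Term.func (L := arith) ArithFunc.add) (funext fun i => by fin_cases i <;> rfl)

theorem num_subst (n : ℕ) : (num n).subst s = num n := by
  induction n with
  | zero =>
    exact congrArg (Term.func (L := arith) ArithFunc.zero) (funext fun i => i.elim0)
  | succ n ih => rw [num, succ_subst, ih]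

theorem shift_num (n : ℕ) : shift (num n) = num n := by rw [shift_eq_subst, num_subst]

theorem le_subst (t r : ATerm) : (le t r).subst s = le (t.subst s) (r.subst s) := by
  simp only [le, Fm.ex, Fm.neg, Fm.subst, add_subst, var_subst, shift_subst_up]
  rfl

theorem isMin_subst (φ : AFm) (t : ATerm) :
    (isMin φ t).subst s = isMin (φ.subst (up s)) (t.subst s) := by
  simp only [isMin, Fm.and, Fm.neg, Fm.subst, Fm.inst_subst, le_subst, var_subst, shift_subst_up]
  rfl

theorem app_subst {φ : AFm} (hφ : φ.Below 2) (t r : ATerm) :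
    (φ.app t r).subst s = φ.app (t.subst s) (r.subst s) := by
  rw [Fm.app, Fm.app, Fm.subst_subst]
  refine Fm.subst_congr φ hφ fun i hi => ?_
  match i, hi with
  | 0, _ => rfl
  | 1, _ => rfl

theorem termBelow_var {n : ℕ} : TermBelow k (var n) ↔ n < k := Iff.rfl

theorem termBelow_succ {t : ATerm} : TermBelow k (succ t) ↔ TermBelow k t := by
  simp [succ, TermBelow]

theorem termBelow_add {t r : ATerm} : TermBelow k (add t r) ↔ TermBelow k t ∧ TermBelow k r := by
  simp [add, TermBelow, Fin.forall_fin_two]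

theorem termBelow_num (n : ℕ) : TermBelow k (num n) := by
  induction n with
  | zero => exact fun i => i.elim0
  | succ n ih => exact termBelow_succ.2 ih

theorem below_le {t r : ATerm} (ht : TermBelow k t) (hr : TermBelow k r) : (le t r).Below k :=
  ⟨⟨⟨termBelow_add.2 ⟨termBelow_var.2 (Nat.succ_pos k), termBelow_shift t ht⟩,
    termBelow_shift r hr⟩, trivial⟩, trivial⟩

theorem below_app {φ : AFm} (hφ : φ.Below 2) {t r : ATerm} (ht : TermBelow k t)
    (hr : TermBelow k r) : (φ.app t r).Below k :=
  hφ.subst fun i hi => match i, hi with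
  | 0, _ => ht
  | 1, _ => hr

theorem below_inst {φ : AFm} (hφ : φ.Below (k + 1)) {t : ATerm} (ht : TermBelow k t) :
    (φ.inst t).Below k :=
  hφ.subst fun i hi => match i, hi with
  | 0, _ => ht
  | _ + 1, hi => Nat.lt_of_succ_lt_succ hi

theorem below_and {φ ψ : AFm} (hφ : φ.Below k) (hψ : ψ.Below k) : (φ.and ψ).Below k :=
  ⟨⟨hφ, hψ, trivial⟩, trivial⟩

theorem below_ex {φ : AFm} (hφ : φ.Below (k + 1)) : φ.ex.Below k := ⟨⟨hφ, trivial⟩, trivial⟩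

theorem below_isMin {φ : AFm} (hφ : φ.Below (k + 1)) {t : ATerm} (ht : TermBelow k t) :
    (isMin φ t).Below k :=
  below_and (below_inst hφ ht) ⟨hφ, below_le (termBelow_shift t ht) (Nat.succ_pos k)⟩

end ArithSyntax

/-! ### Models of Robinson arithmetic and of Peano arithmetic -/

section ArithModels

open FirstOrder.Language.Structure (funMap)

variable {M : Type w} [arith.Structure M]

/-- Zero in a structure for the language of arithmetic. -/
def aZero : M := funMap (L := arith) ArithFunc.zero ![]

/-- The successor function of a structure for the language of arithmetic. -/
def aSucc (a : M) : M := funMap (L := arith) ArithFunc.succ ![a]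

/-- Addition in a structure for the language of arithmetic. -/
def aAdd (a b : M) : M := funMap (L := arith) ArithFunc.add ![a, b]

/-- The value of the numeral of `n`. -/
def aNum : ℕ → M
  | 0 => aZero
  | n + 1 => aSucc (aNum n)

/-- The relation defined by the formula `x ≤ y`. -/
def aLe (a b : M) : Prop := ∃ c, aAdd c a = b

/-- The binary relation defined by a formula in the free variables `0` and `1`. -/
def Sat₂ (φ : AFm) (a b : M) : Prop := φ.Sat (scons a fun _ => b)

variable {v : ℕ → M}

@[simp] theorem realize_var' (n : ℕ) : (var n).realize v = v n := rfl

@[simp] theorem realize_zero : zero.realize v = aZero :=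
  congrArg (funMap (L := arith) ArithFunc.zero) (funext fun i => i.elim0)

@[simp] theorem realize_succ (t : ATerm) : (succ t).realize v = aSucc (t.realize v) :=
  congrArg (funMap (L := arith) ArithFunc.succ) (funext fun i => by fin_cases i; rfl)

@[simp] theorem realize_add (t r : ATerm) :
    (add t r).realize v = aAdd (t.realize v) (r.realize v) :=
  congrArg (funMap (L := arith) ArithFunc.add) (funext fun i => by fin_cases i <;> rfl)

@[simp] theorem realize_num (n : ℕ) : (num n).realize v = aNum n := by
  induction n with
  | zero => exact realize_zero
  | succ n ih => rw [num, realize_succ, ih, aNum]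

@[simp] theorem sat_le (t r : ATerm) :
    (le t r).Sat v ↔ aLe (t.realize v) (r.realize v) := by
  simp [le, aLe]

@[simp] theorem sat_lt (t r : ATerm) :
    (lt t r).Sat v ↔ ¬ aLe (r.realize v) (t.realize v) := by
  simp [lt]

@[simp] theorem sat_isMin (φ : AFm) (t : ATerm) :
    (isMin φ t).Sat v ↔ φ.Sat (scons (t.realize v) v) ∧
      ∀ b, φ.Sat (scons b v) → aLe (t.realize v) b := by
  simp [isMin]

theorem sat_app {φ : AFm} (hφ : φ.Below 2) (t r : ATerm) :
    (φ.app t r).Sat v ↔ Sat₂ φ (t.realize v) (r.realize v) := by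
  rw [Fm.app, Fm.sat_subst]
  refine Fm.sat_congr hφ fun i hi => ?_
  match i, hi with
  | 0, _ => rfl
  | 1, _ => rfl

variable (M) in
/-- The facts about successor and addition that hold in the models of Robinson arithmetic. -/
structure QModel : Prop where
  succ_ne_zero : ∀ a : M, aSucc a ≠ aZero
  succ_inj : ∀ a b : M, aSucc a = aSucc b → a = b
  zero_or_succ : ∀ a : M, a = aZero ∨ ∃ b, a = aSucc b
  add_zero : ∀ a : M, aAdd a aZero = a
  add_succ : ∀ a b : M, aAdd a (aSucc b) = aSucc (aAdd a b)

theorem qModel_of_sat (h : ∀ φ, Q φ → ∀ v : ℕ → M, φ.Sat v) : QModel M where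
  succ_ne_zero a := by simpa using h _ .succ_ne_zero (fun _ => aZero) a
  succ_inj a b := by simpa using h _ .succ_inj (fun _ => aZero) a b
  zero_or_succ a := by simpa [or_iff_not_imp_left] using h _ .zero_or_succ (fun _ => aZero) a
  add_zero a := by simpa using h _ .add_zero (fun _ => aZero) a
  add_succ a b := by simpa using h _ .add_succ (fun _ => aZero) a b

namespace QModel

variable (hM : QModel M)
include hM

theorem num_injective : Function.Injective (aNum : ℕ → M) := by
  intro n
  induction n with
  | zero =>
    rintro (_ | m) h
    · rfl
    · exact absurd h.symm (hM.succ_ne_zero _)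
  | succ n ih =>
    rintro (_ | m) h
    · exact absurd h (hM.succ_ne_zero _)
    · rw [ih (hM.succ_inj _ _ h)]

theorem eq_num_of_le {n : ℕ} {a : M} (h : aLe a (aNum n)) : ∃ k, a = aNum k := by
  induction n generalizing a with
  | zero =>
    obtain ⟨c, hc⟩ := h
    rcases hM.zero_or_succ a with rfl | ⟨b, rfl⟩
    · exact ⟨0, rfl⟩
    · rw [hM.add_succ] at hc
      exact absurd hc (hM.succ_ne_zero _)
  | succ n ih =>
    obtain ⟨c, hc⟩ := h
    rcases hM.zero_or_succ a with rfl | ⟨b, rfl⟩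
    · exact ⟨0, rfl⟩
    · rw [hM.add_succ] at hc
      obtain ⟨k, rfl⟩ := ih ⟨c, hM.succ_inj _ _ hc⟩
      exact ⟨k + 1, rfl⟩

theorem eq_num_of_not_le {n : ℕ} {a : M} (h : ¬ aLe (aNum n) a) : ∃ k, a = aNum k := by
  induction n generalizing a with
  | zero => exact absurd ⟨a, hM.add_zero a⟩ h
  | succ n ih =>
    rcases hM.zero_or_succ a with rfl | ⟨b, rfl⟩
    · exact ⟨0, rfl⟩
    · obtain ⟨k, rfl⟩ := ih (a := b) fun ⟨c, hc⟩ => h ⟨c, by rw [aNum, hM.add_succ, hc]⟩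
      exact ⟨k + 1, rfl⟩

end QModel

variable (M) in
/-- The facts that hold in the models of Peano arithmetic: those for Robinson arithmetic, and
induction for arithmetical formulas with parameters. -/
structure PAModel : Prop extends QModel M where
  induction : ∀ (φ : AFm) (v : ℕ → M), φ.Sat (scons aZero v) →
    (∀ a, φ.Sat (scons a v) → φ.Sat (scons (aSucc a) v)) → ∀ a, φ.Sat (scons a v)

theorem paModel_of_sat (h : ∀ φ, PA φ → ∀ v : ℕ → M, φ.Sat v) : PAModel M where
  toQModel := qModel_of_sat fun φ hφ => h φ (.base φ hφ)
  induction φ v h0 hs := by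
    refine h _ (.induction φ) v (by simpa using h0) fun a ha => ?_
    rw [Fm.sat_subst]
    convert hs a ha using 1
    funext n
    cases n with
    | zero => exact realize_succ _
    | succ n => rfl

namespace PAModel

variable (hM : PAModel M)
include hM

theorem zero_add (a : M) : aAdd aZero a = a := by
  have h := hM.induction (.eq (add zero (var 0)) (var 0)) (fun _ => a)
  simp only [Fm.sat_eq, realize_add, realize_zero, realize_var', scons_zero] at h
  exact h (hM.add_zero _) (fun b hb => by rw [hM.add_succ, hb]) a

theorem succ_add (a b : M) : aAdd (aSucc a) b = aSucc (aAdd a b) := by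
  have h := hM.induction (.eq (add (succ (var 1)) (var 0)) (succ (add (var 1) (var 0))))
    (fun _ => a)
  simp only [Fm.sat_eq, realize_add, realize_succ, realize_var', scons_zero, scons_succ] at h
  exact h (by rw [hM.add_zero, hM.add_zero]) (fun c hc => by rw [hM.add_succ, hc, hM.add_succ]) b

theorem add_assoc (a b c : M) : aAdd (aAdd a b) c = aAdd a (aAdd b c) := by
  have h := hM.induction (.eq (add (add (var 1) (var 2)) (var 0))
    (add (var 1) (add (var 2) (var 0)))) (scons a fun _ => b)
  simp only [Fm.sat_eq, realize_add, realize_var', scons_zero, scons_succ] at h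
  exact h (by rw [hM.add_zero, hM.add_zero])
    (fun c hc => by rw [hM.add_succ, hM.add_succ, hM.add_succ, hc]) c

theorem add_succ_ne (a b : M) : aAdd a (aSucc b) ≠ b := by
  have h := hM.induction (.neg (.eq (add (var 1) (succ (var 0))) (var 0))) (fun _ => a)
  simp only [Fm.sat_neg, Fm.sat_eq, realize_add, realize_succ, realize_var', scons_zero,
    scons_succ] at h
  refine h ?_ (fun c hc hc' => hc ?_) b
  · rw [hM.add_succ]
    exact hM.succ_ne_zero _
  · rw [hM.add_succ] at hc'
    exact hM.succ_inj _ _ hc'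

theorem le_trans {a b c : M} (h : aLe a b) (h' : aLe b c) : aLe a c := by
  obtain ⟨d, rfl⟩ := h
  obtain ⟨e, rfl⟩ := h'
  exact ⟨aAdd e d, hM.add_assoc e d a⟩

/-- The least number principle for arithmetical formulas with parameters. -/
theorem exists_min (φ : AFm) (v : ℕ → M) (hφ : ∃ a, φ.Sat (scons a v)) :
    ∃ a, φ.Sat (scons a v) ∧ ∀ b, φ.Sat (scons b v) → aLe a b := by
  by_contra hmin
  push Not at hmin
  -- without a least element, every number is a lower bound, by induction
  have h := hM.induction
    (.all (.imp (φ.subst fun n => Nat.casesOn n (var 0) fun m => var (m + 2))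
      (le (var 1) (var 0)))) v
  have hsat : ∀ a b, (φ.subst fun n => Nat.casesOn n (var 0) fun m => var (m + 2)).Sat
      (scons b (scons a v)) ↔ φ.Sat (scons b v) := by
    intro a b
    rw [Fm.sat_subst]
    refine iff_of_eq (congrArg _ (funext fun n => ?_))
    cases n <;> rfl
  simp only [Fm.sat_all, Fm.sat_imp, hsat, sat_le, realize_var', scons_zero, scons_succ] at h
  have hlow := h (fun b _ => ⟨b, hM.add_zero b⟩) fun a ha b hb => ?_
  · obtain ⟨a, ha⟩ := hφ
    obtain ⟨c, hc⟩ := hlow (aSucc a) a ha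
    exact hM.add_succ_ne c a hc
  · obtain ⟨c, rfl⟩ := ha b hb
    rcases hM.zero_or_succ c with rfl | ⟨d, rfl⟩
    · rw [hM.zero_add] at hb
      obtain ⟨b, hb', hlt⟩ := hmin a hb
      exact absurd (ha b hb') hlt
    · exact ⟨d, by rw [hM.succ_add, hM.add_succ]⟩

end PAModel

end ArithModels

/-! ### Representability in models, and the diagonal sentences -/

section Representability

variable {L : FirstOrder.Language.{u, v}} {ι : arith →ᴸ L} {T : Set (Fm L)}

section Models

variable {M : Type w} [L.Structure M] [arith.Structure M] [ι.IsExpansionOn M]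

theorem qModel_of_extends (hQ : Extends ι T Q) (hM : Models M T) : QModel M :=
  qModel_of_sat fun φ hφ v => (Fm.sat_map ι).1 ((hQ φ hφ).sat hM v)

theorem paModel_of_extends (hPA : Extends ι T PA) (hM : Models M T) : PAModel M :=
  paModel_of_sat fun φ hφ v => (Fm.sat_map ι).1 ((hPA φ hφ).sat hM v)

theorem Represents.sat₂_iff {G : AFm} {f : ℕ → ℕ} (hG : Represents ι T G f) (hM : Models M T)
    (n : ℕ) (b : M) : Sat₂ G (aNum n) b ↔ b = aNum (f n) := by
  have h := (Fm.sat_map ι).1 ((hG.2 n).sat hM fun _ => aZero) b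
  simpa [sat_app hG.1] using h

theorem Represents.sat₂ {G : AFm} {f : ℕ → ℕ} (hG : Represents ι T G f) (hM : Models M T)
    (n : ℕ) : Sat₂ G (aNum n : M) (aNum (f n)) := (hG.sat₂_iff hM n _).2 rfl

end Models

variable [Primcodable (Σ n, L.Functions n)] [Primcodable (Σ n, L.Relations n)]

theorem ProofRel.unique {n m m' : ℕ} (h : ProofRel T n m) (h' : ProofRel T n m') : m = m' := by
  obtain ⟨φ, l, -, -, h1, rfl⟩ := h
  obtain ⟨φ', l', -, -, h2, rfl⟩ := h'
  have h3 := encode_injective (h1.symm.trans h2)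
  rw [List.map_cons, List.map_cons, List.cons.injEq] at h3
  exact h3.1

theorem provable_of_forall_arith_model (ι : arith →ᴸ L) (hT : ∀ φ ∈ T, φ.IsSentence) {φ : Fm L}
    (h : ∀ (M : Type u) [L.Structure M] [arith.Structure M] [ι.IsExpansionOn M], Models M T →
      ∀ v : ℕ → M, φ.Sat v) : Provable T φ := by
  have := countable_fm (L := L)
  refine provable_of_forall_model hT fun M _ hM v => ?_
  let _ := ι.reduct M
  exact h M hM v

theorem provable_map_of_forall_model (hT : ∀ φ ∈ T, φ.IsSentence) {φ : AFm}
    (h : ∀ (M : Type u) [L.Structure M] [arith.Structure M] [ι.IsExpansionOn M], Models M T →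
      ∀ v : ℕ → M, φ.Sat v) : Provable T (φ.map ι) :=
  provable_of_forall_arith_model ι hT fun M _ _ _ hM v => (Fm.sat_map ι).2 (h M hM v)

theorem exists_arith_model (ι : arith →ᴸ L) (hT : ∀ φ ∈ T, φ.IsSentence) (hcons : Consistent T) :
    ∃ (M : Type u) (_ : L.Structure M) (_ : arith.Structure M) (_ : ι.IsExpansionOn M),
      Models M T := by
  have := countable_fm (L := L)
  obtain ⟨M, hL, -, hM⟩ := exists_model hT hcons
  exact ⟨M, hL, ι.reduct M, inferInstance, hM⟩

variable {M : Type w} [L.Structure M] [arith.Structure M] [ι.IsExpansionOn M]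

/-- At standard arguments a proof formula has, in every model, exactly the values prescribed by the
actual proofs. -/
theorem RepresentsProof.sat₂_iff {P : AFm} (hP : RepresentsProof ι T P) (hM : Models M T)
    (n : ℕ) (b : M) : Sat₂ P (aNum n) b ↔ ∃ m, ProofRel T n m ∧ b = aNum m := by
  by_cases hn : ∃ m, ProofRel T n m
  · obtain ⟨m, hm⟩ := hn
    have h := (Fm.sat_map ι).1 ((hP.2.1 n m hm).sat hM fun _ => aZero) b
    simp only [Fm.sat_iff, sat_app hP.1, realize_num, realize_var', scons_zero, Fm.sat_eq] at h
    refine h.trans ⟨fun h' => ⟨m, hm, h'⟩, ?_⟩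
    rintro ⟨m', hm', rfl⟩
    rw [hm.unique hm']
  · have h := (Fm.sat_map ι).1 ((hP.2.2 n (not_exists.1 hn)).sat hM fun _ => aZero) b
    simp only [Fm.sat_neg, sat_app hP.1, realize_num, realize_var', scons_zero] at h
    exact iff_of_false h fun ⟨m, hm, _⟩ => hn ⟨m, hm⟩

theorem RepresentsProof.sat₂ {P : AFm} (hP : RepresentsProof ι T P) (hM : Models M T) {n m : ℕ}
    (h : ProofRel T n m) : Sat₂ P (aNum n : M) (aNum m) :=
  (hP.sat₂_iff hM n _).2 ⟨m, h, rfl⟩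

/-- A numeral that is a proof in a model is a proof. -/
theorem RepresentsProof.proofRel_of_sat₂ {P : AFm} (hP : RepresentsProof ι T P)
    (hQ : Extends ι T Q) (hM : Models M T) {n m : ℕ}
    (h : Sat₂ P (aNum n : M) (aNum m)) : ProofRel T n m := by
  obtain ⟨m', hm', h'⟩ := (hP.sat₂_iff hM n _).1 h
  rwa [(qModel_of_extends (ι := ι) hQ hM).num_injective h']

/-- A proof predicate exists. If the total function `f` sends proofs to the code of their conclusion
plus one, and is represented by `G`, then `G(x, S y)` is a proof predicate. -/
theorem exists_representsProof (hF : Computable (fun f : Σ n, L.Functions n => f.1))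
    (hR : Computable (fun R : Σ n, L.Relations n => R.1)) (hT : ∀ φ ∈ T, φ.IsSentence)
    (hrec : RecursivelyAxiomatized T) (hQ : Extends ι T Q) (hrep : RepresentsComputable ι T) :
    ∃ P : AFm, RepresentsProof ι T P := by
  obtain ⟨f, hf, hf'⟩ := exists_computable_proofRel hF hR hrec
  obtain ⟨G, hG⟩ := hrep f hf
  have hP : (G.app (var 0) (succ (var 1))).Below 2 :=
    below_app hG.1 (termBelow_var.2 Nat.two_pos)
      (termBelow_succ.2 (termBelow_var.2 Nat.one_lt_two))
  have hsat : ∀ (M : Type u) [arith.Structure M] (a b : M),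
      Sat₂ (G.app (var 0) (succ (var 1))) a b ↔ Sat₂ G a (aSucc b) := by
    intro M _ a b
    rw [Sat₂, sat_app hG.1]
    simp
  refine ⟨_, hP, fun n m hnm => provable_map_of_forall_model hT fun M _ _ _ hM v b => ?_,
    fun n hn => provable_map_of_forall_model hT fun M _ _ _ hM v b => ?_⟩
  · have hq := qModel_of_extends (ι := ι) hQ hM
    have h1 := hG.sat₂_iff hM n (aSucc b)
    rw [(hf' n m).2 hnm] at h1
    simp only [Fm.sat_iff, sat_app hP, realize_num, realize_var', scons_zero, Fm.sat_eq, hsat, h1]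
    exact ⟨hq.succ_inj _ _, congrArg _⟩
  · have hq := qModel_of_extends (ι := ι) hQ hM
    have h0 : f n = 0 := by
      by_contra h
      obtain ⟨m, hm⟩ := Nat.exists_eq_succ_of_ne_zero h
      exact hn m ((hf' n m).1 hm)
    have h1 := hG.sat₂_iff hM n (aSucc b)
    rw [h0] at h1
    simp only [Fm.sat_neg, sat_app hP, realize_num, realize_var', scons_zero, hsat, h1]
    exact hq.succ_ne_zero _

theorem below_preDiag {G E : AFm} (hG : G.Below 2) (hE : E.Below 1) : (preDiag G E).Below 1 :=
  ⟨below_app hG (termBelow_var.2 Nat.one_lt_two) (termBelow_var.2 Nat.two_pos),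
    hE.mono one_le_two⟩

theorem isSentence_diag {G E : AFm} (hG : G.Below 2) (hE : E.Below 1) :
    ((diag ι G E).map ι).IsSentence :=
  Fm.Below.map ι (below_inst (below_preDiag hG hE) (termBelow_num _))

/-- The diagonal sentence of `E(v)` asserts `E` of its own code. -/
theorem sat_diag {G E : AFm} (hG : Represents ι T G (selfApp ι)) (hE : E.Below 1)
    (hM : Models M T) (v : ℕ → M) :
    (diag ι G E).Sat v ↔ E.Sat (scons (aNum (code ((diag ι G E).map ι))) v) := by
  have hself : selfApp ι (code ((preDiag G E).map ι)) = code ((diag ι G E).map ι) := by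
    rw [selfApp_code ι (Fm.Below.map ι (below_preDiag hG.1 hE)), diag, Fm.map_inst]
  have h : ∀ a : M, E.Sat (scons a (scons (aNum (code ((preDiag G E).map ι))) v)) ↔
      E.Sat (scons a v) := fun a => Fm.sat_congr hE fun i hi => by
    rw [Nat.lt_one_iff.1 hi]; rfl
  have hpre : ∀ w : ℕ → M, (preDiag G E).Sat w ↔
      ∀ a, Sat₂ G (w 0) a → E.Sat (scons a w) := fun w => by simp [preDiag, sat_app hG.1]
  rw [← hself, diag, Fm.sat_inst, hpre]
  simp only [scons_zero, realize_num, hG.sat₂_iff hM, forall_eq, h]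

/-- The function `diagCode` is computable if the sentence form is uniform in its parameter, in that
it results from substitution of the numeral of the parameter into one fixed formula. -/
theorem computable_diagCode (hF : Computable (fun f : Σ n, L.Functions n => f.1))
    (hR : Computable (fun R : Σ n, L.Relations n => R.1)) {G B : AFm} {E : ℕ → AFm}
    (hB : ∀ n, preDiag G (E n) = B.inst (num n)) : Computable (diagCode ι G E) := by
  obtain ⟨f, hf, hf'⟩ := exists_computable_inst (L := L)
  obtain ⟨g, hg, hg'⟩ := exists_computable_num ι
  have h1 : ComputablePred fun n : ℕ => ∃ s : Fm L, s.IsSentence ∧ code s = n :=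
    computablePred_comp (f := fun n : ℕ => (0, n)) (computablePred_below hF hR).2 (by fun_prop)
  have h2 : ∀ n, f (g n, code (B.map ι)) = code ((preDiag G (E n)).map ι) := fun n => by
    rw [hB, Fm.map_inst, hg', hf']
  have h3 : ∀ n, f (g (f (g n, code (B.map ι))), f (g n, code (B.map ι))) =
      code ((diag ι G (E n)).map ι) := fun n => by
    rw [h2, hg', hf', diag, Fm.map_inst]
  classical
  refine (computable_ite h1 (show Computable fun n =>
    f (g (f (g n, code (B.map ι))), f (g n, code (B.map ι))) by fun_prop) (.const 0)).of_eq
    fun n => ?_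
  rw [h3, diagCode]

theorem diagCode_code {G : AFm} {E : ℕ → AFm} {s : Fm L} (hs : s.IsSentence) :
    diagCode ι G E (code s) = code ((diag ι G (E (code s))).map ι) := by
  rw [diagCode, if_pos ⟨s, hs, rfl⟩]

/-- The diagonal lemma. -/
theorem exists_isFixedPoint (hT : ∀ φ ∈ T, φ.IsSentence) {G E : AFm} {F : ℕ → AFm}
    (hG : Represents ι T G (selfApp ι)) (hE : E.Below 1)
    (hEF : ∀ (M : Type u) [arith.Structure M] (n : ℕ) (v : ℕ → M),
      E.Sat (scons (aNum n) v) ↔ (F n).Sat v) :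
    ∃ σ : Fm L, IsFixedPoint ι T F σ := by
  refine ⟨(diag ι G E).map ι, isSentence_diag hG.1 hE,
    provable_map_of_forall_model (φ := (diag ι G E).iff (F _)) hT fun M _ _ _ hM v => ?_⟩
  rw [Fm.sat_iff, sat_diag hG hE hM, hEF]

theorem IsFixedPoint.sat_iff {F : ℕ → AFm} {σ : Fm L} (h : IsFixedPoint ι T F σ)
    (hM : Models M T) (v : ℕ → M) : σ.Sat v ↔ (F (code σ)).Sat v := by
  have h1 := h.2.sat hM v
  rw [Fm.sat_iff, Fm.sat_map] at h1
  exact h1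

end Representability

/-! ### The sentences without minimality -/

section WithoutMinimality

variable {L : FirstOrder.Language.{u, v}} [Primcodable (Σ n, L.Functions n)]
  [Primcodable (Σ n, L.Relations n)] {ι : arith →ᴸ L} {T : Set (Fm L)} {P G H : AFm}

section Sat

variable {M : Type w} [arith.Structure M] {v : ℕ → M}

theorem sat_ext (hP : P.Below 2) (c : ℕ) : (ext P c).Sat v ↔
    ∀ x, Sat₂ P x (v 0) → ∃ y, Sat₂ P y (aNum c) ∧ aLe y x := by
  simp [ext, sat_app hP]

/-- `remote(b)` in a structure. -/
def SatRemote (P H : AFm) (b : M) : Prop :=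
  ∃ x, Sat₂ H b x ∧ ∃ z, Sat₂ P z x ∧ ∀ k, Sat₂ P k b → ¬ aLe k z

theorem sat_remote (hP : P.Below 2) (hH : H.Below 2) :
    (remote P H).Sat v ↔ SatRemote P H (v 0) := by
  simp [remote, SatRemote, sat_app hP, sat_app hH]

theorem sat_form (hP : P.Below 2) (hH : H.Below 2) (c : ℕ) : (form P H c).Sat v ↔
    ∀ x : M, Sat₂ P x (aNum c) → ∃ y : M, SatRemote P H y ∧ Sat₂ P x y := by
  simp [form, sat_app hP, sat_remote hP hH]

end Sat

theorem below_ext (hP : P.Below 2) (c : ℕ) : (ext P c).Below 1 :=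
  ⟨below_app hP (termBelow_var.2 (by norm_num)) (termBelow_var.2 (by norm_num)),
    below_ex (below_and (below_app hP (termBelow_var.2 (by norm_num)) (termBelow_num c))
      (below_le (termBelow_var.2 (by norm_num)) (termBelow_var.2 (by norm_num))))⟩

theorem sat_diag_ext {M : Type w} [L.Structure M] [arith.Structure M] [ι.IsExpansionOn M]
    (hP : P.Below 2) (hG : Represents ι T G (selfApp ι)) (hM : Models M T) (c : ℕ) (v : ℕ → M) :
    ((diag ι G (ext P c)).map ι).Sat v ↔
      ∀ x : M, Sat₂ P x (aNum (code ((diag ι G (ext P c)).map ι))) →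
        ∃ y, Sat₂ P y (aNum c) ∧ aLe y x := by
  rw [Fm.sat_map, sat_diag hG (below_ext hP c) hM, sat_ext hP, scons_zero]

theorem below_remote (hP : P.Below 2) (hH : H.Below 2) : (remote P H).Below 1 :=
  below_ex (below_and
    (below_app hH (termBelow_var.2 (by norm_num)) (termBelow_var.2 (by norm_num)))
    (below_ex (below_and
      (below_app hP (termBelow_var.2 (by norm_num)) (termBelow_var.2 (by norm_num)))
      ⟨below_app hP (termBelow_var.2 (by norm_num)) (termBelow_var.2 (by norm_num)),
        below_le (termBelow_var.2 (by norm_num)) (termBelow_var.2 (by norm_num)), trivial⟩)))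

theorem computable_diagCode_ext (hF : Computable (fun f : Σ n, L.Functions n => f.1))
    (hR : Computable (fun R : Σ n, L.Relations n => R.1)) (hP : P.Below 2) (hG : G.Below 2) :
    Computable (diagCode ι G (ext P)) := by
  refine computable_diagCode hF hR (B := .all (.imp (G.app (var 2) (var 0))
    (.all (.imp (P.app (var 0) (var 1)) (.ex (.and (P.app (var 0) (var 3))
      (le (var 0) (var 1)))))))) fun n => ?_
  simp only [Fm.inst, Fm.subst, Fm.ex, Fm.and, Fm.neg, app_subst hP, app_subst hG, le_subst,
    var_subst, up, shift_num, preDiag, ext]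
  rfl

theorem exists_isFixedPoint_form (hT : ∀ φ ∈ T, φ.IsSentence)
    (hG : Represents ι T G (selfApp ι)) (hP : P.Below 2) (hH : H.Below 2) :
    ∃ σ : Fm L, IsFixedPoint ι T (form P H) σ := by
  refine exists_isFixedPoint (E := .all (.imp (P.app (var 0) (var 1))
    (.ex (.and (remote P H) (P.app (var 1) (var 0)))))) hT hG ?_ fun M _ n v => ?_
  · exact ⟨below_app hP (termBelow_var.2 (by norm_num)) (termBelow_var.2 (by norm_num)),
      below_ex (below_and ((below_remote hP hH).mono (by norm_num))
        (below_app hP (termBelow_var.2 (by norm_num)) (termBelow_var.2 (by norm_num))))⟩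
  · rw [sat_form hP hH]
    simp [sat_app hP, sat_remote hP hH]

/-- Let `D` be the sentence "if I have a proof, then a smaller number proves `σ`". A proof of `σ`
would yield, by the fixed point property, a proof of `D` below all proofs of `σ`, which contradicts
`D`. A refutation of `σ` would show that no proof of `D` lies below all proofs of `σ`, which is what
`D` asserts; hence `D` would be provable, by a standard number, and a smaller, hence standard,
number would prove `σ`. -/
theorem undecidable_of_isFixedPoint_form (hT : ∀ φ ∈ T, φ.IsSentence) (hcons : Consistent T)
    (hQ : Extends ι T Q) (hP : RepresentsProof ι T P) (hG : Represents ι T G (selfApp ι))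
    (hH : Represents ι T H (diagCode ι G (ext P))) {σ : Fm L}
    (hσ : IsFixedPoint ι T (form P H) σ) : Undecidable T σ := by
  have hD := isSentence_diag (ι := ι) hG.1 (below_ext hP.1 (code σ))
  have hHσ := diagCode_code (ι := ι) (G := G) (E := ext P) hσ.1
  have hDsat := fun (M : Type u) [L.Structure M] [arith.Structure M] [ι.IsExpansionOn M]
    (hM : Models M T) => sat_diag_ext (M := M) hP.1 hG hM (code σ)
  generalize (diag ι G (ext P (code σ))).map ι = D at hD hHσ hDsat
  constructor
  · intro hprov
    obtain ⟨n, hn⟩ := (exists_proofRel_iff hσ.1).2 hprov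
    obtain ⟨M, _, _, _, hM⟩ := exists_arith_model ι hT hcons
    have hq := qModel_of_extends (ι := ι) hQ hM
    let v : ℕ → M := fun _ => aZero
    have h1 := (hσ.sat_iff hM v).1 (hprov.sat hM v)
    rw [sat_form hP.1 hH.1] at h1
    have hnσ : Sat₂ P (aNum n : M) (aNum (code σ)) := hP.sat₂ hM hn
    obtain ⟨y, ⟨x, h2, z, h3, h4⟩, h5⟩ := h1 _ hnσ
    obtain ⟨m, h6, rfl⟩ := (hP.sat₂_iff hM n y).1 h5
    obtain rfl : code σ = m := hn.unique h6
    rw [hH.sat₂_iff hM, hHσ] at h2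
    rw [h2] at h3
    obtain ⟨z, rfl⟩ := hq.eq_num_of_not_le (h4 _ hnσ)
    have hDprov : Provable T D :=
      (exists_proofRel_iff hD).1 ⟨z, hP.proofRel_of_sat₂ hQ hM h3⟩
    obtain ⟨k, h8, h9⟩ := (hDsat M hM v).1 (hDprov.sat hM v) _ h3
    exact h4 k h8 h9
  · intro hprov
    have hDprov : Provable T D := by
      refine provable_of_forall_arith_model ι hT fun M _ _ _ hM v => ?_
      have h1 : ¬ σ.Sat v := hprov.sat hM v
      rw [hσ.sat_iff hM v, sat_form hP.1 hH.1] at h1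
      push Not at h1
      obtain ⟨x, h2, h3⟩ := h1
      have h4 : ¬ SatRemote P H (aNum (code σ) : M) := fun h => h3 _ h h2
      rw [hDsat M hM]
      intro z hz
      by_contra h5
      push Not at h5
      exact h4 ⟨_, hH.sat₂ hM _, z, by rwa [hHσ], h5⟩
    obtain ⟨n, hn⟩ := (exists_proofRel_iff hD).2 hDprov
    obtain ⟨M, _, _, _, hM⟩ := exists_arith_model ι hT hcons
    have hq := qModel_of_extends (ι := ι) hQ hM
    let v : ℕ → M := fun _ => aZero
    obtain ⟨y, h2, h3⟩ := (hDsat M hM v).1 (hDprov.sat hM v) _ (hP.sat₂ hM hn)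
    obtain ⟨k, rfl⟩ := hq.eq_num_of_le h3
    exact Provable.false_of_neg hcons
      ((exists_proofRel_iff hσ.1).1 ⟨k, hP.proofRel_of_sat₂ hQ hM h2⟩) hprov

end WithoutMinimality

/-! ### The sentences in terms of minimal proofs -/

section MinimalProofs

variable {L : FirstOrder.Language.{u, v}} [Primcodable (Σ n, L.Functions n)]
  [Primcodable (Σ n, L.Relations n)] {ι : arith →ᴸ L} {T : Set (Fm L)} {P G H : AFm}

section Sat

variable {M : Type w} [arith.Structure M] {v : ℕ → M}

/-- `a` is the least number with the property `p`, in a structure. -/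
def IsMinimum (p : M → Prop) (a : M) : Prop := p a ∧ ∀ b, p b → aLe a b

theorem sat_extMin (hP : P.Below 2) (c : ℕ) : (extMin P c).Sat v ↔
    ∀ x y, Sat₂ P x (v 0) → IsMinimum (fun z => Sat₂ P z (aNum c)) y → aLe y x := by
  simp [extMin, sat_app hP, IsMinimum]

/-- `remote(b)` in a structure, in the version with minimal proofs. -/
def SatRemoteMin (P H : AFm) (b : M) : Prop :=
  ∃ x k z, Sat₂ H b x ∧ IsMinimum (fun n => Sat₂ P n b) k ∧
    IsMinimum (fun m => Sat₂ P m x) z ∧ ¬ aLe k z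

theorem sat_remoteMin (hP : P.Below 2) (hH : H.Below 2) :
    (remoteMin P H).Sat v ↔ SatRemoteMin P H (v 0) := by
  simp [remoteMin, SatRemoteMin, sat_app hP, sat_app hH, IsMinimum]

theorem sat_isK (hP : P.Below 2) (hH : H.Below 2) (t : ATerm) : (isK P H t).Sat v ↔
    IsMinimum (fun k => ∃ y, SatRemoteMin P H y ∧ Sat₂ P k y) (t.realize v) := by
  simp [isK, IsMinimum, sat_app hP, sat_remoteMin hP hH]

theorem sat_formMin (hP : P.Below 2) (hH : H.Below 2) (c : ℕ) : (formMin P H c).Sat v ↔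
    ∀ x : M, Sat₂ P x (aNum c) →
      ∃ k : M, IsMinimum (fun k => ∃ y, SatRemoteMin P H y ∧ Sat₂ P k y) k ∧ aLe k x := by
  simp [formMin, sat_app hP, sat_isK hP hH]

/-- If a sentence has a proof in a model of Peano arithmetic, then it has a least one. -/
theorem PAModel.exists_isMinimum_sat₂ (hM : PAModel M) (hP : P.Below 2) (b : M)
    (h : ∃ a, Sat₂ P a b) : ∃ a, IsMinimum (fun a => Sat₂ P a b) a := by
  have h1 := hM.exists_min (P.app (var 0) (var 1)) fun _ => b
  simp only [sat_app hP, realize_var', scons_zero, scons_succ] at h1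
  exact h1 h

theorem PAModel.exists_isMinimum_remoteMin (hM : PAModel M) (hP : P.Below 2) (hH : H.Below 2)
    (h : ∃ a : M, ∃ y, SatRemoteMin P H y ∧ Sat₂ P a y) :
    ∃ a : M, IsMinimum (fun a => ∃ y, SatRemoteMin P H y ∧ Sat₂ P a y) a := by
  have h1 := hM.exists_min (.ex (.and (remoteMin P H) (P.app (var 1) (var 0)))) fun _ => aZero
  simp only [Fm.sat_ex, Fm.sat_and, sat_app hP, sat_remoteMin hP hH, realize_var', scons_zero,
    scons_succ] at h1
  exact h1 h

end Sat

theorem below_extMin (hP : P.Below 2) (c : ℕ) : (extMin P c).Below 1 :=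
  ⟨below_and (below_app hP (termBelow_var.2 (by norm_num)) (termBelow_var.2 (by norm_num)))
    (below_isMin (below_app hP (termBelow_var.2 (by norm_num)) (termBelow_num c))
      (termBelow_var.2 (by norm_num))),
    below_le (termBelow_var.2 (by norm_num)) (termBelow_var.2 (by norm_num))⟩

theorem sat_diag_extMin {M : Type w} [L.Structure M] [arith.Structure M] [ι.IsExpansionOn M]
    (hP : P.Below 2) (hG : Represents ι T G (selfApp ι)) (hM : Models M T) (c : ℕ) (v : ℕ → M) :
    ((diag ι G (extMin P c)).map ι).Sat v ↔
      ∀ x y : M, Sat₂ P x (aNum (code ((diag ι G (extMin P c)).map ι))) →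
        IsMinimum (fun z => Sat₂ P z (aNum c)) y → aLe y x := by
  rw [Fm.sat_map, sat_diag hG (below_extMin hP c) hM, sat_extMin hP, scons_zero]

theorem below_remoteMin (hP : P.Below 2) (hH : H.Below 2) : (remoteMin P H).Below 1 :=
  below_ex (below_ex (below_ex (below_and
    (below_app hH (termBelow_var.2 (by norm_num)) (termBelow_var.2 (by norm_num)))
    (below_and (below_isMin (below_app hP (termBelow_var.2 (by norm_num))
        (termBelow_var.2 (by norm_num))) (termBelow_var.2 (by norm_num)))
      (below_and (below_isMin (below_app hP (termBelow_var.2 (by norm_num))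
        (termBelow_var.2 (by norm_num))) (termBelow_var.2 (by norm_num)))
        ⟨below_le (termBelow_var.2 (by norm_num)) (termBelow_var.2 (by norm_num)), trivial⟩)))))

theorem below_isK (hP : P.Below 2) (hH : H.Below 2) {k : ℕ} {t : ATerm} (ht : TermBelow k t) :
    (isK P H t).Below k :=
  below_isMin (below_ex (below_and ((below_remoteMin hP hH).mono (by omega))
    (below_app hP (termBelow_var.2 (by omega)) (termBelow_var.2 (by omega))))) ht

theorem computable_diagCode_extMin (hF : Computable (fun f : Σ n, L.Functions n => f.1))
    (hR : Computable (fun R : Σ n, L.Relations n => R.1)) (hP : P.Below 2) (hG : G.Below 2) :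
    Computable (diagCode ι G (extMin P)) := by
  refine computable_diagCode hF hR (B := .all (.imp (G.app (var 2) (var 0))
    (.all (.all (.imp (.and (P.app (var 1) (var 2)) (isMin (P.app (var 0) (var 4)) (var 0)))
      (le (var 0) (var 1))))))) fun n => ?_
  simp only [Fm.inst, Fm.subst, Fm.and, Fm.neg, app_subst hP, app_subst hG, le_subst, isMin_subst,
    var_subst, up, shift_num, preDiag, extMin]
  rfl

theorem exists_isFixedPoint_formMin (hT : ∀ φ ∈ T, φ.IsSentence)
    (hG : Represents ι T G (selfApp ι)) (hP : P.Below 2) (hH : H.Below 2) :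
    ∃ σ : Fm L, IsFixedPoint ι T (formMin P H) σ := by
  refine exists_isFixedPoint (E := .all (.imp (P.app (var 0) (var 1))
    (.ex (.and (isK P H (var 0)) (le (var 0) (var 1)))))) hT hG ?_ fun M _ n v => ?_
  · exact ⟨below_app hP (termBelow_var.2 (by norm_num)) (termBelow_var.2 (by norm_num)),
      below_ex (below_and (below_isK hP hH (termBelow_var.2 (by norm_num)))
        (below_le (termBelow_var.2 (by norm_num)) (termBelow_var.2 (by norm_num))))⟩
  · rw [sat_formMin hP hH]
    simp [sat_app hP, sat_isK hP hH]

/-- The argument is that of `undecidable_of_isFixedPoint_form`. A proof of `σ` bounds the least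
proof of a remote sentence, so that this least proof is standard and its conclusion is an actual
sentence `s`; the contradiction is then obtained for `s` in place of `σ`. Induction is used in the
other half, for the existence of least proofs. -/
theorem undecidable_of_isFixedPoint_formMin (hT : ∀ φ ∈ T, φ.IsSentence) (hcons : Consistent T)
    (hQ : Extends ι T Q) (hPA : Extends ι T PA) (hP : RepresentsProof ι T P)
    (hG : Represents ι T G (selfApp ι)) (hH : Represents ι T H (diagCode ι G (extMin P)))
    {σ : Fm L} (hσ : IsFixedPoint ι T (formMin P H) σ) : Undecidable T σ := by
  constructor
  · intro hprov
    obtain ⟨n, hn⟩ := (exists_proofRel_iff hσ.1).2 hprov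
    obtain ⟨M, _, _, _, hM⟩ := exists_arith_model ι hT hcons
    have hq := qModel_of_extends (ι := ι) hQ hM
    let v : ℕ → M := fun _ => aZero
    have h1 := (hσ.sat_iff hM v).1 (hprov.sat hM v)
    rw [sat_formMin hP.1 hH.1] at h1
    obtain ⟨k, ⟨⟨y, hrem, hky⟩, -⟩, hkn⟩ := h1 _ (hP.sat₂ hM hn)
    obtain ⟨k, rfl⟩ := hq.eq_num_of_le hkn
    obtain ⟨m, hkm, rfl⟩ := (hP.sat₂_iff hM k y).1 hky
    obtain ⟨s, hs, -, rfl⟩ := hkm.exists_provable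
    obtain ⟨x, k', z, h2, hk', hz, hlt⟩ := hrem
    have hD := isSentence_diag (ι := ι) hG.1 (below_extMin hP.1 (code s))
    have hDsat := sat_diag_extMin hP.1 hG hM (code s) v
    rw [hH.sat₂_iff hM, diagCode_code hs] at h2
    generalize (diag ι G (extMin P (code s))).map ι = D at hD hDsat h2
    rw [h2] at hz
    obtain ⟨k', rfl⟩ := hq.eq_num_of_le (hk'.2 _ hky)
    obtain ⟨z, rfl⟩ := hq.eq_num_of_not_le hlt
    have hDprov : Provable T D :=
      (exists_proofRel_iff hD).1 ⟨z, hP.proofRel_of_sat₂ hQ hM hz.1⟩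
    exact hlt (hDsat.1 (hDprov.sat hM v) _ _ hz.1 hk')
  · intro hprov
    have hD := isSentence_diag (ι := ι) hG.1 (below_extMin hP.1 (code σ))
    have hHσ := diagCode_code (ι := ι) (G := G) (E := extMin P) hσ.1
    have hDsat := fun (M : Type u) [L.Structure M] [arith.Structure M] [ι.IsExpansionOn M]
      (hM : Models M T) => sat_diag_extMin (M := M) hP.1 hG hM (code σ)
    generalize (diag ι G (extMin P (code σ))).map ι = D at hD hHσ hDsat
    -- in every model there is a proof of `σ`, but `σ` is not remote
    have key : ∀ (M : Type u) [L.Structure M] [arith.Structure M] [ι.IsExpansionOn M],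
        Models M T → (∃ x : M, Sat₂ P x (aNum (code σ))) ∧
          ¬ SatRemoteMin P H (aNum (code σ) : M) := by
      intro M _ _ _ hM
      have hpa := paModel_of_extends (ι := ι) hPA hM
      let v : ℕ → M := fun _ => aZero
      have h1 : ¬ σ.Sat v := hprov.sat hM v
      rw [hσ.sat_iff hM v, sat_formMin hP.1 hH.1] at h1
      push Not at h1
      obtain ⟨x, h2, h3⟩ := h1
      refine ⟨⟨x, h2⟩, fun hrem => ?_⟩
      obtain ⟨k, hk⟩ := hpa.exists_isMinimum_remoteMin hP.1 hH.1 ⟨x, _, hrem, h2⟩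
      exact h3 k hk (hk.2 x ⟨_, hrem, h2⟩)
    have hDprov : Provable T D := by
      refine provable_of_forall_arith_model ι hT fun M _ _ _ hM v => ?_
      have hpa := paModel_of_extends (ι := ι) hPA hM
      rw [hDsat M hM]
      intro x y hx hy
      obtain ⟨z, hz⟩ := hpa.exists_isMinimum_sat₂ hP.1 _ ⟨x, hx⟩
      have hyz : aLe y z := by
        by_contra h
        refine (key M hM).2 ⟨_, y, z, hH.sat₂ hM _, hy, ?_, h⟩
        rw [hHσ]
        exact hz
      exact hpa.le_trans hyz (hz.2 x hx)
    obtain ⟨n, hn⟩ := (exists_proofRel_iff hD).2 hDprov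
    obtain ⟨M, _, _, _, hM⟩ := exists_arith_model ι hT hcons
    have hq := qModel_of_extends (ι := ι) hQ hM
    have hpa := paModel_of_extends (ι := ι) hPA hM
    let v : ℕ → M := fun _ => aZero
    have h1 := (hDsat M hM v).1 (hDprov.sat hM v)
    obtain ⟨y, hy⟩ := hpa.exists_isMinimum_sat₂ hP.1 _ (key M hM).1
    obtain ⟨k, rfl⟩ := hq.eq_num_of_le (h1 _ _ (hP.sat₂ hM hn) hy)
    exact Provable.false_of_neg hcons
      ((exists_proofRel_iff hσ.1).1 ⟨k, hP.proofRel_of_sat₂ hQ hM hy.1⟩) hprov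

end MinimalProofs

end Goedel

/-! ### The incompleteness theorem -/

open scoped FirstOrder in
open Goedel in
/-- Gödel's first incompleteness theorem under mere consistency, with two explicit undecidable
sentences. The language `L` of `T` is any computably presented language that contains (via `ι`) the
language of arithmetic. -/
theorem mainTheorem1 {L : FirstOrder.Language}
    [Primcodable (Σ n, L.Functions n)] [Primcodable (Σ n, L.Relations n)]
    (hF : Computable (fun f : Σ n, L.Functions n => f.1))
    (hR : Computable (fun R : Σ n, L.Relations n => R.1))
    (ι : arith →ᴸ L) (T : Set (Fm L)) (hT : ∀ φ ∈ T, φ.IsSentence)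
    (hrec : RecursivelyAxiomatized T) (hcons : Consistent T)
    (hQ : Extends ι T Q) (hrep : RepresentsComputable ι T) :
    -- `T` is incomplete
    ¬ Complete T ∧
    -- the proof relation of `T` and the self-application function are representable in `T`
    (∃ P : AFm, RepresentsProof ι T P) ∧ (∃ G : AFm, Represents ι T G (selfApp ι)) ∧
    ∀ P G : AFm, RepresentsProof ι T P → Represents ι T G (selfApp ι) →
      -- the fixed points in terms of minimal proofs, if `T` extends Peano arithmetic
      (Extends ι T PA →
        (∃ H : AFm, Represents ι T H (diagCode ι G (extMin P))) ∧
        ∀ H : AFm, Represents ι T H (diagCode ι G (extMin P)) →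
          (∃ σ : Fm L, IsFixedPoint ι T (formMin P H) σ) ∧
          ∀ σ : Fm L, IsFixedPoint ι T (formMin P H) σ → Undecidable T σ) ∧
      -- the fixed points that avoid minimality, for every `T`
      ((∃ H : AFm, Represents ι T H (diagCode ι G (ext P))) ∧
        ∀ H : AFm, Represents ι T H (diagCode ι G (ext P)) →
          (∃ σ : Fm L, IsFixedPoint ι T (form P H) σ) ∧
          ∀ σ : Fm L, IsFixedPoint ι T (form P H) σ → Undecidable T σ) := by
  obtain ⟨P₀, hP₀⟩ := exists_representsProof hF hR hT hrec hQ hrep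
  obtain ⟨G₀, hG₀⟩ := hrep _ (computable_selfApp hF hR ι)
  refine ⟨fun hc => ?_, ⟨P₀, hP₀⟩, ⟨G₀, hG₀⟩, fun P G hP hG =>
    ⟨fun hPA => ⟨hrep _ (computable_diagCode_extMin hF hR hP.1 hG.1), fun H hH =>
        ⟨exists_isFixedPoint_formMin hT hG hP.1 hH.1, fun σ hσ =>
          undecidable_of_isFixedPoint_formMin hT hcons hQ hPA hP hG hH hσ⟩⟩,
      hrep _ (computable_diagCode_ext hF hR hP.1 hG.1), fun H hH =>
        ⟨exists_isFixedPoint_form hT hG hP.1 hH.1, fun σ hσ =>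
          undecidable_of_isFixedPoint_form hT hcons hQ hP hG hH hσ⟩⟩⟩
  obtain ⟨H, hH⟩ := hrep _ (computable_diagCode_ext hF hR hP₀.1 hG₀.1)
  obtain ⟨σ, hσ⟩ := exists_isFixedPoint_form hT hG₀ hP₀.1 hH.1
  have hu := undecidable_of_isFixedPoint_form hT hcons hQ hP₀ hG₀ hH hσ
  exact (hc σ hσ.1).elim hu.1 hu.2
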